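/- **Setting.** Let $L_2=L_2([0,1],\mathrm{Leb})$ with norm $\|\cdot\|_2$ and inner product $\langle\cdot,\cdot\rangle$. Let $D^\uparrow$ be the set of càdlàg nondecreasing functions $[0,1]\to[-\infty,\infty]$ that are continuous at $1$, and $L_2^\uparrow\subset L_2$ the set of classes of functions from $D^\uparrow$. For $g\in L_2$ let $L_2(g)$ be the closed subspace of those $f\in L_2$ that are measurable for the Lebesgue completion of $\sigma(g)$, and $\mathrm{pr}_g$ the orthogonal projection of $L_2$ onto $L_2(g)$. Fix a bounded $\xi\in D^\uparrow$ and put $L_2^\uparrow(\xi)=L_2^\uparrow\cap L_2(\xi)$, with the topology of $L_2$. *The measure $\Xi$.* For $n\ge1$ let $Q^n=\{0<q_1<\dots<q_{n-1}<1\}$, $q_0=0$, $q_n=1$, $E^n=\{x\in\mathbb R^n: x_1\le\dots\le x_n\}$, and $\chi_n(q,x)=\sum_{i=1}^n x_i\mathbb 1_{[q_{i-1},q_i)}+x_n\mathbb 1_{\{1\}}$. Let $\nu_n(q,\cdot)$ be the image under $\chi_n(q,\cdot)$ of Lebesgue measure on $E^n$, and $$\Xi=\sum_{n\ge1}\int_{Q^n}\prod_{i=1}^n(q_i-q_{i-1})\,\nu_n(q,\cdot)\,d\xi^{\otimes(n-1)}(q),$$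 where $d\xi$ is the Lebesgue–Stieltjes measure of $\xi$ and the term $n=1$ is the image of Lebesgue measure on $\mathbb R$ under $x\mapsto x\mathbb 1_{[0,1]}$. We regard $\Xi$ as a Borel measure on $L_2^\uparrow(\xi)$. *The form.* Let $\mathcal{FC}$ be the linear span of the functions $U(g)=u(\langle g,h_1\rangle,\dots,\langle g,h_m\rangle)\,\varphi(\|g\|_2^2)$ with $u\in C_b^\infty(\mathbb R^m)$, $\varphi\in C_0^\infty(\mathbb R)$, $h_j\in L_2(\xi)$. For $U,V\in\mathcal{FC}$ let $\mathrm DU(g)=\mathrm{pr}_g[\nabla^{L_2}U(g)]$ and $$\mathcal E(U,V)=\tfrac12\int_{L_2^\uparrow(\xi)}\langle \mathrm DU(g),\mathrm DV(g)\rangle\,\Xi(dg).$$ Let $(\mathcal E,\mathbb D)$ be the closure of $(\mathcal E,\mathcal{FC})$ on $L_2(\Xi)$, and $\mathcal E_1=\mathcal E+\langle\cdot,\cdot\rangle_{L_2(\Xi)}$. *Notions.* For $K\subset L_2^\uparrow(\xi)$ let $\mathbb D_K=\{U\in\mathbb D: U=0\ \Xi\text{-a.e. off }K\}$. An increasing sequence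 of closed sets $K_n$ is an *$\mathcal E$-nest* if $\bigcup_n\mathbb D_{K_n}$ is dense in $\mathbb D$ for $\mathcal E_1^{1/2}$. A set is *$\mathcal E$-exceptional* if it is contained in $\bigcap_n K_n^c$ for some $\mathcal E$-nest $(K_n)$. A function is *$\mathcal E$-quasi-continuous* if its restriction to each $K_n$ is continuous for some $\mathcal E$-nest $(K_n)$. **Statement.** $(\mathcal E,\mathcal{FC})$ is well defined and closable on $L_2(\Xi)$, and its closure $(\mathcal E,\mathbb D)$ is a symmetric Dirichlet form. It is quasi-regular, that is: 1. there is an $\mathcal E$-nest consisting of compact sets; in fact the sets $K_n=\{g\in L_2^\uparrow(\xi):\|g\|_{2+1/n}\le n\}$, $n\ge1$, are compact and form an $\mathcal E$-nest; 2. there is an $\mathcal E_1^{1/2}$-dense subset of $\mathbb D$ whose elements have $\mathcal E$-quasi-continuous $\Xi$-versions; 3. there are $U_n\in\mathbb D$, $n\in\mathbb N$, with $\mathcal E$-quasi-continuous $\Xi$-versions $\widetilde U_n$, and an $\mathcal E$-exceptional set $A\subset L_2^\uparrow(\xi)$, such that $\{\widetilde U_n\}$ separates the points of $L_2^\uparrow(\xi)\setminus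 A$. Moreover $(\mathcal E,\mathbb D)$ has the local property: $\mathcal E(U,V)=0$ for all $U,V\in\mathbb D$ for which $\mathrm{supp}(U\cdot\Xi)$ and $\mathrm{supp}(V\cdot\Xi)$ are compact and disjoint. -/

import Mathlib

open MeasureTheory Filter Topology Set
open scoped ENNReal unitInterval ContDiff

noncomputable section

namespace StickyFlow

/-! ### Symmetric Dirichlet forms, nests and quasi-regularity on a topological measure space -/

section General

variable {E : Type*} [TopologicalSpace E] [MeasurableSpace E]

/-- The data of a form on `L²(E; m)`: a domain, and the value of the form at two elements.
The values outside of the domain are never used, and the laws are those of `IsDirichletForm`. -/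
structure L2Form (m : Measure E) where
  dom : Set (Lp ℝ 2 m)
  form : Lp ℝ 2 m → Lp ℝ 2 m → ℝ

namespace L2Form

variable {m : Measure E} (𝓔 : L2Form m)

/-- `𝓔₁(U, V) = 𝓔(U, V) + ⟨U, V⟩`. -/
def form₁ (U V : Lp ℝ 2 m) : ℝ := 𝓔.form U V + inner ℝ U V

/-- `S` is a subset of the domain that is dense in it for the norm `𝓔₁^{1/2}`. -/
def DenseInDom (S : Set (Lp ℝ 2 m)) : Prop :=
  S ⊆ 𝓔.dom ∧ ∀ U ∈ 𝓔.dom, ∀ ε > (0 : ℝ), ∃ V ∈ S, 𝓔.form₁ (U - V) (U - V) < ε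

/-- A symmetric Dirichlet form: a densely defined, nonnegative, symmetric bilinear form that is
closed and on which the unit contraction operates. -/
structure IsDirichletForm : Prop where
  zero_mem : (0 : Lp ℝ 2 m) ∈ 𝓔.dom
  add_mem : ∀ U ∈ 𝓔.dom, ∀ V ∈ 𝓔.dom, U + V ∈ 𝓔.dom
  smul_mem : ∀ c : ℝ, ∀ U ∈ 𝓔.dom, c • U ∈ 𝓔.dom
  dense : Dense 𝓔.dom
  symm : ∀ U ∈ 𝓔.dom, ∀ V ∈ 𝓔.dom, 𝓔.form U V = 𝓔.form V U
  add_left : ∀ U ∈ 𝓔.dom, ∀ V ∈ 𝓔.dom, ∀ W ∈ 𝓔.dom,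
    𝓔.form (U + V) W = 𝓔.form U W + 𝓔.form V W
  smul_left : ∀ c : ℝ, ∀ U ∈ 𝓔.dom, ∀ V ∈ 𝓔.dom, 𝓔.form (c • U) V = c * 𝓔.form U V
  nonneg : ∀ U ∈ 𝓔.dom, 0 ≤ 𝓔.form U U
  closed : ∀ u : ℕ → Lp ℝ 2 m, (∀ n, u n ∈ 𝓔.dom) →
    (∀ ε > (0 : ℝ), ∃ N, ∀ k ≥ N, ∀ l ≥ N, 𝓔.form₁ (u k - u l) (u k - u l) < ε) →
    ∃ U ∈ 𝓔.dom, Tendsto (fun n => 𝓔.form₁ (u n - U) (u n - U)) atTop (𝓝 0)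
  markov : ∀ U ∈ 𝓔.dom, ∃ V ∈ 𝓔.dom, (V =ᵐ[m] fun x => min (max (U x) 0) 1) ∧
    𝓔.form V V ≤ 𝓔.form U U

/-- `𝔻_K`: the elements of the domain that vanish a.e. outside of `K`. -/
def domOn (K : Set E) : Set (Lp ℝ 2 m) :=
  {U | U ∈ 𝓔.dom ∧ ∀ᵐ x ∂m, x ∉ K → U x = 0}

/-- An `𝓔`-nest. -/
structure IsNest (K : ℕ → Set E) : Prop where
  mono : Monotone K
  closed : ∀ n, IsClosed (K n)
  dense : 𝓔.DenseInDom (⋃ n, 𝓔.domOn (K n))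

/-- An `𝓔`-exceptional set: it is contained in the complement of an `𝓔`-nest. -/
def IsExceptional (A : Set E) : Prop :=
  ∃ K : ℕ → Set E, 𝓔.IsNest K ∧ A ⊆ ⋂ n, (K n)ᶜ

/-- `𝓔`-quasi-continuity: the restrictions to the sets of some `𝓔`-nest are continuous. -/
def IsQuasiContinuous (f : E → ℝ) : Prop :=
  ∃ K : ℕ → Set E, 𝓔.IsNest K ∧ ∀ n, ContinuousOn f (K n)

/-- Quasi-regularity. -/
structure IsQuasiRegular : Prop where
  compact_nest : ∃ K : ℕ → Set E, 𝓔.IsNest K ∧ ∀ n, IsCompact (K n)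
  dense_quasiContinuous : ∃ S : Set (Lp ℝ 2 m), 𝓔.DenseInDom S ∧
    ∀ U ∈ S, ∃ f : E → ℝ, 𝓔.IsQuasiContinuous f ∧ f =ᵐ[m] U
  separating : ∃ (U : ℕ → Lp ℝ 2 m) (f : ℕ → E → ℝ) (A : Set E),
    (∀ n, U n ∈ 𝓔.dom ∧ 𝓔.IsQuasiContinuous (f n) ∧ f n =ᵐ[m] U n) ∧
    𝓔.IsExceptional A ∧ ∀ x ∉ A, ∀ y ∉ A, x ≠ y → ∃ n, f n x ≠ f n y

/-- The topological support of the (signed) measure `U · m`, that is, of `|U| · m`. -/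
def supp (U : Lp ℝ 2 m) : Set E := (m.withDensity fun x => ‖U x‖ₑ).support

/-- The local property. -/
def HasLocalProperty : Prop :=
  ∀ U ∈ 𝓔.dom, ∀ V ∈ 𝓔.dom, IsCompact (supp U) → IsCompact (supp V) →
    supp U ∩ supp V = ∅ → 𝓔.form U V = 0

end L2Form

end General

/-! ### The space of square integrable nondecreasing functions -/

/-- `L₂ = L₂([0,1], Lebesgue)`, with its Borel σ-algebra. -/
abbrev L2 : Type := Lp ℝ 2 (volume : Measure I)

instance : MeasurableSpace L2 := borel L2

instance : BorelSpace L2 := ⟨rfl⟩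

/-- `D↑`: the càdlàg nondecreasing functions from `[0,1]` to the extended real line that are
continuous at `1` (left limits exist by monotonicity). -/
def Dup : Set (I → EReal) :=
  {f | Monotone f ∧ (∀ s, ContinuousWithinAt f (Ici s) s) ∧ ContinuousAt f 1}

/-- `L₂↑`: the classes in `L₂` of functions from `D↑`. -/
def L2up : Set L2 := {g | ∃ f ∈ Dup, ∀ᵐ s : I, f s = ((g s : ℝ) : EReal)}

/-- The σ-algebra on `[0,1]` generated by a real function. -/
abbrev sigmaAlg (f : I → ℝ) : MeasurableSpace I := MeasurableSpace.comap f inferInstance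

/-- `L₂(f)`: the classes in `L₂` of functions that are measurable for the Lebesgue completion of
`σ(f)`, that is, that agree a.e. with a `σ(f)`-measurable function. -/
def L2sub (f : I → ℝ) : Submodule ℝ L2 := lpMeas ℝ ℝ (sigmaAlg f) 2 (volume : Measure I)

/-- `pr_g`: the orthogonal projection of `L₂` onto `L₂(g)`. -/
def pr (g : L2) (h : L2) : L2 :=
  (condExpL2 (μ := (volume : Measure I)) ℝ ℝ (m := sigmaAlg g)
    (Lp.stronglyMeasurable g).measurable.comap_le h : L2)

/-- `L₂↑(ξ) = L₂(ξ) ∩ L₂↑`, with the topology and the Borel σ-algebra of `L₂`. -/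
abbrev L2upOf (ξ : I → ℝ) : Type := {g : L2 // g ∈ L2up ∧ g ∈ L2sub ξ}

/-! ### The measure `Ξ`

In this part the index `n` stands for step functions with at most `n` jumps, hence `n + 1` pieces,
with jump points `q 0 < ⋯ < q (n - 1)` and values `x 0 ≤ ⋯ ≤ x n`. -/

/-- The left ends `0, q 0, …, q (n - 1)` of the pieces. -/
def leftEnd {n : ℕ} (q : Fin n → I) : Fin (n + 1) → I := Fin.cons 0 q

/-- The right ends `q 0, …, q (n - 1), 1` of the pieces. -/
def rightEnd {n : ℕ} (q : Fin n → I) : Fin (n + 1) → I := Fin.snoc q 1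

/-- The jump points `0 < q 0 < ⋯ < q (n - 1) < 1`. -/
def jumpSet (n : ℕ) : Set (Fin n → I) := {q | StrictMono q ∧ ∀ i, 0 < q i ∧ q i < 1}

/-- The nondecreasing vectors of length `n`. -/
def monoCone (n : ℕ) : Set (Fin n → ℝ) := {x | Monotone x}

/-- The class in `L₂` of the step function with jump points `q` and values `x`. -/
def chi {n : ℕ} (q : Fin n → I) (x : Fin (n + 1) → ℝ) : L2 :=
  ∑ i, indicatorConstLp 2 (μ := (volume : Measure I))
    (measurableSet_Ico (a := leftEnd q i) (b := rightEnd q i)) (measure_ne_top _ _) (x i)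

/-- The image under `χ(q, ·)` of Lebesgue measure on the cone of nondecreasing vectors. -/
def nu {n : ℕ} (q : Fin n → I) : Measure L2 :=
  ((volume : Measure (Fin (n + 1) → ℝ)).restrict (monoCone (n + 1))).map (chi q)

/-- The measure `∏ (lengths of the pieces) dξ^{⊗ n}` on the jump points; `ξ.measure` is the
Lebesgue–Stieltjes measure of `ξ`. -/
def muJump (ξ : StieltjesFunction I) (n : ℕ) : Measure (Fin n → I) :=
  ((Measure.pi fun _ : Fin n => ξ.measure).restrict (jumpSet n)).withDensity fun q =>
    ∏ i, ENNReal.ofReal ((rightEnd q i : ℝ) - (leftEnd q i : ℝ))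

/-- The part of `Ξ` that lives on step functions with `n + 1` pieces:
`A ↦ ∫ (∏ lengths) ν(q, A) dξ^{⊗ n}(q)`. For `n = 0` it is the image of Lebesgue measure on `ℝ`
under `x ↦ x · 1_{[0,1]}`. -/
def XiPart (ξ : StieltjesFunction I) (n : ℕ) : Measure L2 := (muJump ξ n).bind nu

/-- The measure `Ξ` on `L₂↑(ξ)`. -/
def Xi (ξ : StieltjesFunction I) : Measure (L2upOf ξ) :=
  (Measure.sum (XiPart ξ)).comap Subtype.val

/-! ### The form `(𝓔, 𝔻)` -/

/-- `C_b^∞(ℝ^m)`: smooth functions that are bounded with all their derivatives. -/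
def CbInf {m : ℕ} (u : (Fin m → ℝ) → ℝ) : Prop :=
  ContDiff ℝ ∞ u ∧ ∀ k : ℕ, ∃ C : ℝ, ∀ y, ‖iteratedFDeriv ℝ k u y‖ ≤ C

/-- `𝓕𝓒`: the linear span of the functions `g ↦ u(⟨g, h₁⟩, …, ⟨g, h_m⟩) φ(‖g‖²)` with
`u ∈ C_b^∞(ℝ^m)`, `φ ∈ C_0^∞(ℝ)` and `h_j ∈ L₂(ξ)`. They are given on the whole of `L₂`, where they
are differentiable. -/
def FC (ξ : StieltjesFunction I) : Submodule ℝ (L2 → ℝ) :=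
  Submodule.span ℝ {U | ∃ (m : ℕ) (u : (Fin m → ℝ) → ℝ) (φ : ℝ → ℝ) (h : Fin m → L2),
    CbInf u ∧ ContDiff ℝ ∞ φ ∧ HasCompactSupport φ ∧ (∀ j, h j ∈ L2sub ξ) ∧
    U = fun g => u (fun j => inner ℝ g (h j)) * φ (‖g‖ ^ 2)}

/-- `D U(g) = pr_g [∇U(g)]`. -/
def DD (U : L2 → ℝ) (g : L2) : L2 := pr g (gradient U g)

/-- `𝓔(U, V) = ½ ∫ ⟨D U(g), D V(g)⟩ Ξ(dg)` on `𝓕𝓒`. -/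
def preForm (ξ : StieltjesFunction I) (U V : L2 → ℝ) : ℝ :=
  (1 / 2) * ∫ g : L2upOf ξ, inner ℝ (DD U g) (DD V g) ∂(Xi ξ)

/-- `u` is an `𝓔`-Cauchy sequence in `𝓕𝓒` that converges to `U` in `L₂(Ξ)`. -/
structure Approx (ξ : StieltjesFunction I) (u : ℕ → L2 → ℝ) (U : Lp ℝ 2 (Xi ξ)) : Prop where
  mem : ∀ n, u n ∈ FC ξ
  cauchy : ∀ ε > (0 : ℝ), ∃ N, ∀ k ≥ N, ∀ l ≥ N, preForm ξ (u k - u l) (u k - u l) < ε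
  tendsto : Tendsto (fun n => eLpNorm (fun g : L2upOf ξ => u n g - U g) 2 (Xi ξ)) atTop (𝓝 0)

/-- `(𝓔, 𝓕𝓒)` is well defined and closable on `L₂(Ξ)`: the functions in `𝓕𝓒` are square
integrable, the integrals that define `𝓔` exist, and `𝓔(u_n, u_n) → 0` for every `𝓔`-Cauchy
sequence `u_n` in `𝓕𝓒` that converges to `0` in `L₂(Ξ)`. -/
structure IsClosablePreForm (ξ : StieltjesFunction I) : Prop where
  memLp : ∀ U ∈ FC ξ, MemLp (fun g : L2upOf ξ => U g) 2 (Xi ξ)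
  integrable : ∀ U ∈ FC ξ, ∀ V ∈ FC ξ,
    Integrable (fun g : L2upOf ξ => (inner ℝ (DD U g) (DD V g) : ℝ)) (Xi ξ)
  closable : ∀ u : ℕ → L2 → ℝ, Approx ξ u 0 →
    Tendsto (fun n => preForm ξ (u n) (u n)) atTop (𝓝 0)

open Classical in
/-- `(𝓔, 𝔻)`, the closure of `(𝓔, 𝓕𝓒)` on `L₂(Ξ)`: its domain consists of the limits in `L₂(Ξ)` of
`𝓔`-Cauchy sequences in `𝓕𝓒`, and `𝓔(U, V) = lim 𝓔(u_n, v_n)` for such sequences `u_n → U` and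
`v_n → V`. -/
def closureForm (ξ : StieltjesFunction I) : L2Form (Xi ξ) where
  dom := {U | ∃ u, Approx ξ u U}
  form U V :=
    if h : (∃ u, Approx ξ u U) ∧ (∃ v, Approx ξ v V) then
      limUnder atTop fun n => preForm ξ (h.1.choose n) (h.2.choose n)
    else 0

/-- `{g ∈ L₂↑(ξ) : ‖g‖_{2 + 1/n} ≤ n}`. -/
def normBall (ξ : StieltjesFunction I) (n : ℕ) : Set (L2upOf ξ) :=
  {g | eLpNorm (g : L2) (2 + 1 / (n : ℝ≥0∞)) (volume : Measure I) ≤ (n : ℝ≥0∞)}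

end StickyFlow

end

/-! The measure Ξ is a sum over n of images of product measures under (q, x) ↦ χ(q, x), so all
questions are moved to the parameters. For almost all of them the jump points and the values
increase strictly (`ae_goodSet`). There pr_g is averaging over the pieces of g (`pr_chi`), χ is
injective (`chi_injOn`), and the inner product of DU with the i-th piece is the partial derivative
of x ↦ U(χ(q, x)) in x_i (`fderiv_comp_chi`). The form is thus a superposition over q of gradient
forms on open cones with Lebesgue measure.

Integrability: bounding the indicator of a ball of radius R by exp(t(R² − ‖g‖²)) splits the integral
over the values into one-dimensional Gaussian integrals. The product of the lengths makes them
bounded uniformly in q, and for large t the series in n is geometric. The extra weight 1 + ‖g‖₃³ is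
absorbed by the same Gaussians (`lintegral_ballWeight_lt_top`).

Closability and locality are one fact (`grad_eq_zero_on_open`): if (U, W) is a limit of pairs (u,
Du) and U vanishes on an open set, then so does W. On almost every fibre one integrates by parts
against test functions compactly supported in the part of the open cone that is mapped into the open
set, so no boundary term appears. The whole space as open set gives uniqueness of the gradient;
hence the domain is the projection of the closed graph `gradGraph`, and the form is ½⟨W, W'⟩.
Complements of supports give the local property.

Weak compactness enters through `exists_mem_of_bounded_snd`: in a closed convex set of pairs,
convergence of the first components with bounded second components is enough. Combined with
polynomial approximation of the unit contraction it yields the Markov property. Density of 𝓕𝓒 in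
L₂(Ξ) is injectivity of the Fourier transform.

The sets K_n are compact because a truncated nondecreasing function is uniformly close to a
combination of finitely many indicators of intervals [a, 1], while the bound in L_{2+1/n} controls
the truncation error in L₂. They form a nest because of the potential Φ(g) = ∫ (1 + g²)^{5/4}:
formally its gradient has squared norm at most a constant times 1 + ‖g‖₃³, which is integrable over
balls, and sublevel sets of Φ lie in some K_n. As Φ is not a cylinder function, it is replaced by
its value at averages over uniform partitions, where Jensen's inequality gives the same bound.
Smooth cutoffs of Φ at level M then approximate every u in 𝓕𝓒, with bounded gradients, as M → ∞. The
rest of quasi-regularity holds because functions in 𝓕𝓒 are continuous. -/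

noncomputable section

namespace StickyFlow

/-! ### Classes of nondecreasing functions -/

/-- A sequence converging in `Lp` has an almost everywhere convergent subsequence. -/
theorem exists_subseq_tendsto_ae {α F : Type*} [MeasurableSpace α] [NormedAddCommGroup F]
    {μ : Measure α} {p : ℝ≥0∞} [Fact (1 ≤ p)] {u : ℕ → Lp F p μ} {g : Lp F p μ}
    (h : Tendsto u atTop (𝓝 g)) :
    ∃ ns : ℕ → ℕ, StrictMono ns ∧ ∀ᵐ s ∂μ, Tendsto (fun k => u (ns k) s) atTop (𝓝 (g s)) :=
  (tendstoInMeasure_of_tendsto_Lp h).exists_seq_tendsto_ae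

/-- The representative is the right limit of g along S, which is monotone and right-continuous. It
differs from g on S only at jumps, and these are countable. The criterion in terms of a full set S
is stable under almost everywhere limits. -/
theorem mem_L2up_of_monotoneOn {g : L2} {S : Set I} (hS : ∀ᵐ s : I, s ∈ S)
    (hg : MonotoneOn g S) : g ∈ L2up := by
  classical
  let F : I → EReal := fun s => ⨅ t : {t : I // t ∈ S ∧ s < t}, ((g t : ℝ) : EReal)
  -- At 1 the infimum runs over the empty set and equals ⊤, so the left limit is used there instead.
  let f : I → EReal := fun s => if s = 1 then ⨆ t : {t : I // t < 1}, F t else F s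
  have hF : Monotone F := by
    intro s t hst
    refine le_iInf fun u => ?_
    exact iInf_le (fun t : {t : I // t ∈ S ∧ s < t} => ((g t : ℝ) : EReal))
      ⟨u.1, u.2.1, hst.trans_lt u.2.2⟩
  have hf1 : ∀ s, s ≠ 1 → f s = F s := fun s hs => by simp [f, hs]
  have hf : Monotone f := by
    intro s t hst
    by_cases ht : t = 1
    · by_cases hs : s = 1
      · rw [hs, ht]
      · rw [hf1 s hs]
        simp only [f, ht, if_true]
        exact le_iSup (fun t : {t : I // t < 1} => F t) ⟨s, lt_of_le_of_ne unitInterval.le_one' hs⟩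
    · have hs : s ≠ 1 := by
        rintro rfl
        exact ht (le_antisymm unitInterval.le_one' hst)
      rw [hf1 s hs, hf1 t ht]
      exact hF hst
  refine ⟨f, ⟨hf, ?_, ?_⟩, ?_⟩
  · intro s
    by_cases hs : s = 1
    · subst hs
      have : Ici (1 : I) = {1} := by
        ext x; simp only [mem_Ici, mem_singleton_iff]
        exact ⟨fun h => le_antisymm unitInterval.le_one' h, fun h => h.ge⟩
      rw [this]
      exact continuousWithinAt_singleton
    refine tendsto_order.2 ⟨fun a ha => ?_, fun b hb => ?_⟩
    · exact eventually_nhdsWithin_of_forall fun x hx => ha.trans_le (hf hx)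
    · rw [hf1 s hs] at hb
      obtain ⟨t, ht⟩ := iInf_lt_iff.1 hb
      have : Iio t.1 ∈ 𝓝[≥] s := mem_nhdsWithin_of_mem_nhds (Iio_mem_nhds t.2.2)
      filter_upwards [this] with x hx
      rw [hf1 x (ne_of_lt (lt_of_lt_of_le hx unitInterval.le_one'))]
      exact lt_of_le_of_lt (iInf_le (fun t : {t : I // t ∈ S ∧ x < t} => ((g t : ℝ) : EReal))
        ⟨t.1, t.2.1, hx⟩) ht
  · refine tendsto_order.2 ⟨fun a ha => ?_, fun b hb => ?_⟩
    · have ha' : a < ⨆ t : {t : I // t < 1}, F t := by simpa [f] using ha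
      obtain ⟨t, ht⟩ := lt_iSup_iff.1 ha'
      filter_upwards [Ioi_mem_nhds t.2] with x hx
      refine ht.trans_le ?_
      rw [← hf1 t.1 t.2.ne]
      exact hf (le_of_lt hx)
    · exact Eventually.of_forall fun x => (hf unitInterval.le_one').trans_lt hb
  -- The intervals (g s, F s) at distinct exceptional points are disjoint, and each contains a
  -- rational.
  · have hc : {s : I | s ∈ S ∧ s ≠ 1 ∧ F s ≠ ((g s : ℝ) : EReal)}.Countable := by
      have key : ∀ s ∈ {s : I | s ∈ S ∧ s ≠ 1 ∧ F s ≠ ((g s : ℝ) : EReal)},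
          ∃ r : ℚ, ((g s : ℝ) : EReal) < ((r : ℝ) : EReal) ∧ ((r : ℝ) : EReal) < F s := by
        rintro s ⟨hs, h1, h2⟩
        have : ((g s : ℝ) : EReal) ≤ F s :=
          le_iInf fun t => by exact_mod_cast hg hs t.2.1 t.2.2.le
        exact EReal.lt_iff_exists_rat_btwn.1 (lt_of_le_of_ne this h2.symm)
      choose! r hr1 hr2 using key
      refine MapsTo.countable_of_injOn (f := r) (t := univ) (fun _ _ => mem_univ _) ?_
        countable_univ
      have aux : ∀ s ∈ {s : I | s ∈ S ∧ s ≠ 1 ∧ F s ≠ ((g s : ℝ) : EReal)},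
          ∀ t ∈ {s : I | s ∈ S ∧ s ≠ 1 ∧ F s ≠ ((g s : ℝ) : EReal)}, r s = r t → ¬ s < t := by
        intro s hs t ht hst hlt
        have h1 : F s ≤ ((g t : ℝ) : EReal) :=
          iInf_le (fun t : {t : I // t ∈ S ∧ s < t} => ((g t : ℝ) : EReal)) ⟨t, ht.1, hlt⟩
        have h2 := hr2 s hs
        rw [hst] at h2
        exact absurd ((h2.trans_le h1).trans (hr1 t ht)) (lt_irrefl _)
      intro s hs t ht hst
      exact le_antisymm (not_lt.1 (aux t ht s hs hst.symm)) (not_lt.1 (aux s hs t ht hst))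
    have h1 : ∀ᵐ s : I, s ≠ 1 := by simp [ae_iff]
    filter_upwards [hS, h1, hc.ae_notMem volume] with s h2 h3 h4
    rw [hf1 s h3]
    by_contra h5
    exact h4 ⟨h2, h3, h5⟩

theorem exists_monotoneOn_of_mem_L2up {g : L2} (hg : g ∈ L2up) :
    ∃ S : Set I, (∀ᵐ s : I, s ∈ S) ∧ MonotoneOn g S := by
  obtain ⟨f, hf, h⟩ := hg
  refine ⟨{s | f s = ((g s : ℝ) : EReal)}, h, fun s hs t ht hst => ?_⟩
  have := hf.1 hst
  rw [hs, ht] at this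
  exact_mod_cast this

theorem isClosed_L2up : IsClosed L2up := by
  refine IsSeqClosed.isClosed fun u g hu hlim => ?_
  obtain ⟨ns, -, hns⟩ := exists_subseq_tendsto_ae hlim
  choose S hS hm using fun n => exists_monotoneOn_of_mem_L2up (hu n)
  refine mem_L2up_of_monotoneOn
    (S := {s | Tendsto (fun k => u (ns k) s) atTop (𝓝 (g s)) ∧ ∀ n, s ∈ S n}) ?_ ?_
  · filter_upwards [hns, ae_all_iff.2 hS] with s h1 h2 using ⟨h1, h2⟩
  · intro s hs t ht hst
    exact le_of_tendsto_of_tendsto' hs.1 ht.1 fun k => hm _ (hs.2 _) (ht.2 _) hst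

theorem isClosed_L2sub {f : I → ℝ} (hf : Measurable f) : IsClosed (L2sub f : Set L2) :=
  isClosed_aestronglyMeasurable (F := ℝ) (p := 2) hf.comap_le

theorem measurable_stieltjes (ξ : StieltjesFunction I) : Measurable ξ := ξ.mono.measurable

theorem isClosed_L2upOf (ξ : StieltjesFunction I) :
    IsClosed {g : L2 | g ∈ L2up ∧ g ∈ L2sub ξ} :=
  isClosed_L2up.inter (isClosed_L2sub (measurable_stieltjes ξ))

/-- Lower semicontinuity of the norm (Fatou) along an almost everywhere convergent subsequence. -/
theorem isClosed_normBall (ξ : StieltjesFunction I) (n : ℕ) : IsClosed (normBall ξ n) := by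
  refine IsSeqClosed.isClosed fun u g hu hlim => ?_
  obtain ⟨ns, -, hns⟩ := exists_subseq_tendsto_ae
    ((continuous_subtype_val.tendsto g).comp hlim)
  exact Lp.eLpNorm_le_of_ae_tendsto (Eventually.of_forall fun k => hu (ns k))
    (fun k => Lp.aestronglyMeasurable _) hns

/-- The class of the indicator function of `[a, 1]`. -/
def tailInd (a : I) : L2 :=
  indicatorConstLp 2 (μ := (volume : Measure I)) (measurableSet_Ici (a := a)) (measure_ne_top _ _)
    (1 : ℝ)

/-- The class of the indicator function of `[a, b)`. -/
def pieceInd (a b : I) : L2 :=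
  indicatorConstLp 2 (μ := (volume : Measure I)) (measurableSet_Ico (a := a) (b := b))
    (measure_ne_top _ _) (1 : ℝ)

theorem tailInd_coeFn (a : I) : ∀ᵐ s : I, tailInd a s = (Ici a).indicator (fun _ => (1 : ℝ)) s :=
  indicatorConstLp_coeFn

theorem pieceInd_coeFn (a b : I) :
    ∀ᵐ s : I, pieceInd a b s = (Ico a b).indicator (fun _ => (1 : ℝ)) s :=
  indicatorConstLp_coeFn

theorem pieceInd_eq_sub (a b : I) : pieceInd a b = tailInd a - tailInd (max a b) := by
  refine Lp.ext ?_
  filter_upwards [tailInd_coeFn a, tailInd_coeFn (max a b), pieceInd_coeFn a b,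
    Lp.coeFn_sub (tailInd a) (tailInd (max a b))] with s h1 h2 h3 h4
  rw [h3, h4, Pi.sub_apply, h1, h2]
  simp only [indicator, mem_Ico, mem_Ici, sup_le_iff]
  by_cases h5 : a ≤ s <;> by_cases h6 : b ≤ s <;> simp [h5, h6, not_lt.2, not_le.1]

theorem continuous_tailInd : Continuous tailInd := by
  refine continuous_iff_continuousAt.2 fun a => ?_
  refine tendsto_indicatorConstLp_set (by norm_num) ?_
  have h : ∀ b : I, volume (symmDiff (Ici b) (Ici a)) ≤ ENNReal.ofReal |(b : ℝ) - a| := by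
    intro b
    rcases le_total a b with h | h
    · have : symmDiff (Ici b) (Ici a) ⊆ Ico a b := by
        rintro x (⟨h1, h2⟩ | ⟨h1, h2⟩)
        · exact absurd (h.trans h1) h2
        · exact ⟨h1, not_le.1 h2⟩
      refine (measure_mono this).trans ?_
      rw [unitInterval.volume_Ico]
      exact ENNReal.ofReal_le_ofReal (le_abs_self _)
    · have : symmDiff (Ici b) (Ici a) ⊆ Ico b a := by
        rintro x (⟨h1, h2⟩ | ⟨h1, h2⟩)
        · exact ⟨h1, not_le.1 h2⟩
        · exact absurd (h.trans h1) h2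
      refine (measure_mono this).trans ?_
      rw [unitInterval.volume_Ico]
      exact ENNReal.ofReal_le_ofReal (by rw [abs_sub_comm]; exact le_abs_self _)
  refine tendsto_of_tendsto_of_tendsto_of_le_of_le tendsto_const_nhds ?_ (fun _ => zero_le) h
  have : Continuous fun b : I => ENNReal.ofReal |(b : ℝ) - a| :=
    ENNReal.continuous_ofReal.comp (by fun_prop)
  simpa using this.tendsto a

theorem continuous_pieceInd : Continuous fun p : I × I => pieceInd p.1 p.2 := by
  simp_rw [pieceInd_eq_sub]
  exact (continuous_tailInd.comp continuous_fst).sub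
    (continuous_tailInd.comp (continuous_fst.max continuous_snd))

/-! ### Compactness of the balls of `L_{2+1/n}` in `L₂↑(ξ)` -/

/-- Truncation at the levels `-B` and `B`. -/
def clip (B y : ℝ) : ℝ := max (-B) (min y B)

/-- Where |y| > B the error is at most |y| = |y|^(1−r) |y|^r, and 1 − r ≤ 0. This turns a bound in
L_{2r} into a small truncation error in L₂. -/
theorem abs_sub_clip_le {B r : ℝ} (hB : 0 < B) (hr : 1 ≤ r) (y : ℝ) :
    |y - clip B y| ≤ B ^ (1 - r) * |y| ^ r := by
  rcases le_or_gt |y| B with h | h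
  · have : clip B y = y := by
      rw [abs_le] at h
      simp [clip, h.1, h.2]
    rw [this, sub_self, abs_zero]
    positivity
  · have h1 : |y - clip B y| ≤ |y| := by
      unfold clip
      rcases lt_abs.1 h with h2 | h2
      · rw [min_eq_right h2.le, max_eq_right (by linarith), abs_of_nonneg (by linarith),
          abs_of_pos (by linarith)]
        linarith
      · rw [min_eq_left (by linarith), max_eq_left (by linarith), abs_of_neg (by linarith),
          abs_of_neg (by linarith)]
        linarith
    have hy : 0 < |y| := hB.trans h
    have h2 : |y| = |y| ^ (1 - r) * |y| ^ r := by
      rw [← Real.rpow_add hy]; simp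
    calc |y - clip B y| ≤ |y| := h1
      _ = |y| ^ (1 - r) * |y| ^ r := h2
      _ ≤ B ^ (1 - r) * |y| ^ r := by
        gcongr ?_ * _
        exact Real.rpow_le_rpow_of_nonpos hB h.le (by linarith)

/-- The sum counts the integers 1, …, J that are at most z, so it is the integer part of z cut off
at J. -/
theorem sum_indicator_levels (J : ℕ) (z : ℝ) :
    |max 0 (min z J) - ∑ j ∈ Finset.range J, (if (j : ℝ) + 1 ≤ z then (1 : ℝ) else 0)| ≤ 1 := by
  rw [Finset.sum_boole]
  have h : (Finset.range J).filter (fun j : ℕ => (j : ℝ) + 1 ≤ z) =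
      Finset.range (min J ⌊z⌋₊) := by
    ext j
    simp only [Finset.mem_filter, Finset.mem_range, lt_min_iff, and_congr_right_iff]
    intro _
    rw [← Nat.succ_le_iff, Nat.le_floor_iff' (Nat.succ_ne_zero j)]
    push_cast; rfl
  rw [h, Finset.card_range]
  push_cast
  rcases le_or_gt z 0 with hz | hz
  · rw [Nat.floor_of_nonpos hz, min_eq_left (hz.trans (Nat.cast_nonneg J)), max_eq_left hz]
    simp
  · have h1 := Nat.floor_le hz.le
    have h2 := Nat.lt_floor_add_one z
    rw [max_eq_right (le_min hz.le (Nat.cast_nonneg J)), abs_le]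
    rcases le_total z J with h3 | h3
    · rw [min_eq_left h3, min_eq_right (h1.trans h3)]
      constructor <;> linarith
    · rw [min_eq_right h3]
      rcases le_total (J : ℝ) ⌊z⌋₊ with h4 | h4
      · rw [min_eq_left h4]; constructor <;> linarith
      · rw [min_eq_right h4]; constructor <;> linarith

theorem abs_clip_sub_levels {B : ℝ} (hB : 0 < B) {J : ℕ} (hJ : 0 < J) (y : ℝ) :
    |clip B y - (-B + 2 * B / J * ∑ j ∈ Finset.range J,
      (if -B + 2 * B / J * ((j : ℝ) + 1) ≤ y then (1 : ℝ) else 0))| ≤ 2 * B / J := by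
  have hJ' : (0 : ℝ) < J := Nat.cast_pos.2 hJ
  set δ := 2 * B / J with hδ
  have hδ0 : 0 < δ := by positivity
  have hδJ : δ * J = 2 * B := by rw [hδ]; field_simp
  have h := sum_indicator_levels J ((y + B) / δ)
  have h1 : ∀ j : ℕ, ((j : ℝ) + 1 ≤ (y + B) / δ) ↔ (-B + δ * ((j : ℝ) + 1) ≤ y) := by
    intro j
    rw [le_div_iff₀ hδ0]
    constructor <;> intro h <;> linarith
  simp_rw [h1] at h
  have h2 : clip B y = -B + δ * max 0 (min ((y + B) / δ) J) := by
    rw [mul_max_of_nonneg _ _ hδ0.le, mul_min_of_nonneg _ _ hδ0.le, hδJ, mul_zero,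
      mul_div_cancel₀ _ hδ0.ne', clip, ← max_add_add_left, ← min_add_add_left]
    ring_nf
  rw [h2, show ∀ a b : ℝ, -B + δ * a - (-B + δ * b) = δ * (a - b) by intros; ring, abs_mul,
    abs_of_pos hδ0]
  exact mul_le_of_le_one_right hδ0.le h

/-- A superlevel set of a nondecreasing function is an interval [a, 1] up to its left end. This is
where monotonicity produces compactness: such sets form a one-parameter family. -/
theorem exists_tailInd_eq_level {g : L2} (hg : g ∈ L2up) (c : ℝ) :
    ∃ a : I, ∀ᵐ s : I, tailInd a s = if c ≤ g s then (1 : ℝ) else 0 := by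
  obtain ⟨S, hS, hm⟩ := exists_monotoneOn_of_mem_L2up hg
  refine ⟨sInf {s | s ∈ S ∧ c ≤ g s}, ?_⟩
  set a := sInf {s | s ∈ S ∧ c ≤ g s}
  have h1 : ∀ᵐ s : I, s ≠ a := by simp [ae_iff]
  filter_upwards [tailInd_coeFn a, hS, h1] with s h2 h3 h4
  rw [h2, indicator]
  have key : s ∈ Ici a ↔ c ≤ g s := by
    refine ⟨fun h => ?_, fun h => sInf_le (show s ∈ {s | s ∈ S ∧ c ≤ g s} from ⟨h3, h⟩)⟩
    obtain ⟨t, ht, hts⟩ := sInf_lt_iff.1 (lt_of_le_of_ne h h4.symm)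
    exact ht.2.trans (hm ht.1 h3 hts.le)
  simp only [key]

theorem tailInd_zero_coeFn : ∀ᵐ s : I, tailInd 0 s = (1 : ℝ) := by
  filter_upwards [tailInd_coeFn 0] with s h
  rw [h, indicator_of_mem (show s ∈ Ici (0 : I) from unitInterval.nonneg')]

/-- Nondecreasing functions with values in `[-B, B]` are uniformly close to sums of finitely many
indicator functions. -/
theorem exists_levels_approx {g : L2} (hg : g ∈ L2up) {B : ℝ} (hB : 0 < B) {J : ℕ} (hJ : 0 < J) :
    ∃ a : Fin J → I, ∀ᵐ s : I,
      |clip B (g s) - ((-B) • tailInd 0 + (2 * B / J) • ∑ j, tailInd (a j) : L2) s| ≤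
        2 * B / J := by
  choose a ha using fun j : Fin J => exists_tailInd_eq_level hg (-B + 2 * B / J * ((j : ℝ) + 1))
  refine ⟨a, ?_⟩
  filter_upwards [ae_all_iff.2 ha, tailInd_zero_coeFn,
    Lp.coeFn_add ((-B) • tailInd 0) ((2 * B / J) • ∑ j, tailInd (a j)),
    Lp.coeFn_smul (-B) (tailInd 0), Lp.coeFn_smul (2 * B / J) (∑ j, tailInd (a j)),
    Lp.coeFn_fun_finsetSum Finset.univ (fun j => tailInd (a j))] with s h1 h2 h3 h4 h5 h6
  rw [h3, Pi.add_apply, h4, h5, Pi.smul_apply, Pi.smul_apply, h2, h6]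
  simp_rw [h1]
  rw [Fin.sum_univ_eq_sum_range
    (fun j : ℕ => if -B + 2 * B / J * ((j : ℝ) + 1) ≤ g s then (1 : ℝ) else 0) J]
  simpa using abs_clip_sub_levels hB hJ (g s)

/-- Up to 2ε/3, each g lies on the image of the compact cube I^J under a continuous map into L₂. One
third pays for truncation at B, one for the discretisation into J levels, and one for a finite net
of the image. -/
theorem totallyBounded_L2up_inter {r : ℝ} (hr : 1 < r) {N : ℝ≥0∞} (hN : N ≠ ⊤) :
    TotallyBounded {g : L2 | g ∈ L2up ∧ eLpNorm g (2 * ENNReal.ofReal r) volume ≤ N} := by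
  rw [EMetric.totallyBounded_iff]
  intro ε hε
  have hlim : Tendsto (fun B : ℝ => ENNReal.ofReal (B ^ (1 - r)) * N ^ r) atTop (𝓝 0) := by
    have h1 : Tendsto (fun B : ℝ => B ^ (1 - r)) atTop (𝓝 0) := by
      rw [show 1 - r = -(r - 1) by ring]
      exact tendsto_rpow_neg_atTop (by linarith)
    have h2 := ENNReal.tendsto_ofReal h1
    rw [ENNReal.ofReal_zero] at h2
    simpa using ENNReal.Tendsto.mul_const h2
      (Or.inr (ENNReal.rpow_ne_top_of_nonneg (by linarith) hN))
  have hε3 : 0 < ε / 3 := ENNReal.div_pos hε.ne' (by norm_num)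
  obtain ⟨B, hB1, hB⟩ := ((tendsto_order.1 hlim).2 _ hε3).and (eventually_gt_atTop 0) |>.exists
  have hlim2 : Tendsto (fun J : ℕ => ENNReal.ofReal (2 * B / J)) atTop (𝓝 0) := by
    have := ENNReal.tendsto_ofReal (tendsto_const_div_atTop_nhds_zero_nat (2 * B))
    rwa [ENNReal.ofReal_zero] at this
  obtain ⟨J, hJ1, hJ⟩ := ((tendsto_order.1 hlim2).2 _ hε3).and (eventually_gt_atTop 0) |>.exists
  have hC : IsCompact (range fun a : Fin J → I =>
      ((-B) • tailInd 0 + (2 * B / J) • ∑ j, tailInd (a j) : L2)) := by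
    refine isCompact_range ?_
    have : ∀ j, Continuous fun a : Fin J → I => tailInd (a j) :=
      fun j => continuous_tailInd.comp (continuous_apply j)
    fun_prop
  obtain ⟨t, ht, hCt⟩ := EMetric.totallyBounded_iff.1 hC.totallyBounded (ε / 3) hε3
  refine ⟨t, ht, fun g hg => ?_⟩
  obtain ⟨a, ha⟩ := exists_levels_approx hg.1 hB hJ
  obtain ⟨y, hy, hy'⟩ := mem_iUnion₂.1 (hCt ⟨a, rfl⟩)
  refine mem_iUnion₂.2 ⟨y, hy, ?_⟩
  set c : L2 := (-B) • tailInd 0 + (2 * B / J) • ∑ j, tailInd (a j) with hc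
  have hgc : edist g c ≤ ENNReal.ofReal (B ^ (1 - r)) * N ^ r + ENNReal.ofReal (2 * B / J) := by
    rw [Lp.edist_def]
    have hmeas : AEStronglyMeasurable (fun s => B ^ (1 - r) * ‖g s‖ ^ r) (volume : Measure I) :=
      (((Lp.aestronglyMeasurable g).norm.aemeasurable.pow_const r).const_mul _).aestronglyMeasurable
    calc eLpNorm (⇑g - ⇑c) 2 volume
        ≤ eLpNorm (fun s => B ^ (1 - r) * ‖g s‖ ^ r + 2 * B / J) 2 volume := by
          refine eLpNorm_mono_ae_real ?_
          filter_upwards [ha] with s hs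
          rw [Pi.sub_apply, Real.norm_eq_abs]
          have h3 := abs_sub_clip_le hB hr.le (g s)
          have h4 : g s - c s = (g s - clip B (g s)) + (clip B (g s) - c s) := by ring
          rw [h4]
          exact (abs_add_le _ _).trans (add_le_add h3 hs)
      _ ≤ eLpNorm (fun s => B ^ (1 - r) * ‖g s‖ ^ r) 2 volume +
          eLpNorm (fun _ : I => 2 * B / J) 2 volume :=
          eLpNorm_add_le hmeas aestronglyMeasurable_const (by norm_num)
      _ ≤ _ := by
          refine add_le_add ?_ ?_
          · have h5 : (fun s => B ^ (1 - r) * ‖g s‖ ^ r) = B ^ (1 - r) • fun s => ‖g s‖ ^ r := rfl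
            rw [h5, eLpNorm_const_smul, eLpNorm_norm_rpow _ (by linarith),
              Real.enorm_of_nonneg (by positivity)]
            gcongr
            exact hg.2
          · rw [eLpNorm_const _ (by norm_num) (NeZero.ne _)]
            simp [Real.enorm_of_nonneg (show 0 ≤ 2 * B / J by positivity)]
  calc edist g y ≤ edist g c + edist c y := edist_triangle _ _ _
    _ < (ε / 3 + ε / 3) + ε / 3 :=
      ENNReal.add_lt_add (hgc.trans_lt (ENNReal.add_lt_add hB1 hJ1)) hy'
    _ = ε := ENNReal.add_thirds ε

theorem exponent_eq (n : ℕ) :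
    (2 + 1 / ((n + 1 : ℕ) : ℝ≥0∞)) = 2 * ENNReal.ofReal (1 + 1 / (2 * (n + 1 : ℝ))) := by
  rw [← ENNReal.toReal_eq_toReal_iff' (by simp) (by finiteness)]
  rw [ENNReal.toReal_add (by simp) (by simp), ENNReal.toReal_mul,
    ENNReal.toReal_ofReal (by positivity), ENNReal.toReal_div]
  have : ((n : ℝ≥0∞) + 1).toReal = n + 1 := by
    rw [ENNReal.toReal_add (by simp) (by simp)]; simp
  simp [this]
  field_simp

/-- The set is closed and totally bounded in the complete space L₂. The index n + 1 keeps away from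
0, where the exponent would be 2 + 1/0 = ∞. -/
theorem isCompact_normBall (ξ : StieltjesFunction I) (n : ℕ) : IsCompact (normBall ξ (n + 1)) := by
  have hcl : IsClosed (Subtype.val '' normBall ξ (n + 1) : Set L2) :=
    (isClosed_L2upOf ξ).isClosedEmbedding_subtypeVal.isClosedMap _ (isClosed_normBall ξ _)
  have hr : (1 : ℝ) < 1 + 1 / (2 * (n + 1 : ℝ)) := by
    have : (0 : ℝ) < 1 / (2 * (n + 1 : ℝ)) := by positivity
    linarith
  have htb : TotallyBounded (Subtype.val '' normBall ξ (n + 1) : Set L2) := by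
    refine (totallyBounded_L2up_inter hr (ENNReal.natCast_ne_top (n + 1))).subset ?_
    rintro _ ⟨g, hg, rfl⟩
    refine ⟨g.2.1, ?_⟩
    rw [← exponent_eq]
    exact hg
  have := isCompact_iff_totallyBounded_isComplete.2 ⟨htb, hcl.isComplete⟩
  exact (Topology.IsEmbedding.subtypeVal.isCompact_iff).2 this

/-- On a probability space the norm increases with the exponent, so lowering the exponent and
raising the radius both enlarge the ball. -/
theorem normBall_mono (ξ : StieltjesFunction I) : Monotone fun n => normBall ξ (n + 1) := by
  refine monotone_nat_of_le_succ fun n g hg => ?_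
  refine (eLpNorm_le_eLpNorm_of_exponent_le ?_ (Lp.aestronglyMeasurable _)).trans
    (le_trans hg (by exact_mod_cast Nat.le_succ _))
  gcongr
  exact_mod_cast Nat.le_succ _

/-! ### Step functions -/

section StepFunctions

variable {n : ℕ}

/-- The class of the indicator function of the `i`-th piece. -/
def piece (q : Fin n → I) (i : Fin (n + 1)) : L2 := pieceInd (leftEnd q i) (rightEnd q i)

/-- The length of the `i`-th piece. -/
def len (q : Fin n → I) (i : Fin (n + 1)) : ℝ := (rightEnd q i : ℝ) - (leftEnd q i : ℝ)

theorem chi_eq_sum (q : Fin n → I) (x : Fin (n + 1) → ℝ) : chi q x = ∑ i, x i • piece q i := by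
  refine Finset.sum_congr rfl fun i _ => Lp.ext ?_
  filter_upwards [Lp.coeFn_smul (x i) (piece q i), pieceInd_coeFn (leftEnd q i) (rightEnd q i),
    indicatorConstLp_coeFn (p := 2) (μ := (volume : Measure I))
      (hs := measurableSet_Ico (a := leftEnd q i) (b := rightEnd q i))
      (hμs := measure_ne_top _ _) (c := x i)] with s h1 h2 h3
  rw [h1, h3, Pi.smul_apply, piece, h2]
  simp [indicator]

theorem continuous_leftEnd (i : Fin (n + 1)) : Continuous fun q : Fin n → I => leftEnd q i := by
  refine Fin.cases ?_ (fun j => ?_) i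
  · simpa [leftEnd] using continuous_const
  · simpa [leftEnd] using continuous_apply j

theorem continuous_rightEnd (i : Fin (n + 1)) : Continuous fun q : Fin n → I => rightEnd q i := by
  refine Fin.lastCases ?_ (fun j => ?_) i
  · simpa [rightEnd] using continuous_const
  · simpa [rightEnd] using continuous_apply j

theorem continuous_piece (i : Fin (n + 1)) : Continuous fun q : Fin n → I => piece q i :=
  continuous_pieceInd.comp ((continuous_leftEnd i).prodMk (continuous_rightEnd i))

theorem continuous_len (i : Fin (n + 1)) : Continuous fun q : Fin n → I => len q i :=
  (continuous_subtype_val.comp (continuous_rightEnd i)).sub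
    (continuous_subtype_val.comp (continuous_leftEnd i))

theorem continuous_chi :
    Continuous fun p : (Fin n → I) × (Fin (n + 1) → ℝ) => chi p.1 p.2 := by
  simp_rw [chi_eq_sum]
  refine continuous_finsetSum _ fun i _ => ?_
  exact ((continuous_apply i).comp continuous_snd).smul ((continuous_piece i).comp continuous_fst)

theorem rightEnd_le_leftEnd {q : Fin n → I} (hq : q ∈ jumpSet n) {i j : Fin (n + 1)} (hij : i < j) :
    rightEnd q i ≤ leftEnd q j := by
  obtain ⟨j, rfl⟩ := Fin.exists_succ_eq.2 (Fin.ne_zero_of_lt hij)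
  obtain ⟨i, rfl⟩ := Fin.exists_castSucc_eq.2 (Fin.ne_last_of_lt hij)
  simp only [rightEnd, leftEnd, Fin.snoc_castSucc, Fin.cons_succ]
  exact hq.1.monotone (Fin.castSucc_lt_succ_iff.1 hij)

theorem leftEnd_lt_rightEnd {q : Fin n → I} (hq : q ∈ jumpSet n) (i : Fin (n + 1)) :
    leftEnd q i < rightEnd q i := by
  rcases Fin.eq_zero_or_eq_succ i with rfl | ⟨j, rfl⟩
  · rcases Fin.eq_castSucc_or_eq_last (0 : Fin (n + 1)) with ⟨k, hk⟩ | hk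
    · rw [hk]
      simp only [rightEnd, Fin.snoc_castSucc]
      rw [← hk]
      simpa [leftEnd] using (hq.2 k).1
    · conv_rhs => rw [hk]
      simp [rightEnd, leftEnd]
  · rcases Fin.eq_castSucc_or_eq_last j.succ with ⟨k, hk⟩ | hk
    · conv_rhs => rw [hk]
      simp only [rightEnd, Fin.snoc_castSucc, leftEnd, Fin.cons_succ]
      refine hq.1 ?_
      rw [← Fin.castSucc_lt_castSucc_iff, ← hk]
      exact Fin.castSucc_lt_succ
    · conv_rhs => rw [hk]
      simpa [rightEnd, leftEnd] using (hq.2 j).2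

theorem len_pos {q : Fin n → I} (hq : q ∈ jumpSet n) (i : Fin (n + 1)) : 0 < len q i :=
  sub_pos.2 (leftEnd_lt_rightEnd hq i)

theorem len_le_one (q : Fin n → I) (i : Fin (n + 1)) : len q i ≤ 1 := by
  have h1 := (rightEnd q i).2.2
  have h2 := (leftEnd q i).2.1
  unfold len
  linarith

theorem exists_mem_Ico_piece (q : Fin n → I) {s : I} (hs : s < 1) :
    ∃ i, s ∈ Ico (leftEnd q i) (rightEnd q i) := by
  have hne : (Finset.univ.filter fun i => leftEnd q i ≤ s).Nonempty :=
    ⟨0, Finset.mem_filter.2 ⟨Finset.mem_univ _, unitInterval.nonneg'⟩⟩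
  obtain ⟨i, hi, hmax⟩ := Finset.exists_max_image _ id hne
  simp only [Finset.mem_filter, Finset.mem_univ, true_and, id] at hi hmax
  refine ⟨i, hi, ?_⟩
  rcases Fin.eq_castSucc_or_eq_last i with ⟨k, rfl⟩ | rfl
  · simp only [rightEnd, Fin.snoc_castSucc]
    by_contra h
    have := hmax k.succ (by simpa [leftEnd] using h)
    exact absurd Fin.castSucc_lt_succ (not_lt.2 this)
  · simpa [rightEnd] using hs

theorem le_of_mem_Ico_piece {q : Fin n → I} (hq : q ∈ jumpSet n) {s t : I} {i j : Fin (n + 1)}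
    (hs : s ∈ Ico (leftEnd q i) (rightEnd q i)) (ht : t ∈ Ico (leftEnd q j) (rightEnd q j))
    (hst : s ≤ t) : i ≤ j := by
  by_contra h
  exact absurd ((rightEnd_le_leftEnd hq (not_le.1 h)).trans (hs.1.trans hst)) (not_le.2 ht.2)

theorem ae_exists_mem_piece (q : Fin n → I) :
    ∀ᵐ s : I, ∃ i, s ∈ Ico (leftEnd q i) (rightEnd q i) := by
  have h1 : ∀ᵐ s : I, s ≠ 1 := by simp [ae_iff]
  filter_upwards [h1] with s hs using
    exists_mem_Ico_piece q (lt_of_le_of_ne unitInterval.le_one' hs)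

/-- On a piece, a linear combination of the indicators of the pieces is constant. -/
theorem sum_smul_piece_coeFn {q : Fin n → I} (hq : q ∈ jumpSet n) (c : Fin (n + 1) → ℝ) :
    ∀ᵐ s : I, ∀ i, s ∈ Ico (leftEnd q i) (rightEnd q i) → (∑ j, c j • piece q j : L2) s = c i := by
  filter_upwards [Lp.coeFn_fun_finsetSum Finset.univ fun j => c j • piece q j,
    ae_all_iff.2 fun j => Lp.coeFn_smul (c j) (piece q j),
    ae_all_iff.2 fun j => pieceInd_coeFn (leftEnd q j) (rightEnd q j)] with s h1 h2 h3 i hi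
  rw [h1, Finset.sum_eq_single i]
  · rw [h2, Pi.smul_apply, piece, h3, indicator_of_mem hi, smul_eq_mul, mul_one]
  · intro j _ hj
    rw [h2, Pi.smul_apply, piece, h3, indicator_of_notMem, smul_zero]
    intro hj'
    exact hj (le_antisymm (le_of_mem_Ico_piece hq hj' hi le_rfl)
      (le_of_mem_Ico_piece hq hi hj' le_rfl))
  · simp

theorem chi_coeFn {q : Fin n → I} (hq : q ∈ jumpSet n) (x : Fin (n + 1) → ℝ) :
    ∀ᵐ s : I, ∀ i, s ∈ Ico (leftEnd q i) (rightEnd q i) → chi q x s = x i := by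
  rw [chi_eq_sum]
  exact sum_smul_piece_coeFn hq x

theorem chi_mem_L2up {q : Fin n → I} (hq : q ∈ jumpSet n) {x : Fin (n + 1) → ℝ}
    (hx : Monotone x) : chi q x ∈ L2up := by
  refine mem_L2up_of_monotoneOn
    (S := {s | (∃ i, s ∈ Ico (leftEnd q i) (rightEnd q i)) ∧
      ∀ i, s ∈ Ico (leftEnd q i) (rightEnd q i) → chi q x s = x i}) ?_ ?_
  · filter_upwards [ae_exists_mem_piece q, chi_coeFn hq x] with s h1 h2 using ⟨h1, h2⟩
  · rintro s ⟨⟨i, hi⟩, hs⟩ t ⟨⟨j, hj⟩, ht⟩ hst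
    rw [hs i hi, ht j hj]
    exact hx (le_of_mem_Ico_piece hq hi hj hst)

theorem inner_piece (q : Fin n → I) (i : Fin (n + 1)) (g : L2) :
    inner ℝ (piece q i) g = ∫ s in Ico (leftEnd q i) (rightEnd q i), g s := by
  have := L2.inner_indicatorConstLp_eq_setIntegral_inner ℝ g
    (measurableSet_Ico (a := leftEnd q i) (b := rightEnd q i)) (1 : ℝ) (measure_ne_top _ _)
  refine this.trans ?_
  simp

theorem volume_real_Ico_piece {q : Fin n → I} (hq : q ∈ jumpSet n) (i : Fin (n + 1)) :
    volume.real (Ico (leftEnd q i) (rightEnd q i)) = len q i := by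
  rw [measureReal_def, unitInterval.volume_Ico, ← len, ENNReal.toReal_ofReal (len_pos hq i).le]

theorem inner_piece_sum {q : Fin n → I} (hq : q ∈ jumpSet n) (c : Fin (n + 1) → ℝ)
    (i : Fin (n + 1)) : inner ℝ (piece q i) (∑ j, c j • piece q j) = len q i * c i := by
  rw [inner_piece]
  rw [setIntegral_congr_ae (g := fun _ => c i) measurableSet_Ico
    ((sum_smul_piece_coeFn hq c).mono fun s hs h => hs i h)]
  rw [setIntegral_const, volume_real_Ico_piece hq, smul_eq_mul]

theorem inner_sum_sum {q : Fin n → I} (hq : q ∈ jumpSet n) (c d : Fin (n + 1) → ℝ) :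
    inner ℝ (∑ j, c j • piece q j) (∑ j, d j • piece q j) = ∑ i, len q i * c i * d i := by
  rw [sum_inner]
  refine Finset.sum_congr rfl fun i _ => ?_
  rw [real_inner_smul_left, inner_piece_sum hq]
  ring

theorem norm_sq_chi {q : Fin n → I} (hq : q ∈ jumpSet n) (x : Fin (n + 1) → ℝ) :
    ‖chi q x‖ ^ 2 = ∑ i, len q i * x i ^ 2 := by
  rw [← real_inner_self_eq_norm_sq, chi_eq_sum, inner_sum_sum hq]
  exact Finset.sum_congr rfl fun i _ => by ring

/-- Integrals are sums of integrals over the pieces. -/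
theorem lintegral_eq_sum_piece {q : Fin n → I} (hq : q ∈ jumpSet n) (f : I → ℝ≥0∞) :
    ∫⁻ s : I, f s = ∑ i, ∫⁻ s in Ico (leftEnd q i) (rightEnd q i), f s := by
  have hU : (⋃ i ∈ (Finset.univ : Finset (Fin (n + 1))), Ico (leftEnd q i) (rightEnd q i)) =ᵐ[volume]
      (univ : Set I) := by
    filter_upwards [ae_exists_mem_piece q] with s hs
    refine propext ⟨fun _ => trivial, fun _ => ?_⟩
    obtain ⟨i, hi⟩ := hs
    exact mem_iUnion₂.2 ⟨i, Finset.mem_univ i, hi⟩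
  rw [← setLIntegral_univ, ← setLIntegral_congr hU, lintegral_biUnion_finset]
  · intro i _ j _ hij
    refine Set.disjoint_left.2 fun s hi hj => hij ?_
    exact le_antisymm (le_of_mem_Ico_piece hq hi hj le_rfl) (le_of_mem_Ico_piece hq hj hi le_rfl)
  · exact fun i _ => measurableSet_Ico

/-- Integrals of functions of a step function. -/
theorem lintegral_comp_chi {q : Fin n → I} (hq : q ∈ jumpSet n) (x : Fin (n + 1) → ℝ)
    (f : ℝ → ℝ≥0∞) :
    ∫⁻ s : I, f (chi q x s) = ∑ i, ENNReal.ofReal (len q i) * f (x i) := by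
  rw [lintegral_eq_sum_piece hq]
  refine Finset.sum_congr rfl fun i _ => ?_
  rw [setLIntegral_congr_fun_ae (g := fun _ => f (x i)) measurableSet_Ico
    ((chi_coeFn hq x).mono fun s hs h => by rw [hs i h])]
  rw [setLIntegral_const, unitInterval.volume_Ico, mul_comm, len]

end StepFunctions

/-! ### The measure `Ξ` as a sum of image measures -/

section Jumps

variable (ξ : StieltjesFunction I)

theorem tailInd_zero_mem_L2sub (f : I → ℝ) : tailInd 0 ∈ L2sub f := by
  refine mem_lpMeas_iff_aestronglyMeasurable.2 ⟨fun _ => (1 : ℝ), ?_, tailInd_zero_coeFn⟩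
  exact @stronglyMeasurable_const _ _ (sigmaAlg f) _ _

theorem tailInd_one : tailInd 1 = 0 := by
  refine Lp.ext ?_
  have h1 : ∀ᵐ s : I, s ≠ 1 := by simp [ae_iff]
  filter_upwards [tailInd_coeFn 1, Lp.coeFn_zero ℝ 2 (volume : Measure I), h1] with s h2 h3 h4
  rw [h2, h3, indicator_of_notMem, Pi.zero_apply]
  exact fun h => h4 (le_antisymm unitInterval.le_one' h)

/-- If ξ is strictly smaller to the left of q, then [q, 1] is the superlevel set {ξ ≥ ξ(q)}. -/
theorem tailInd_mem_L2sub {q : I} (hq : ∀ s < q, ξ s ≠ ξ q) : tailInd q ∈ L2sub ξ := by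
  have hs : MeasurableSet[sigmaAlg ξ] (Ici q) := by
    refine ⟨Ici (ξ q), measurableSet_Ici, ?_⟩
    ext s
    refine ⟨fun h => ?_, fun h => ξ.mono h⟩
    by_contra hlt
    have hlt' : s < q := not_le.1 hlt
    exact hq s hlt' (le_antisymm (ξ.mono hlt'.le) h)
  exact mem_lpMeas_indicatorConstLp (F := ℝ) (𝕜 := ℝ) (p := 2) (μ := (volume : Measure I))
    (measurable_stieltjes ξ).comap_le hs (measure_ne_top _ _) (c := (1 : ℝ))

/-- Each (s, d] on which ξ stays at its value at s has measure ξ(d) − ξ(s) = 0. The set in question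
is one such interval or a countable union of them, according to whether it has a largest point. -/
theorem measure_level_right (s : I) : ξ.measure {q | s < q ∧ ξ s = ξ q} = 0 := by
  set S : Set I := {q | s < q ∧ ξ s = ξ q}
  have hIoc : ∀ d, ξ s = ξ d → ξ.measure (Ioc s d) = 0 := fun d hd => by
    rw [StieltjesFunction.measure_Ioc, hd, sub_self, ENNReal.ofReal_zero]
  by_cases hmax : ∃ b ∈ S, ∀ q ∈ S, q ≤ b
  · obtain ⟨b, hb, hbm⟩ := hmax
    exact measure_mono_null (fun q hq => show q ∈ Ioc s b from ⟨hq.1, hbm q hq⟩) (hIoc b hb.2)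
  · push Not at hmax
    obtain ⟨D, hDc, hDd⟩ := TopologicalSpace.exists_countable_dense I
    have hsub : S ⊆ ⋃ d ∈ {d ∈ D | ξ s = ξ d}, Ioc s d := by
      intro q hq
      obtain ⟨q', hq', hlt⟩ := hmax q hq
      obtain ⟨d, hdD, hd1, hd2⟩ := hDd.exists_between hlt
      refine mem_iUnion₂.2 ⟨d, ⟨hdD, le_antisymm ?_ ?_⟩, hq.1, hd1.le⟩
      · exact ξ.mono (hq.1.trans hd1).le
      · rw [hq'.2]; exact ξ.mono hd2.le
    refine measure_mono_null hsub ((measure_biUnion_null_iff ?_).2 fun d hd => hIoc d hd.2)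
    exact hDc.mono fun d hd => hd.1

/-- A bad q has a stretch of constancy to its left, which contains a point of a countable dense set;
countably many null sets cover these q. This is why Ξ lives on L₂(ξ). -/
theorem ae_tailInd_mem_L2sub : ∀ᵐ q ∂ξ.measure, tailInd q ∈ L2sub ξ := by
  obtain ⟨D, hDc, hDd⟩ := TopologicalSpace.exists_countable_dense I
  have h : ∀ᵐ q ∂ξ.measure, ∀ d ∈ D, ¬ (d < q ∧ ξ d = ξ q) :=
    (ae_ball_iff hDc).2 fun d _ => by
      rw [ae_iff]; simpa using measure_level_right ξ d
  filter_upwards [h] with q hq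
  refine tailInd_mem_L2sub ξ fun s hs heq => ?_
  obtain ⟨d, hdD, hd1, hd2⟩ := hDd.exists_between hs
  refine hq d hdD ⟨hd2, le_antisymm (ξ.mono hd2.le) ?_⟩
  rw [← heq]
  exact ξ.mono hd1.le

theorem chi_mem_L2sub {n : ℕ} {q : Fin n → I} (hq : q ∈ jumpSet n)
    (h : ∀ i, tailInd (q i) ∈ L2sub ξ) (x : Fin (n + 1) → ℝ) : chi q x ∈ L2sub ξ := by
  rw [chi_eq_sum]
  refine Submodule.sum_mem _ fun i _ => Submodule.smul_mem _ _ ?_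
  rw [piece, pieceInd_eq_sub, max_eq_right (leftEnd_lt_rightEnd hq i).le]
  refine Submodule.sub_mem _ ?_ ?_
  · refine Fin.cases ?_ (fun j => ?_) i
    · simpa [leftEnd] using tailInd_zero_mem_L2sub ξ
    · simpa [leftEnd] using h j
  · refine Fin.lastCases ?_ (fun j => ?_) i
    · simp [rightEnd, tailInd_one]
    · simpa [rightEnd] using h j

/-- Increasing vectors. -/
def strictCone (n : ℕ) : Set (Fin n → ℝ) := {x | StrictMono x}

theorem isOpen_strictCone (n : ℕ) : IsOpen (strictCone n) := by
  simp only [strictCone, StrictMono, Set.ofPred_forall]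
  exact isOpen_iInter_of_finite fun i => isOpen_iInter_of_finite fun j =>
    isOpen_iInter_of_finite fun _ => isOpen_lt (continuous_apply i) (continuous_apply j)

theorem isOpen_jumpSet (n : ℕ) : IsOpen (jumpSet n) := by
  have : jumpSet n = (⋂ i, ⋂ j, ⋂ (_ : i < j), {q : Fin n → I | q i < q j}) ∩
      ⋂ i, ({q | 0 < q i} ∩ {q | q i < 1}) := by
    ext q
    simp [jumpSet, StrictMono]
  rw [this]
  refine IsOpen.inter ?_ ?_
  · exact isOpen_iInter_of_finite fun i => isOpen_iInter_of_finite fun j =>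
      isOpen_iInter_of_finite fun _ => isOpen_lt (continuous_apply i) (continuous_apply j)
  · exact isOpen_iInter_of_finite fun i => (isOpen_lt continuous_const (continuous_apply i)).inter
      (isOpen_lt (continuous_apply i) continuous_const)

theorem isClosed_monoCone (n : ℕ) : IsClosed (monoCone n) := by
  simp only [monoCone, Monotone, Set.ofPred_forall]
  exact isClosed_iInter fun i => isClosed_iInter fun j => isClosed_iInter fun _ =>
    isClosed_le (continuous_apply i) (continuous_apply j)

theorem strictCone_subset_monoCone (n : ℕ) : strictCone n ⊆ monoCone n :=
  fun _ hx => StrictMono.monotone hx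

/-- The difference of the two cones lies in finitely many hyperplanes x_i = x_j. -/
theorem ae_strictCone (n : ℕ) :
    ∀ᵐ x ∂(volume : Measure (Fin n → ℝ)).restrict (monoCone n), x ∈ strictCone n := by
  rw [ae_restrict_iff' (isClosed_monoCone n).measurableSet]
  have h : ∀ i j : Fin n, i ≠ j → ∀ᵐ x : Fin n → ℝ, x i ≠ x j := by
    intro i j hij
    set p : (Fin n → ℝ) →ₗ[ℝ] ℝ := 
      (LinearMap.proj i : (Fin n → ℝ) →ₗ[ℝ] ℝ) - LinearMap.proj j
    have hp : LinearMap.ker p ≠ ⊤ := by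
      intro h
      have h1 : (Pi.single i 1 : Fin n → ℝ) ∈ LinearMap.ker p := h ▸ Submodule.mem_top
      simp [p, hij.symm] at h1
    have := Measure.addHaar_submodule volume (LinearMap.ker p) hp
    rw [ae_iff]
    refine measure_mono_null (fun x hx => ?_) this
    simp only [ne_eq, not_not, mem_ofPred_eq] at hx
    simp [p, hx]
  have h' : ∀ᵐ x : Fin n → ℝ, ∀ i j, i ≠ j → x i ≠ x j :=
    ae_all_iff.2 fun i => ae_all_iff.2 fun j => by
      by_cases hij : i = j
      · exact Eventually.of_forall fun x h => absurd hij h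
      · filter_upwards [h i j hij] with x hx _ using hx
  filter_upwards [h'] with x hx hm
  exact Monotone.strictMono_of_injective hm fun i j hij => by
    by_contra hne
    exact hx i j hne hij

theorem muJump_le (n : ℕ) : muJump ξ n ≤ Measure.pi fun _ : Fin n => ξ.measure := by
  refine Measure.le_iff.2 fun s hs => ?_
  rw [muJump, withDensity_apply _ hs]
  calc ∫⁻ q in s, ∏ i, ENNReal.ofReal ((rightEnd q i : ℝ) - (leftEnd q i : ℝ))
        ∂(Measure.pi fun _ : Fin n => ξ.measure).restrict (jumpSet n)
      ≤ ∫⁻ _ in s, 1 ∂(Measure.pi fun _ : Fin n => ξ.measure).restrict (jumpSet n) := by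
        refine lintegral_mono fun q => Finset.prod_le_one' fun i _ => ?_
        exact ENNReal.ofReal_le_one.2 (len_le_one q i)
    _ ≤ _ := by
        rw [setLIntegral_one]
        exact Measure.restrict_apply_le _ _

theorem ae_muJump_mem_jumpSet (n : ℕ) : ∀ᵐ q ∂muJump ξ n, q ∈ jumpSet n :=
  (withDensity_absolutelyContinuous _ _).ae_le (ae_restrict_mem (isOpen_jumpSet n).measurableSet)

theorem ae_muJump_tailInd (n : ℕ) : ∀ᵐ q ∂muJump ξ n, ∀ i, tailInd (q i) ∈ L2sub ξ := by
  refine (Measure.absolutelyContinuous_of_le (muJump_le ξ n)).ae_le ?_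
  exact ae_all_iff.2 fun i =>
    (Measure.quasiMeasurePreserving_eval (μ := fun _ : Fin n => ξ.measure) i).ae
      (ae_tailInd_mem_L2sub ξ)

/-- The measure on the parameters of step functions with `n` jumps. -/
def paramMeasure (n : ℕ) : Measure ((Fin n → I) × (Fin (n + 1) → ℝ)) :=
  (muJump ξ n).prod (volume.restrict (monoCone (n + 1)))

/-- The parameters of nondegenerate step functions. -/
def goodSet (n : ℕ) : Set ((Fin n → I) × (Fin (n + 1) → ℝ)) := jumpSet n ×ˢ strictCone (n + 1)

theorem measurableSet_goodSet (n : ℕ) : MeasurableSet (goodSet n) :=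
  (isOpen_jumpSet n).measurableSet.prod (isOpen_strictCone _).measurableSet

theorem ae_goodSet (n : ℕ) : ∀ᵐ p ∂paramMeasure ξ n, p ∈ goodSet n := by
  have h1 : ∀ᵐ p ∂paramMeasure ξ n, p.1 ∈ jumpSet n :=
    Measure.quasiMeasurePreserving_fst.ae (ae_muJump_mem_jumpSet ξ n)
  have h2 : ∀ᵐ p ∂paramMeasure ξ n, p.2 ∈ strictCone (n + 1) :=
    Measure.quasiMeasurePreserving_snd.ae (ae_strictCone (n + 1))
  filter_upwards [h1, h2] with p hp1 hp2 using ⟨hp1, hp2⟩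

theorem ae_chi_mem (n : ℕ) :
    ∀ᵐ p ∂paramMeasure ξ n, chi p.1 p.2 ∈ L2up ∧ chi p.1 p.2 ∈ L2sub ξ := by
  have h1 : ∀ᵐ p ∂paramMeasure ξ n, ∀ i, tailInd (p.1 i) ∈ L2sub ξ :=
    Measure.quasiMeasurePreserving_fst.ae (ae_muJump_tailInd ξ n)
  filter_upwards [ae_goodSet ξ n, h1] with p hp1 hp2
  exact ⟨chi_mem_L2up hp1.1 hp1.2.monotone, chi_mem_L2sub ξ hp1.1 hp2 _⟩

theorem zero_mem_L2up : (0 : L2) ∈ L2up :=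
  mem_L2up_of_monotoneOn (S := {s | (0 : L2) s = 0}) (Lp.coeFn_zero ℝ 2 (volume : Measure I))
    fun s hs t ht _ => by rw [hs, ht]

open Classical in
/-- The step function with given parameters, as an element of `L₂↑(ξ)`. -/
def chiUp {n : ℕ} (p : (Fin n → I) × (Fin (n + 1) → ℝ)) : L2upOf ξ :=
  if h : chi p.1 p.2 ∈ L2up ∧ chi p.1 p.2 ∈ L2sub ξ then ⟨chi p.1 p.2, h⟩
  else ⟨0, zero_mem_L2up, Submodule.zero_mem _⟩

theorem ae_chiUp (n : ℕ) : ∀ᵐ p ∂paramMeasure ξ n, (chiUp ξ p : L2) = chi p.1 p.2 := by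
  filter_upwards [ae_chi_mem ξ n] with p hp
  rw [chiUp, dif_pos hp]

theorem measurable_chiUp (n : ℕ) : Measurable (chiUp ξ (n := n)) := by
  classical
  have : Measurable fun p : (Fin n → I) × (Fin (n + 1) → ℝ) => (chiUp ξ p : L2) := by
    have h : (fun p : (Fin n → I) × (Fin (n + 1) → ℝ) => (chiUp ξ p : L2)) =
        fun p => if chi p.1 p.2 ∈ {g : L2 | g ∈ L2up ∧ g ∈ L2sub ξ} then chi p.1 p.2 else 0 := by
      funext p
      unfold chiUp
      by_cases h : chi p.1 p.2 ∈ L2up ∧ chi p.1 p.2 ∈ L2sub ξ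
      · rw [dif_pos h]; exact (if_pos h).symm
      · rw [dif_neg h]; exact (if_neg h).symm
    rw [h]
    exact Measurable.ite (continuous_chi.measurable (isClosed_L2upOf ξ).measurableSet)
      continuous_chi.measurable measurable_const
  exact this.subtype_mk

/-- Fubini's theorem: the mixture over q of images of Lebesgue measure is the image of the product
measure. -/
theorem XiPart_eq_map (n : ℕ) :
    XiPart ξ n = (paramMeasure ξ n).map fun p => chi p.1 p.2 := by
  have hν : ∀ s : Set L2, MeasurableSet s → ∀ q : Fin n → I,
      nu q s = (volume.restrict (monoCone (n + 1)))
        (Prod.mk q ⁻¹' ((fun p : (Fin n → I) × (Fin (n + 1) → ℝ) => chi p.1 p.2) ⁻¹' s)) := by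
    intro s hs q
    have hc : Continuous (chi q) := continuous_chi.comp (Continuous.prodMk_right q)
    rw [nu, Measure.map_apply hc.measurable hs]
    rfl
  have hmeas : Measurable (nu (n := n)) := by
    refine Measure.measurable_of_measurable_coe _ fun s hs => ?_
    simp_rw [hν s hs]
    exact measurable_measure_prodMk_left (continuous_chi.measurable hs)
  ext s hs
  rw [XiPart, Measure.bind_apply hs hmeas.aemeasurable,
    Measure.map_apply continuous_chi.measurable hs, paramMeasure,
    Measure.prod_apply (continuous_chi.measurable hs)]
  exact lintegral_congr fun q => hν s hs q

/-- Restriction to L₂↑(ξ) loses no mass, since χ takes values there for almost all parameters. -/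
theorem Xi_eq_sum : Xi ξ = Measure.sum fun n => (paramMeasure ξ n).map (chiUp ξ) := by
  have he : MeasurableEmbedding (Subtype.val : L2upOf ξ → L2) :=
    MeasurableEmbedding.subtype_coe (isClosed_L2upOf ξ).measurableSet
  ext s hs
  have hs' := he.measurableSet_image.2 hs
  rw [Xi, he.comap_apply, Measure.sum_apply _ hs', Measure.sum_apply _ hs]
  refine tsum_congr fun n => ?_
  rw [XiPart_eq_map, Measure.map_apply continuous_chi.measurable hs',
    Measure.map_apply (measurable_chiUp ξ n) hs]
  refine measure_congr ?_
  filter_upwards [ae_chiUp ξ n] with p hp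
  refine propext ?_
  change chi p.1 p.2 ∈ Subtype.val '' s ↔ chiUp ξ p ∈ s
  rw [← hp]
  exact Subtype.val_injective.mem_set_image

theorem ae_Xi_iff {P : L2upOf ξ → Prop} (hP : MeasurableSet {g | P g}) :
    (∀ᵐ g ∂Xi ξ, P g) ↔ ∀ n, ∀ᵐ p ∂paramMeasure ξ n, P (chiUp ξ p) := by
  rw [Xi_eq_sum, Measure.ae_sum_iff]
  exact forall_congr' fun n => ae_map_iff (measurable_chiUp ξ n).aemeasurable hP

theorem ae_param_of_ae_Xi {P : L2upOf ξ → Prop} (h : ∀ᵐ g ∂Xi ξ, P g) (n : ℕ) :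
    ∀ᵐ p ∂paramMeasure ξ n, P (chiUp ξ p) := by
  rw [Xi_eq_sum, Measure.ae_sum_iff] at h
  exact ae_of_ae_map (measurable_chiUp ξ n).aemeasurable (h n)

theorem lintegral_Xi {f : L2upOf ξ → ℝ≥0∞} (hf : Measurable f) :
    ∫⁻ g, f g ∂Xi ξ = ∑' n, ∫⁻ p, f (chiUp ξ p) ∂paramMeasure ξ n := by
  rw [Xi_eq_sum, lintegral_sum_measure]
  exact tsum_congr fun n => lintegral_map hf (measurable_chiUp ξ n)

end Jumps

/-! ### Integrability with respect to `Ξ` -/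

section Integrability

/-- The third power of the norm of `L₃`. -/
def cubeNorm (g : L2) : ℝ≥0∞ := ∫⁻ s, ‖g s‖ₑ ^ 3

/-- Integrals of nonnegative continuous functions are lower semicontinuous, hence measurable. -/
theorem measurable_lintegral_comp {f : ℝ → ℝ≥0∞} (hf : Continuous f) :
    Measurable fun g : L2 => ∫⁻ s, f (g s) := by
  refine measurable_of_Iic fun c => IsClosed.measurableSet ?_
  refine IsSeqClosed.isClosed fun u g hu hlim => ?_
  obtain ⟨ns, -, hns⟩ := exists_subseq_tendsto_ae hlim
  have h1 : ∫⁻ s, f (g s) = ∫⁻ s, liminf (fun k => f (u (ns k) s)) atTop := by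
    refine lintegral_congr_ae ?_
    filter_upwards [hns] with s hs
    exact ((hf.tendsto _).comp hs).liminf_eq.symm
  change ∫⁻ s, f (g s) ≤ c
  rw [h1]
  refine (lintegral_liminf_le' fun k => ?_).trans ?_
  · exact hf.measurable.comp_aemeasurable (Lp.aestronglyMeasurable _).aemeasurable
  · exact liminf_le_of_frequently_le' (Frequently.of_forall fun k => hu (ns k))

theorem measurable_cubeNorm : Measurable cubeNorm :=
  measurable_lintegral_comp ((ENNReal.continuous_pow 3).comp continuous_enorm)

theorem cubeNorm_chi {n : ℕ} {q : Fin n → I} (hq : q ∈ jumpSet n) (x : Fin (n + 1) → ℝ) :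
    cubeNorm (chi q x) = ENNReal.ofReal (∑ i, len q i * |x i| ^ 3) := by
  rw [cubeNorm, lintegral_comp_chi hq x fun y => ‖y‖ₑ ^ 3,
    ENNReal.ofReal_sum_of_nonneg fun i _ => mul_nonneg (len_pos hq i).le (by positivity)]
  refine Finset.sum_congr rfl fun i _ => ?_
  rw [ENNReal.ofReal_mul (len_pos hq i).le, ENNReal.ofReal_pow (abs_nonneg _),
    Real.enorm_eq_ofReal_abs]

/-- Used to dominate 1 + ‖g‖₃³ by a product over the pieces, so that the integral over the values
factorises. -/
theorem one_add_sum_le_prod_one_add {ι : Type*} (s : Finset ι) {a : ι → ℝ} (ha : ∀ i, 0 ≤ a i) :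
    1 + ∑ i ∈ s, a i ≤ ∏ i ∈ s, (1 + a i) := by
  classical
  induction s using Finset.induction_on with
  | empty => simp
  | insert i s hi ih =>
    rw [Finset.sum_insert hi, Finset.prod_insert hi]
    have h1 : 0 ≤ ∑ i ∈ s, a i := Finset.sum_nonneg fun i _ => ha i
    nlinarith [ha i, mul_nonneg (ha i) h1, mul_le_mul_of_nonneg_left ih (ha i)]

/-- With z = √d |y|, the prefactor is at most √d (1 + z³) ≤ 4 √d exp(z²). One unit of the exponent τ
+ 1 absorbs the exponential, and the remaining √d is exactly what makes the Gaussian integral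
independent of d. -/
theorem mul_cube_mul_exp_le {d : ℝ} (hd : 0 < d) (hd1 : d ≤ 1) (τ y : ℝ) :
    d * ((1 + d * |y| ^ 3) * Real.exp (-((τ + 1) * (d * y ^ 2)))) ≤
      4 * √d * Real.exp (-(τ * d) * y ^ 2) := by
  set r := √d with hr
  have hr0 : 0 < r := Real.sqrt_pos.2 hd
  have hr1 : r ≤ 1 := Real.sqrt_le_one.2 hd1
  have hrd : d = r ^ 2 := (Real.sq_sqrt hd.le).symm
  set z := r * |y| with hz
  have hz0 : 0 ≤ z := by positivity
  have h1 : d * (1 + d * |y| ^ 3) ≤ r * (1 + z ^ 3) := by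
    rw [hrd, hz]
    have : r ^ 2 * (1 + r ^ 2 * |y| ^ 3) = r * (r + (r * |y|) ^ 3) := by ring
    rw [this]
    gcongr
  have h2 : 1 + z ^ 3 ≤ 4 * Real.exp (z ^ 2) := by
    have := Real.quadratic_le_exp_of_nonneg (sq_nonneg z)
    nlinarith [sq_nonneg (z ^ 2 - z), sq_nonneg z, sq_nonneg (z - 1), sq_nonneg (z ^ 2 - 1),
      pow_nonneg hz0 3]
  have h3 : d * y ^ 2 = z ^ 2 := by rw [hz, mul_pow, sq_abs, hrd]
  calc d * ((1 + d * |y| ^ 3) * Real.exp (-((τ + 1) * (d * y ^ 2))))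
      = d * (1 + d * |y| ^ 3) * Real.exp (-((τ + 1) * z ^ 2)) := by rw [h3]; ring
    _ ≤ r * (4 * Real.exp (z ^ 2)) * Real.exp (-((τ + 1) * z ^ 2)) := by
        refine mul_le_mul_of_nonneg_right ?_ (Real.exp_nonneg _)
        exact h1.trans (mul_le_mul_of_nonneg_left h2 hr0.le)
    _ = 4 * r * (Real.exp (z ^ 2) * Real.exp (-((τ + 1) * z ^ 2))) := by ring
    _ = 4 * r * Real.exp (-(τ * d) * y ^ 2) := by
        rw [← Real.exp_add, ← h3]; ring_nf

theorem lintegral_gaussian_prod {m : ℕ} {τ : ℝ} (hτ : 0 < τ) {d : Fin m → ℝ} (hd : ∀ i, 0 < d i) :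
    ∫⁻ x : Fin m → ℝ, ENNReal.ofReal (∏ i, (4 * √(d i) * Real.exp (-(τ * d i) * x i ^ 2))) =
      ENNReal.ofReal ((4 * √(Real.pi / τ)) ^ m) := by
  have hint : ∀ i, Integrable fun y : ℝ => 4 * √(d i) * Real.exp (-(τ * d i) * y ^ 2) :=
    fun i => (integrable_exp_neg_mul_sq (mul_pos hτ (hd i))).const_mul _
  rw [← ofReal_integral_eq_lintegral_ofReal (by rw [volume_pi]; exact Integrable.fintype_prod hint)
    (Eventually.of_forall fun x => Finset.prod_nonneg fun i _ => by positivity)]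
  rw [integral_fintype_prod_volume_eq_prod
    fun (i : Fin m) (y : ℝ) => 4 * √(d i) * Real.exp (-(τ * d i) * y ^ 2)]
  have : ∀ i, ∫ y : ℝ, 4 * √(d i) * Real.exp (-(τ * d i) * y ^ 2) = 4 * √(Real.pi / τ) := by
    intro i
    rw [integral_const_mul, integral_gaussian, mul_assoc, ← Real.sqrt_mul (hd i).le]
    congr 2
    have := (hd i).ne'
    field_simp
  simp_rw [this]
  simp

/-- A majorant, in the parameters, of the functions that are integrated over balls. -/
def majorant {n : ℕ} (t : ℝ) (p : (Fin n → I) × (Fin (n + 1) → ℝ)) : ℝ :=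
  ∏ i, ((1 + len p.1 i * |p.2 i| ^ 3) * Real.exp (-(t * (len p.1 i * p.2 i ^ 2))))

theorem continuous_majorant {n : ℕ} (t : ℝ) : Continuous (majorant (n := n) t) := by
  unfold majorant
  refine continuous_finsetProd _ fun i _ => ?_
  have h1 : Continuous fun p : (Fin n → I) × (Fin (n + 1) → ℝ) => len p.1 i :=
    (continuous_len i).comp continuous_fst
  fun_prop

variable (ξ : StieltjesFunction I)

theorem lintegral_majorant_le (n : ℕ) {τ : ℝ} (hτ : 0 < τ) :
    ∫⁻ p, ENNReal.ofReal (majorant (τ + 1) p) ∂paramMeasure ξ n ≤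
      ENNReal.ofReal ((4 * √(Real.pi / τ)) ^ (n + 1)) * ξ.measure univ ^ n := by
  have hm : Measurable fun p : (Fin n → I) × (Fin (n + 1) → ℝ) =>
      ENNReal.ofReal (majorant (τ + 1) p) := (continuous_majorant _).measurable.ennreal_ofReal
  have hw : Measurable fun q : Fin n → I =>
      ∏ i, ENNReal.ofReal ((rightEnd q i : ℝ) - (leftEnd q i : ℝ)) :=
    Finset.measurable_fun_prod _ fun i _ => (continuous_len i).measurable.ennreal_ofReal
  rw [paramMeasure, lintegral_prod _ hm.aemeasurable, muJump,
    lintegral_withDensity_eq_lintegral_mul _ hw hm.lintegral_prod_right']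
  have hbd : ∀ q ∈ jumpSet n, (∏ i, ENNReal.ofReal ((rightEnd q i : ℝ) - (leftEnd q i : ℝ))) *
      ∫⁻ x in monoCone (n + 1), ENNReal.ofReal (majorant (τ + 1) (q, x)) ≤
      ENNReal.ofReal ((4 * √(Real.pi / τ)) ^ (n + 1)) := by
    intro q hq
    have h0 : (∏ i, ENNReal.ofReal ((rightEnd q i : ℝ) - (leftEnd q i : ℝ))) =
        ENNReal.ofReal (∏ i, len q i) :=
      (ENNReal.ofReal_prod_of_nonneg fun i _ => (len_pos hq i).le).symm
    rw [h0]
    calc _ ≤ ENNReal.ofReal (∏ i, len q i) *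
          ∫⁻ x, ENNReal.ofReal (majorant (τ + 1) (q, x)) := by
          gcongr
          exact Measure.restrict_le_self
      _ = ∫⁻ x, ENNReal.ofReal (∏ i, len q i) * ENNReal.ofReal (majorant (τ + 1) (q, x)) :=
          (lintegral_const_mul _ (hm.comp measurable_prodMk_left)).symm
      _ ≤ ∫⁻ x : Fin (n + 1) → ℝ,
          ENNReal.ofReal (∏ i, (4 * √(len q i) * Real.exp (-(τ * len q i) * x i ^ 2))) := by
          refine lintegral_mono fun x => ?_
          rw [← ENNReal.ofReal_mul (Finset.prod_nonneg fun i _ => (len_pos hq i).le), majorant,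
            ← Finset.prod_mul_distrib]
          refine ENNReal.ofReal_le_ofReal (Finset.prod_le_prod (fun i _ => ?_) fun i _ => ?_)
          · have := (len_pos hq i).le
            positivity
          · exact mul_cube_mul_exp_le (len_pos hq i) (len_le_one q i) τ (x i)
      _ = _ := lintegral_gaussian_prod hτ fun i => len_pos hq i
  calc _ ≤ ∫⁻ _ in jumpSet n, ENNReal.ofReal ((4 * √(Real.pi / τ)) ^ (n + 1))
        ∂Measure.pi fun _ : Fin n => ξ.measure := by
        refine setLIntegral_mono measurable_const fun q hq => ?_
        exact hbd q hq
    _ ≤ ENNReal.ofReal ((4 * √(Real.pi / τ)) ^ (n + 1)) *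
        (Measure.pi fun _ : Fin n => ξ.measure) univ := by
        rw [setLIntegral_const]
        gcongr
        exact subset_univ _
    _ = _ := by rw [Measure.pi_univ]; simp

/-- The function that is `1 + ‖g‖₃³` on the ball of radius `R`, and `0` elsewhere. -/
def ballWeight (R : ℝ) (g : L2) : ℝ≥0∞ := (Metric.closedBall 0 R).indicator (1 + cubeNorm) g

theorem measurable_ballWeight (R : ℝ) : Measurable (ballWeight R) :=
  (measurable_const.add measurable_cubeNorm).indicator Metric.isClosed_closedBall.measurableSet

/-- Chernoff's bound: on the ball, 1 ≤ exp(t(R² − ‖g‖²)), and ‖χ(q, x)‖² is the sum of the terms len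
· x². -/
theorem ballWeight_chi_le {n : ℕ} {R t : ℝ} (ht : 0 ≤ t)
    {p : (Fin n → I) × (Fin (n + 1) → ℝ)} (hp : p.1 ∈ jumpSet n) :
    ballWeight R (chi p.1 p.2) ≤ ENNReal.ofReal (Real.exp (t * R ^ 2)) *
      ENNReal.ofReal (majorant t p) := by
  have hl := fun i => (len_pos hp i).le
  by_cases h : chi p.1 p.2 ∈ Metric.closedBall (0 : L2) R
  · rw [ballWeight, indicator_of_mem h, Pi.add_apply, cubeNorm_chi hp, Pi.one_apply,
      ← ENNReal.ofReal_one, ← ENNReal.ofReal_add zero_le_one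
        (Finset.sum_nonneg fun i _ => mul_nonneg (hl i) (by positivity)),
      ← ENNReal.ofReal_mul (Real.exp_nonneg _)]
    refine ENNReal.ofReal_le_ofReal ?_
    rw [mem_closedBall_zero_iff] at h
    have h2 : ∑ i, len p.1 i * p.2 i ^ 2 ≤ R ^ 2 := by
      rw [← norm_sq_chi hp]
      gcongr
    rw [majorant, Finset.prod_mul_distrib, ← Real.exp_sum, mul_left_comm, ← Real.exp_add]
    have h3 : 1 ≤ Real.exp (t * R ^ 2 + ∑ i, -(t * (len p.1 i * p.2 i ^ 2))) := by
      rw [Real.one_le_exp_iff, Finset.sum_neg_distrib, ← Finset.mul_sum]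
      nlinarith
    have h4 : 1 + ∑ i, len p.1 i * |p.2 i| ^ 3 ≤ ∏ i, (1 + len p.1 i * |p.2 i| ^ 3) :=
      one_add_sum_le_prod_one_add _ fun i => mul_nonneg (hl i) (by positivity)
    calc _ ≤ ∏ i, (1 + len p.1 i * |p.2 i| ^ 3) := h4
      _ ≤ _ := le_mul_of_one_le_right (Finset.prod_nonneg fun i _ => by
          have := hl i
          positivity) h3
  · rw [ballWeight, indicator_of_notMem h]
    exact zero_le

theorem lintegral_ballWeight_lt_top (R : ℝ) : ∫⁻ g : L2upOf ξ, ballWeight R g ∂Xi ξ < ⊤ := by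
  rw [lintegral_Xi ξ (f := fun g => ballWeight R g)
    ((measurable_ballWeight R).comp measurable_subtype_coe)]
  set C : ℝ := (ξ.measure univ).toReal with hC
  have hC0 : 0 ≤ C := ENNReal.toReal_nonneg
  -- This τ is chosen to make each Gaussian factor equal to 1/(2(C + 1)), where C is the total mass
  -- of dξ; the n-th term is then at most a constant times 2^(−n).
  set τ : ℝ := Real.pi * (8 * (C + 1)) ^ 2 with hτ
  have hτ0 : 0 < τ := by positivity
  have hρ : 4 * √(Real.pi / τ) = 1 / (2 * (C + 1)) := by
    have : Real.pi / τ = (1 / (8 * (C + 1))) ^ 2 := by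
      rw [hτ]; field_simp
    rw [this, Real.sqrt_sq (by positivity)]
    field_simp
    norm_num
  have hbd : ∀ n, ∫⁻ p, ballWeight R (chiUp ξ p) ∂paramMeasure ξ n ≤
      ENNReal.ofReal (Real.exp ((τ + 1) * R ^ 2)) * ENNReal.ofReal ((1 / 2) ^ n) := by
    intro n
    calc ∫⁻ p, ballWeight R (chiUp ξ p) ∂paramMeasure ξ n
        ≤ ∫⁻ p, ENNReal.ofReal (Real.exp ((τ + 1) * R ^ 2)) *
            ENNReal.ofReal (majorant (τ + 1) p) ∂paramMeasure ξ n := by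
          refine lintegral_mono_ae ?_
          filter_upwards [ae_chiUp ξ n, ae_goodSet ξ n] with p h1 h2
          rw [h1]
          exact ballWeight_chi_le (by positivity) h2.1
      _ = ENNReal.ofReal (Real.exp ((τ + 1) * R ^ 2)) *
            ∫⁻ p, ENNReal.ofReal (majorant (τ + 1) p) ∂paramMeasure ξ n :=
          lintegral_const_mul _ (continuous_majorant _).measurable.ennreal_ofReal
      _ ≤ _ := by
          gcongr
          refine (lintegral_majorant_le ξ n hτ0).trans ?_
          rw [hρ, ← ENNReal.ofReal_toReal (measure_ne_top ξ.measure univ), ← hC,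
            ← ENNReal.ofReal_pow hC0, ← ENNReal.ofReal_mul (by positivity)]
          refine ENNReal.ofReal_le_ofReal ?_
          have h1 : 1 / (2 * (C + 1)) ≤ 1 := by
            rw [div_le_one (by positivity)]; linarith
          have h2 : 1 / (2 * (C + 1)) * C ≤ 1 / 2 := by
            rw [div_mul_eq_mul_div, div_le_div_iff₀ (by positivity) (by positivity)]; linarith
          calc (1 / (2 * (C + 1))) ^ (n + 1) * C ^ n
              = (1 / (2 * (C + 1)) * C) ^ n * (1 / (2 * (C + 1))) := by rw [pow_succ, mul_pow]; ring
            _ ≤ (1 / 2) ^ n * 1 := by gcongr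
            _ = (1 / 2) ^ n := mul_one _
  refine (ENNReal.tsum_le_tsum hbd).trans_lt ?_
  rw [ENNReal.tsum_mul_left, ← ENNReal.ofReal_tsum_of_nonneg (fun n => by positivity)
    (summable_geometric_of_lt_one (by norm_num) (by norm_num))]
  exact ENNReal.mul_lt_top ENNReal.ofReal_lt_top ENNReal.ofReal_lt_top

theorem measure_closedBall_lt_top (R : ℝ) : Xi ξ {g | ‖(g : L2)‖ ≤ R} < ⊤ := by
  refine lt_of_le_of_lt ?_ (lintegral_ballWeight_lt_top ξ R)
  have hs : MeasurableSet {g : L2upOf ξ | ‖(g : L2)‖ ≤ R} :=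
    (isClosed_le (continuous_norm.comp continuous_subtype_val) continuous_const).measurableSet
  rw [← lintegral_indicator_one hs]
  refine lintegral_mono fun g => ?_
  by_cases h : ‖(g : L2)‖ ≤ R
  · rw [indicator_of_mem (show g ∈ {g : L2upOf ξ | ‖(g : L2)‖ ≤ R} from h), ballWeight,
      indicator_of_mem (mem_closedBall_zero_iff.2 h)]
    simp
  · rw [indicator_of_notMem (show g ∉ {g : L2upOf ξ | ‖(g : L2)‖ ≤ R} from h)]
    exact zero_le

end Integrability

/-! ### The projection `pr_g` at a step function -/

instance secondCountableTopology_L2 : SecondCountableTopology L2 := by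
  have : Fact ((2 : ℝ≥0∞) ≠ ⊤) := ⟨by norm_num⟩
  infer_instance

section Projection

variable {n : ℕ}

theorem piece_coeFn {q : Fin n → I} (hq : q ∈ jumpSet n) (i : Fin (n + 1)) :
    ∀ᵐ s : I, ∀ j, s ∈ Ico (leftEnd q j) (rightEnd q j) → piece q i s = if j = i then 1 else 0 := by
  have h := sum_smul_piece_coeFn hq fun j => if j = i then (1 : ℝ) else 0
  simpa using h

/-- Since the values are distinct, the i-th piece is a level set of the step function, up to a null
set. -/
theorem piece_mem_lpMeas {p : (Fin n → I) × (Fin (n + 1) → ℝ)} (hp : p ∈ goodSet n)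
    (i : Fin (n + 1)) : piece p.1 i ∈ lpMeas ℝ ℝ (sigmaAlg (chi p.1 p.2)) 2 (volume : Measure I) := by
  refine mem_lpMeas_iff_aestronglyMeasurable.2
    ⟨(chi p.1 p.2 ⁻¹' {p.2 i}).indicator fun _ => (1 : ℝ), ?_, ?_⟩
  · refine (@stronglyMeasurable_const _ _ (sigmaAlg (chi p.1 p.2)) _ _).indicator ?_
    exact ⟨{p.2 i}, measurableSet_singleton _, rfl⟩
  · filter_upwards [piece_coeFn hp.1 i, chi_coeFn hp.1 p.2, ae_exists_mem_piece p.1]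
      with s h1 h2 ⟨j, hj⟩
    rw [h1 j hj]
    have h3 : s ∈ chi p.1 p.2 ⁻¹' {p.2 i} ↔ j = i := by
      rw [mem_preimage, h2 j hj, mem_singleton_iff]
      exact hp.2.injective.eq_iff
    by_cases hji : j = i
    · rw [if_pos hji, indicator_of_mem (h3.2 hji)]
    · rw [if_neg hji, indicator_of_notMem (mt h3.1 hji)]

/-- By the Doob–Dynkin factorisation, a function measurable for σ(g) is a function of g, hence
constant on the pieces. -/
theorem eq_sum_piece_of_mem_lpMeas {p : (Fin n → I) × (Fin (n + 1) → ℝ)} (hp : p ∈ goodSet n)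
    {f : L2} (hf : f ∈ lpMeas ℝ ℝ (sigmaAlg (chi p.1 p.2)) 2 (volume : Measure I)) :
    ∃ c : Fin (n + 1) → ℝ, f = ∑ i, c i • piece p.1 i := by
  obtain ⟨F, hF, hfF⟩ := mem_lpMeas_iff_aestronglyMeasurable.1 hf
  obtain ⟨k, -, rfl⟩ := hF.exists_eq_measurable_comp
  refine ⟨fun i => k (p.2 i), Lp.ext ?_⟩
  filter_upwards [hfF, chi_coeFn hp.1 p.2, ae_exists_mem_piece p.1,
    sum_smul_piece_coeFn hp.1 fun i => k (p.2 i)] with s h1 h2 ⟨j, hj⟩ h3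
  rw [h1, h3 j hj, Function.comp_apply, h2 j hj]

/-- The pieces are orthogonal with squared norms equal to their lengths and span the range of the
projection, so the coefficients are the averages. -/
theorem pr_chi {p : (Fin n → I) × (Fin (n + 1) → ℝ)} (hp : p ∈ goodSet n) (h : L2) :
    pr (chi p.1 p.2) h = ∑ i, (inner ℝ (piece p.1 i) h / len p.1 i) • piece p.1 i := by
  have hle := (Lp.stronglyMeasurable (chi p.1 p.2)).measurable.comap_le
  have : Fact (sigmaAlg (chi p.1 p.2) ≤ (inferInstance : MeasurableSpace I)) := ⟨hle⟩
  refine Submodule.eq_starProjection_of_mem_of_inner_eq_zero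
    (Submodule.sum_mem _ fun i _ => Submodule.smul_mem _ _ (piece_mem_lpMeas hp i)) ?_
  intro w hw
  obtain ⟨c, rfl⟩ := eq_sum_piece_of_mem_lpMeas hp hw
  rw [inner_sub_left, inner_sum_sum hp.1, inner_sum, sub_eq_zero]
  refine Finset.sum_congr rfl fun i _ => ?_
  rw [real_inner_smul_right, real_inner_comm]
  have := (len_pos hp.1 i).ne'
  field_simp

theorem pr_add (g h k : L2) : pr g (h + k) = pr g h + pr g k := by simp [pr]

theorem pr_smul (g : L2) (c : ℝ) (h : L2) : pr g (c • h) = c • pr g h := by simp [pr]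

theorem norm_pr_le (g h : L2) : ‖pr g h‖ ≤ ‖h‖ :=
  norm_condExpL2_coe_le (Lp.stronglyMeasurable g).measurable.comap_le h

theorem inner_pr_left (g h k : L2) : inner ℝ (pr g h) k = inner ℝ h (pr g k) :=
  inner_condExpL2_left_eq_right (𝕜 := ℝ) (Lp.stronglyMeasurable g).measurable.comap_le

theorem pr_chi_piece {p : (Fin n → I) × (Fin (n + 1) → ℝ)} (hp : p ∈ goodSet n) (i : Fin (n + 1)) :
    pr (chi p.1 p.2) (piece p.1 i) = piece p.1 i := by
  rw [pr_chi hp, Finset.sum_eq_single i]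
  · have := inner_piece_sum hp.1 (fun j => if j = i then (1 : ℝ) else 0) i
    simp only [ite_smul, one_smul, zero_smul, Finset.sum_ite_eq', Finset.mem_univ, if_true] at this
    rw [this, mul_one, div_self (len_pos hp.1 i).ne', one_smul]
  · intro j _ hj
    have := inner_piece_sum hp.1 (fun j => if j = i then (1 : ℝ) else 0) j
    simp only [ite_smul, one_smul, zero_smul, Finset.sum_ite_eq', Finset.mem_univ, if_true] at this
    rw [this, if_neg hj, mul_zero, zero_div, zero_smul]
  · simp

/-! Parameters of nondegenerate step functions are determined by the step function. -/

theorem volume_level_chi {p : (Fin n → I) × (Fin (n + 1) → ℝ)} (hp : p ∈ goodSet n) (a : ℝ) :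
    volume {s : I | chi p.1 p.2 s = a} =
      ∑ i, if p.2 i = a then ENNReal.ofReal (len p.1 i) else 0 := by
  have h := lintegral_comp_chi hp.1 p.2 (({a} : Set ℝ).indicator 1)
  have hm : MeasurableSet {s : I | chi p.1 p.2 s = a} :=
    (Lp.stronglyMeasurable (chi p.1 p.2)).measurable (measurableSet_singleton a)
  have h2 : ∀ s : I, ({a} : Set ℝ).indicator (1 : ℝ → ℝ≥0∞) (chi p.1 p.2 s) =
      {s : I | chi p.1 p.2 s = a}.indicator 1 s := fun s => rfl
  simp_rw [h2] at h
  rw [lintegral_indicator_one hm] at h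
  rw [h]
  refine Finset.sum_congr rfl fun i _ => ?_
  by_cases hi : p.2 i = a <;> simp [hi]

theorem volume_level_chi_self {p : (Fin n → I) × (Fin (n + 1) → ℝ)} (hp : p ∈ goodSet n)
    (i : Fin (n + 1)) :
    volume {s : I | chi p.1 p.2 s = p.2 i} = ENNReal.ofReal (len p.1 i) := by
  rw [volume_level_chi hp]
  simp [hp.2.injective.eq_iff]

theorem range_eq_levels {p : (Fin n → I) × (Fin (n + 1) → ℝ)} (hp : p ∈ goodSet n) :
    range p.2 = {a | volume {s : I | chi p.1 p.2 s = a} ≠ 0} := by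
  ext a
  refine ⟨?_, fun h => ?_⟩
  · rintro ⟨i, rfl⟩
    change volume {s : I | chi p.1 p.2 s = p.2 i} ≠ 0
    rw [volume_level_chi_self hp]
    simpa using len_pos hp.1 i
  · by_contra hne
    refine h ?_
    rw [volume_level_chi hp]
    refine Finset.sum_eq_zero fun i _ => if_neg fun hi => hne ⟨i, hi⟩

/-- The values are the levels of positive measure, the lengths are the measures of these levels, and
the jump points follow by summing lengths from the left. -/
theorem chi_injOn : InjOn (fun p : (Fin n → I) × (Fin (n + 1) → ℝ) => chi p.1 p.2) (goodSet n) := by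
  rintro p hp p' hp' (h : chi p.1 p.2 = chi p'.1 p'.2)
  have hx : p.2 = p'.2 := by
    refine (StrictMono.range_inj hp.2 hp'.2).1 ?_
    rw [range_eq_levels hp, range_eq_levels hp', h]
  have hl : ∀ i, len p.1 i = len p'.1 i := by
    intro i
    have h1 := volume_level_chi_self hp i
    rw [h, hx, volume_level_chi_self hp' i] at h1
    exact ((ENNReal.ofReal_eq_ofReal_iff (len_pos hp'.1 i).le (len_pos hp.1 i).le).1 h1).symm
  have hr : ∀ j, ∀ hj : j < n, p.1 ⟨j, hj⟩ = p'.1 ⟨j, hj⟩ := by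
    intro j
    induction j with
    | zero =>
      intro hj
      have h1 := hl (Fin.castSucc ⟨0, hj⟩)
      have h0 : (Fin.castSucc ⟨0, hj⟩ : Fin (n + 1)) = 0 := rfl
      unfold len at h1
      rw [rightEnd, rightEnd, Fin.snoc_castSucc, Fin.snoc_castSucc, h0, leftEnd, leftEnd,
        Fin.cons_zero, Fin.cons_zero] at h1
      exact Subtype.ext (by linarith)
    | succ j ih =>
      intro hj
      have h1 := hl (Fin.castSucc ⟨j + 1, hj⟩)
      have h0 : (Fin.castSucc ⟨j + 1, hj⟩ : Fin (n + 1)) = Fin.succ ⟨j, by omega⟩ := rfl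
      unfold len at h1
      rw [rightEnd, rightEnd, Fin.snoc_castSucc, Fin.snoc_castSucc, h0, leftEnd, leftEnd,
        Fin.cons_succ, Fin.cons_succ, ih (by omega)] at h1
      exact Subtype.ext (by linarith)
  exact Prod.ext (funext fun j => hr j j.2) hx

/-! ### Measurability on L₂↑(ξ) through the parameters -/

variable (ξ : StieltjesFunction I)

/-- A function on `L₂↑(ξ)` is measurable for `Ξ` if it is a measurable function of the parameters
of the step functions. -/
theorem aestronglyMeasurable_Xi {Z : Type*} [TopologicalSpace Z]
    [TopologicalSpace.PseudoMetrizableSpace Z] {f : L2upOf ξ → Z}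
    (h : ∀ n, ∃ f' : (Fin n → I) × (Fin (n + 1) → ℝ) → Z, StronglyMeasurable f' ∧
      ∀ p ∈ goodSet n, (chiUp ξ p : L2) = chi p.1 p.2 → f (chiUp ξ p) = f' p) :
    AEStronglyMeasurable f (Xi ξ) := by
  rw [Xi_eq_sum, aestronglyMeasurable_sum_measure_iff]
  intro n
  obtain ⟨f', hf', hff'⟩ := h n
  set A : Set ((Fin n → I) × (Fin (n + 1) → ℝ)) :=
    {p | p ∈ goodSet n ∧ (chiUp ξ p : L2) = chi p.1 p.2} with hA
  have hAm : MeasurableSet A := (measurableSet_goodSet n).inter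
    (measurableSet_eq_fun (measurable_chiUp ξ n).subtype_val continuous_chi.measurable)
  have : StandardBorelSpace A := hAm.standardBorel
  have hAae : ∀ᵐ p ∂paramMeasure ξ n, p ∈ A := by
    filter_upwards [ae_goodSet ξ n, ae_chiUp ξ n] with p h1 h2 using ⟨h1, h2⟩
  -- Lusin–Souslin: an injective measurable map on a standard Borel space is a measurable embedding,
  -- so measurability of f can be tested after composition with it.
  have hemb : MeasurableEmbedding fun p : A => chiUp ξ p.1 := by
    refine Measurable.measurableEmbedding ((measurable_chiUp ξ n).comp measurable_subtype_coe) ?_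
    intro p p' hpp
    refine Subtype.ext (chi_injOn p.2.1 p'.2.1 ?_)
    change chi p.1.1 p.1.2 = chi p'.1.1 p'.1.2
    rw [← p.2.2, ← p'.2.2]
    exact congrArg Subtype.val hpp
  have hmap : (paramMeasure ξ n).map (chiUp ξ) =
      ((paramMeasure ξ n).comap (Subtype.val : A → _)).map fun p : A => chiUp ξ p.1 := by
    change _ = ((paramMeasure ξ n).comap (Subtype.val : A → _)).map (chiUp ξ ∘ Subtype.val)
    rw [← Measure.map_map (measurable_chiUp ξ n) measurable_subtype_coe,
      map_comap_subtype_coe hAm, Measure.restrict_eq_self_of_ae_mem hAae]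
  rw [hmap, hemb.aestronglyMeasurable_map_iff]
  have : f ∘ (fun p : A => chiUp ξ p.1) = f' ∘ Subtype.val :=
    funext fun p => hff' p.1 p.2.1 p.2.2
  rw [this]
  exact (hf'.comp_measurable measurable_subtype_coe).aestronglyMeasurable

/-- The σ-algebra of the projection varies with g, so measurability is read off from the explicit
formula in terms of the parameters. -/
theorem aestronglyMeasurable_pr {G : L2 → L2} (hG : Continuous G) :
    AEStronglyMeasurable (fun g : L2upOf ξ => pr g (G g)) (Xi ξ) := by
  refine aestronglyMeasurable_Xi ξ fun n => ⟨fun p => ∑ i,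
    (inner ℝ (piece p.1 i) (G (chi p.1 p.2)) / len p.1 i) • piece p.1 i, ?_, fun p hp hc => ?_⟩
  · have h1 : ∀ i, Measurable fun p : (Fin n → I) × (Fin (n + 1) → ℝ) => piece p.1 i :=
      fun i => ((continuous_piece i).comp continuous_fst).measurable
    refine Measurable.stronglyMeasurable ?_
    refine Finset.measurable_fun_sum _ fun i _ => Measurable.fun_smul (Measurable.fun_div ?_ ?_) (h1 i)
    · exact (h1 i).inner (hG.comp continuous_chi).measurable
    · exact ((continuous_len i).comp continuous_fst).measurable
  · rw [hc, pr_chi hp]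

/-- Elements of the range of `pr_g` are determined by their integrals over the pieces of `g`. -/
theorem eq_zero_of_pr_eq_self {p : (Fin n → I) × (Fin (n + 1) → ℝ)} (hp : p ∈ goodSet n) {w : L2}
    (hw : pr (chi p.1 p.2) w = w) (h : ∀ i, inner ℝ (piece p.1 i) w = 0) : w = 0 := by
  rw [← hw, pr_chi hp]
  simp [h]

end Projection

/-! ### The algebra `𝓕𝓒` -/

section Cylinder

/-- Smooth functions with compact support are bounded with all their derivatives. -/
theorem CbInf.of_hasCompactSupport {m : ℕ} {u : (Fin m → ℝ) → ℝ} (hu : ContDiff ℝ ∞ u)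
    (hc : HasCompactSupport u) : CbInf u := by
  refine ⟨hu, fun k => ?_⟩
  exact (hu.continuous_iteratedFDeriv (by exact_mod_cast le_top)).bounded_above_of_compact_support
    (hc.iteratedFDeriv k)

/-- The map `g ↦ (⟨g, h₁⟩, …, ⟨g, h_m⟩)`. -/
def coords {m : ℕ} (h : Fin m → L2) : L2 →L[ℝ] (Fin m → ℝ) :=
  ContinuousLinearMap.pi fun j => innerSL ℝ (h j)

theorem coords_apply {m : ℕ} (h : Fin m → L2) (g : L2) :
    coords h g = fun j => (inner ℝ g (h j) : ℝ) := by
  ext j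
  simp [coords, real_inner_comm]

variable (ξ : StieltjesFunction I)

/-- Smooth functions of finitely many inner products with elements of `L₂(ξ)`. -/
def IsCyl (k : L2 → ℝ) : Prop :=
  ∃ (m : ℕ) (u : (Fin m → ℝ) → ℝ) (h : Fin m → L2),
    ContDiff ℝ ∞ u ∧ (∀ j, h j ∈ L2sub ξ) ∧ k = fun g => u (fun j => inner ℝ g (h j))

variable {ξ}

theorem IsCyl.of_fintype {ι : Type*} [Fintype ι] {u : (ι → ℝ) → ℝ} (hu : ContDiff ℝ ∞ u)
    {h : ι → L2} (hh : ∀ j, h j ∈ L2sub ξ) :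
    IsCyl ξ fun g => u (fun j => inner ℝ g (h j)) := by
  refine ⟨Fintype.card ι, fun y => u fun j => y (Fintype.equivFin ι j),
    fun j => h ((Fintype.equivFin ι).symm j), ?_, fun j => hh _, ?_⟩
  · exact hu.comp (by fun_prop)
  · simp

theorem IsCyl.mul {k l : L2 → ℝ} (hk : IsCyl ξ k) (hl : IsCyl ξ l) : IsCyl ξ (k * l) := by
  obtain ⟨m, u, h, hu, hh, rfl⟩ := hk
  obtain ⟨m', u', h', hu', hh', rfl⟩ := hl
  refine ⟨m + m', fun y => u (fun i => y (Fin.castAdd m' i)) * u' (fun i => y (Fin.natAdd m i)),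
    Fin.append h h', ?_, ?_, ?_⟩
  · exact (hu.comp (by fun_prop)).mul (hu'.comp (by fun_prop))
  · exact fun j => Fin.addCases (fun i => by simpa using hh i) (fun i => by simpa using hh' i) j
  · ext g; simp

theorem IsCyl.comp {k : L2 → ℝ} (hk : IsCyl ξ k) {f : ℝ → ℝ} (hf : ContDiff ℝ ∞ f) :
    IsCyl ξ fun g => f (k g) := by
  obtain ⟨m, u, h, hu, hh, rfl⟩ := hk
  exact ⟨m, f ∘ u, h, hf.comp hu, hh, rfl⟩

theorem IsCyl.inner {h : L2} (hh : h ∈ L2sub ξ) : IsCyl ξ fun g => inner ℝ g h :=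
  ⟨1, fun y => y 0, fun _ => h, by fun_prop, fun _ => hh, rfl⟩

theorem IsCyl.one : IsCyl ξ 1 :=
  ⟨0, fun _ => 1, fun _ => 0, contDiff_const, fun _ => Submodule.zero_mem _, rfl⟩

theorem exists_bound_of_hasCompactSupport {φ : ℝ → ℝ} (hφ : HasCompactSupport φ) :
    ∃ R : ℝ, 0 ≤ R ∧ ∀ g : L2, R < ‖g‖ → φ (‖g‖ ^ 2) = 0 := by
  obtain ⟨r, hr⟩ := hφ.isCompact.isBounded.subset_closedBall 0
  refine ⟨√(max r 0), Real.sqrt_nonneg _, fun g hg => ?_⟩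
  by_contra h
  have h1 := hr (subset_tsupport φ (Function.mem_support.2 h))
  rw [mem_closedBall_zero_iff, Real.norm_of_nonneg (sq_nonneg _)] at h1
  rw [Real.sqrt_lt' ((Real.sqrt_nonneg _).trans_lt hg)] at hg
  exact absurd ((le_max_left r 0).trans_lt hg) (not_lt.2 h1)

/-- The first factor of a generator of `𝓕𝓒` may be an arbitrary smooth function of finitely many
inner products. -/
theorem IsCyl.mul_mem_FC {k : L2 → ℝ} (hk : IsCyl ξ k) {φ : ℝ → ℝ} (hφ : ContDiff ℝ ∞ φ)
    (hc : HasCompactSupport φ) : (fun g => k g * φ (‖g‖ ^ 2)) ∈ FC ξ := by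
  obtain ⟨m, u, h, hu, hh, rfl⟩ := hk
  obtain ⟨R, hR0, hR⟩ := exists_bound_of_hasCompactSupport hc
  have hr : 0 < ‖coords h‖ * R + 1 := by positivity
  -- The bump equals 1 at all inner products that occur on the ball outside of which φ(‖g‖²)
  -- vanishes, so u may be cut off without changing the product.
  let b : ContDiffBump (0 : Fin m → ℝ) := ⟨‖coords h‖ * R + 1, ‖coords h‖ * R + 2, hr, by linarith⟩
  refine Submodule.subset_span ⟨m, fun y => u y * b y, φ, h, ?_, hφ, hc, hh, ?_⟩
  · exact CbInf.of_hasCompactSupport (hu.mul b.contDiff) b.hasCompactSupport.mul_left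
  · funext g
    by_cases hg : R < ‖g‖
    · simp [hR g hg]
    · have h1 : ‖coords h g‖ ≤ ‖coords h‖ * R + 1 := by
        refine ((coords h).le_opNorm g).trans ?_
        have := mul_le_mul_of_nonneg_left (not_lt.1 hg) (norm_nonneg (coords h))
        linarith
      rw [coords_apply] at h1
      have h2 : b (fun j => (Inner.inner ℝ g (h j) : ℝ)) = 1 :=
        b.one_of_mem_closedBall (mem_closedBall_zero_iff.2 h1)
      beta_reduce
      rw [h2, mul_one]

theorem CbInf.isCyl {m : ℕ} {u : (Fin m → ℝ) → ℝ} (hu : CbInf u) {h : Fin m → L2}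
    (hh : ∀ j, h j ∈ L2sub ξ) : IsCyl ξ fun g => u (fun j => Inner.inner ℝ g (h j)) :=
  ⟨m, u, h, hu.1, hh, rfl⟩

theorem mul_cyl_mem_FC {U k : L2 → ℝ} (hU : U ∈ FC ξ) (hk : IsCyl ξ k) : U * k ∈ FC ξ := by
  induction hU using Submodule.span_induction with
  | mem U hU =>
    obtain ⟨m, u, φ, h, hu, hφ, hc, hh, rfl⟩ := hU
    convert ((hu.isCyl hh).mul hk).mul_mem_FC hφ hc using 1
    funext g
    simp only [Pi.mul_apply]
    ring
  | zero => simp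
  | add U V _ _ hU hV => rw [add_mul]; exact Submodule.add_mem _ hU hV
  | smul c U _ hU => rw [smul_mul_assoc]; exact Submodule.smul_mem _ _ hU

/-- The algebra property is what allows polynomials to operate on 𝓕𝓒. -/
theorem mul_mem_FC {U V : L2 → ℝ} (hU : U ∈ FC ξ) (hV : V ∈ FC ξ) : U * V ∈ FC ξ := by
  induction hV using Submodule.span_induction with
  | mem V hV =>
    obtain ⟨m', u', ψ, h', hu', hψ, hc', hh', rfl⟩ := hV
    induction hU using Submodule.span_induction with
    | mem U hU =>
      obtain ⟨m, u, φ, h, hu, hφ, hc, hh, rfl⟩ := hU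
      convert ((hu.isCyl hh).mul (hu'.isCyl hh')).mul_mem_FC (hφ.mul hψ) hc.mul_right using 1
      funext g
      simp only [Pi.mul_apply]
      ring
    | zero => simp
    | add U V _ _ hU hV => rw [add_mul]; exact Submodule.add_mem _ hU hV
    | smul c U _ hU => rw [smul_mul_assoc]; exact Submodule.smul_mem _ _ hU
  | zero => simp
  | add V W _ _ hV hW => rw [mul_add]; exact Submodule.add_mem _ hV hW
  | smul c V _ hV => rw [mul_smul_comm]; exact Submodule.smul_mem _ _ hV

/-- Continuously differentiable functions that are bounded together with their derivative, and
that vanish outside of a ball. -/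
structure IsNice (U : L2 → ℝ) : Prop where
  contDiff : ContDiff ℝ 1 U
  bound : ∃ C, ∀ g, |U g| ≤ C ∧ ‖fderiv ℝ U g‖ ≤ C
  support : ∃ R, ∀ g, R < ‖g‖ → U g = 0

theorem IsNice.differentiable {U : L2 → ℝ} (hU : IsNice U) : Differentiable ℝ U :=
  hU.contDiff.differentiable one_ne_zero

theorem IsNice.add {U V : L2 → ℝ} (hU : IsNice U) (hV : IsNice V) : IsNice (U + V) := by
  obtain ⟨C, hC⟩ := hU.bound
  obtain ⟨D, hD⟩ := hV.bound
  obtain ⟨R, hR⟩ := hU.support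
  obtain ⟨S, hS⟩ := hV.support
  refine ⟨hU.contDiff.add hV.contDiff, ⟨C + D, fun g => ⟨?_, ?_⟩⟩, ⟨max R S, fun g hg => ?_⟩⟩
  · exact (abs_add_le _ _).trans (add_le_add (hC g).1 (hD g).1)
  · rw [fderiv_add (hU.differentiable g) (hV.differentiable g)]
    exact (norm_add_le _ _).trans (add_le_add (hC g).2 (hD g).2)
  · rw [Pi.add_apply, hR g ((le_max_left _ _).trans_lt hg), hS g ((le_max_right _ _).trans_lt hg),
      add_zero]

theorem IsNice.smul {U : L2 → ℝ} (hU : IsNice U) (c : ℝ) : IsNice (c • U) := by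
  obtain ⟨C, hC⟩ := hU.bound
  obtain ⟨R, hR⟩ := hU.support
  refine ⟨hU.contDiff.const_smul c, ⟨|c| * C, fun g => ⟨?_, ?_⟩⟩, ⟨R, fun g hg => ?_⟩⟩
  · rw [Pi.smul_apply, smul_eq_mul, abs_mul]
    exact mul_le_mul_of_nonneg_left (hC g).1 (abs_nonneg c)
  · rw [fderiv_const_smul (hU.differentiable g), norm_smul, Real.norm_eq_abs]
    exact mul_le_mul_of_nonneg_left (hC g).2 (abs_nonneg c)
  · rw [Pi.smul_apply, hR g hg, smul_zero]

/-- The derivative 2⟨g, ·⟩ of ‖g‖² is unbounded, but only its values on the ball of radius R matter,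
since φ(‖g‖²) vanishes outside of it. -/
theorem isNice_generator {m : ℕ} {u : (Fin m → ℝ) → ℝ} (hu : CbInf u) {φ : ℝ → ℝ}
    (hφ : ContDiff ℝ ∞ φ) (hc : HasCompactSupport φ) (h : Fin m → L2) :
    IsNice fun g => u (fun j => inner ℝ g (h j)) * φ (‖g‖ ^ 2) := by
  obtain ⟨R, hR0, hR⟩ := exists_bound_of_hasCompactSupport hc
  obtain ⟨C₀, hC₀⟩ := hu.2 0
  obtain ⟨C₁, hC₁⟩ := hu.2 1
  have hφ1 : ContDiff ℝ 1 φ := hφ.of_le (by exact_mod_cast le_top)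
  obtain ⟨D₀, hD₀⟩ := hφ.continuous.bounded_above_of_compact_support hc
  obtain ⟨D₁, hD₁⟩ := (hφ1.continuous_deriv le_rfl).bounded_above_of_compact_support hc.deriv
  simp only [norm_iteratedFDeriv_zero] at hC₀
  simp only [norm_iteratedFDeriv_one] at hC₁
  have hC₀' : 0 ≤ C₀ := (norm_nonneg _).trans (hC₀ 0)
  have hC₁' : 0 ≤ C₁ := (norm_nonneg _).trans (hC₁ 0)
  have hD₀' : 0 ≤ D₀ := (norm_nonneg _).trans (hD₀ 0)
  have hD₁' : 0 ≤ D₁ := (norm_nonneg _).trans (hD₁ 0)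
  have hu1 : ContDiff ℝ 1 u := hu.1.of_le (by exact_mod_cast le_top)
  set U : L2 → ℝ := fun g => u (fun j => inner ℝ g (h j)) * φ (‖g‖ ^ 2) with hU
  have hUeq : U = fun g => u (coords h g) * φ (‖g‖ ^ 2) := by
    funext g; rw [coords_apply]
  have hder : ∀ g, HasFDerivAt U (u (coords h g) • (deriv φ (‖g‖ ^ 2) • (2 • innerSL ℝ g)) +
      φ (‖g‖ ^ 2) • (fderiv ℝ u (coords h g)).comp (coords h)) g := by
    intro g
    rw [hUeq]
    have h1 : HasFDerivAt (fun g => u (coords h g)) ((fderiv ℝ u (coords h g)).comp (coords h)) g :=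
      ((hu1.differentiable one_ne_zero) _).hasFDerivAt.comp g (coords h).hasFDerivAt
    have h2 : HasFDerivAt (fun g : L2 => φ (‖g‖ ^ 2)) (deriv φ (‖g‖ ^ 2) • (2 • innerSL ℝ g)) g :=
      ((hφ1.differentiable one_ne_zero) _).hasDerivAt.comp_hasFDerivAt g
        (hasStrictFDerivAt_norm_sq g).hasFDerivAt
    exact h1.mul h2
  have hsupp : ∀ g, R < ‖g‖ → U g = 0 := fun g hg => by rw [hU]; simp [hR g hg]
  refine ⟨?_, ⟨C₀ * D₀ + (C₀ * (D₁ * (2 * R)) + D₀ * (C₁ * ‖coords h‖)), fun g => ⟨?_, ?_⟩⟩,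
    ⟨R, hsupp⟩⟩
  · rw [hUeq]
    exact (hu1.comp (coords h).contDiff).mul (hφ1.comp (contDiff_norm_sq ℝ))
  · have h1 : |U g| ≤ C₀ * D₀ := by
      rw [hU, abs_mul]
      exact mul_le_mul (hC₀ _) (hD₀ _) (abs_nonneg _) hC₀'
    have h2 : 0 ≤ C₀ * (D₁ * (2 * R)) + D₀ * (C₁ * ‖coords h‖) := by positivity
    linarith
  · have h0 : 0 ≤ C₀ * D₀ := by positivity
    by_cases hg : R < ‖g‖
    · have : U =ᶠ[𝓝 g] fun _ => (0 : ℝ) := by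
        filter_upwards [(isOpen_lt continuous_const continuous_norm).mem_nhds hg] with x hx
        exact hsupp x hx
      rw [this.fderiv_eq, fderiv_fun_const]
      simp only [Pi.zero_apply, norm_zero]
      positivity
    · rw [(hder g).fderiv]
      have hg' := not_lt.1 hg
      have h2 : ‖(2 • innerSL ℝ g : L2 →L[ℝ] ℝ)‖ ≤ 2 * R := by
        refine (norm_nsmul_le (n := 2) (a := innerSL ℝ g)).trans ?_
        rw [innerSL_apply_norm]
        simpa using hg'
      have h3 : ‖u (coords h g) • (deriv φ (‖g‖ ^ 2) • (2 • innerSL ℝ g : L2 →L[ℝ] ℝ))‖ ≤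
          C₀ * (D₁ * (2 * R)) := by
        rw [norm_smul, norm_smul]
        gcongr
        · exact hC₀ _
        · exact hD₁ _
      have h4 : ‖φ (‖g‖ ^ 2) • (fderiv ℝ u (coords h g)).comp (coords h)‖ ≤
          D₀ * (C₁ * ‖coords h‖) := by
        rw [norm_smul]
        refine mul_le_mul (hD₀ _) ?_ (norm_nonneg _) hD₀'
        exact (ContinuousLinearMap.opNorm_comp_le _ _).trans
          (mul_le_mul_of_nonneg_right (hC₁ _) (norm_nonneg _))
      exact (norm_add_le _ _).trans (by linarith)

theorem isNice_of_mem_FC {U : L2 → ℝ} (hU : U ∈ FC ξ) : IsNice U := by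
  induction hU using Submodule.span_induction with
  | mem U hU =>
    obtain ⟨m, u, φ, h, hu, hφ, hc, hh, rfl⟩ := hU
    exact isNice_generator hu hφ hc h
  | zero =>
    refine ⟨contDiff_const, ⟨0, fun g => ⟨by simp, ?_⟩⟩, ⟨0, fun g _ => rfl⟩⟩
    rw [show (0 : L2 → ℝ) = fun _ => 0 from rfl, fderiv_fun_const]
    simp
  | add U V _ _ hU hV => exact hU.add hV
  | smul c U _ hU => exact hU.smul c

end Cylinder

/-! ### Functions in `𝓕𝓒` and their gradients as elements of `L₂(Ξ)` -/

/-- Let `𝒜` be closed and convex. A limit of first components for which the second components can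
be chosen bounded is again a first component, with the same bound. -/
theorem exists_mem_of_bounded_snd {H₁ H₂ : Type*} [NormedAddCommGroup H₁] [NormedSpace ℝ H₁]
    [NormedAddCommGroup H₂] [InnerProductSpace ℝ H₂] [CompleteSpace H₂] {𝒜 : Set (H₁ × H₂)}
    (hconv : Convex ℝ 𝒜) (hcl : IsClosed 𝒜) {a : H₁} {C : ℝ}
    (h : ∀ ε > (0 : ℝ), ∃ p ∈ 𝒜, ‖p.1 - a‖ ≤ ε ∧ ‖p.2‖ ≤ C) :
    ∃ b, (a, b) ∈ 𝒜 ∧ ‖b‖ ≤ C := by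
  -- The sets B n collect the second components of pairs whose first component is within 1/(n + 1)
  -- of a. The elements p n of least norm in their closures will converge to the required b.
  set B : ℕ → Set H₂ := fun n => Prod.snd '' (𝒜 ∩ {p | ‖p.1 - a‖ ≤ 1 / ((n : ℝ) + 1)}) with hB
  have hBne : ∀ n, ∃ b ∈ closure (B n), ‖b‖ ≤ C := by
    intro n
    obtain ⟨p, hp, h1, h2⟩ := h (1 / ((n : ℝ) + 1)) Nat.one_div_pos_of_nat
    exact ⟨p.2, subset_closure ⟨p, ⟨hp, h1⟩, rfl⟩, h2⟩
  have hBconv : ∀ n, Convex ℝ (closure (B n)) := by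
    intro n
    refine Convex.closure ?_
    have h1 : Convex ℝ {p : H₁ × H₂ | ‖p.1 - a‖ ≤ 1 / ((n : ℝ) + 1)} := by
      have : {p : H₁ × H₂ | ‖p.1 - a‖ ≤ 1 / ((n : ℝ) + 1)} =
          (LinearMap.fst ℝ H₁ H₂) ⁻¹' Metric.closedBall a (1 / ((n : ℝ) + 1)) := by
        ext p; simp [dist_eq_norm]
      rw [this]
      exact (convex_closedBall _ _).linear_preimage _
    exact (hconv.inter h1).linear_image (LinearMap.snd ℝ H₁ H₂)
  have hBmono : Antitone fun n => closure (B n) := by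
    refine antitone_nat_of_succ_le fun n => closure_mono (image_mono ?_)
    refine inter_subset_inter_right _ fun p (hp : ‖p.1 - a‖ ≤ _) => hp.trans ?_
    exact Nat.one_div_le_one_div (Nat.le_succ n)
  choose p hpB hp using fun n => exists_norm_eq_iInf_of_complete_convex (K := closure (B n))
    (let ⟨b, hb, _⟩ := hBne n; ⟨b, hb⟩) isClosed_closure.isComplete (hBconv n) 0
  have hmin : ∀ n, ∀ b ∈ closure (B n), ‖p n‖ ≤ ‖b‖ := by
    intro n b hb
    have h1 := hp n
    rw [zero_sub, norm_neg] at h1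
    rw [h1]
    have h2 := ciInf_le (f := fun w : closure (B n) => ‖(0 : H₂) - w‖)
      ⟨0, by rintro _ ⟨w, rfl⟩; exact norm_nonneg _⟩ ⟨b, hb⟩
    simpa using h2
  have hpC : ∀ n, ‖p n‖ ≤ C := fun n => let ⟨b, hb, hbC⟩ := hBne n; (hmin n b hb).trans hbC
  have hpmono : Monotone fun n => ‖p n‖ ^ 2 := by
    intro n m hnm
    have := hmin n (p m) (hBmono hnm (hpB m))
    dsimp only
    gcongr
  have hlim := tendsto_atTop_ciSup hpmono ⟨C ^ 2, by
    rintro _ ⟨n, rfl⟩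
    exact pow_le_pow_left₀ (norm_nonneg _) (hpC n) 2⟩
  -- Parallelogram law: the midpoint of p m and p n is in the closure of B n, so its norm is at
  -- least ‖p n‖. As the norms ‖p n‖ increase to a limit, the sequence is Cauchy.
  have hest : ∀ n m, n ≤ m → ‖p m - p n‖ ^ 2 ≤ 2 * (‖p m‖ ^ 2 - ‖p n‖ ^ 2) := by
    intro n m hnm
    have hmid : (1 / 2 : ℝ) • p m + (1 / 2 : ℝ) • p n ∈ closure (B n) :=
      hBconv n (hBmono hnm (hpB m)) (hpB n) (by norm_num) (by norm_num) (by norm_num)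
    have h1 := hmin n _ hmid
    rw [← smul_add, norm_smul, Real.norm_of_nonneg (by norm_num)] at h1
    have h2 := parallelogram_law_with_norm ℝ (p m) (p n)
    have h3 : (2 * ‖p n‖) ^ 2 ≤ ‖p m + p n‖ ^ 2 :=
      pow_le_pow_left₀ (by positivity) (by linarith) 2
    nlinarith
  have hcauchy : CauchySeq p := by
    rw [Metric.cauchySeq_iff']
    intro ε hε
    obtain ⟨N, hN⟩ := Metric.cauchySeq_iff'.1 hlim.cauchySeq (ε ^ 2 / 2) (by positivity)
    refine ⟨N, fun n hn => ?_⟩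
    have h1 := hN n hn
    rw [Real.dist_eq] at h1
    have h2 := hest N n hn
    rw [dist_eq_norm]
    refine lt_of_pow_lt_pow_left₀ 2 hε.le ?_
    linarith [le_abs_self (‖p n‖ ^ 2 - ‖p N‖ ^ 2)]
  obtain ⟨b, hb⟩ := cauchySeq_tendsto_of_complete hcauchy
  refine ⟨b, ?_, le_of_tendsto' hb.norm hpC⟩
  have hbB : ∀ n, b ∈ closure (B n) := fun n => isClosed_closure.mem_of_tendsto hb
    ((eventually_ge_atTop n).mono fun m hm => hBmono hm (hpB m))
  rw [← hcl.closure_eq, Metric.mem_closure_iff]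
  intro ε hε
  obtain ⟨n, hn⟩ := exists_nat_one_div_lt hε
  obtain ⟨_, ⟨r, hr, rfl⟩, hrb⟩ := Metric.mem_closure_iff.1 (hbB n) ε hε
  refine ⟨r, hr.1, ?_⟩
  rw [Prod.dist_eq, max_lt_iff]
  refine ⟨?_, hrb⟩
  rw [dist_comm, dist_eq_norm]
  exact lt_of_le_of_lt hr.2 hn

section LpObjects

variable (ξ : StieltjesFunction I)

/-- Bounded functions that vanish outside of a ball are square integrable. -/
theorem memLp_Xi_of_bounded {F : Type*} [NormedAddCommGroup F] {f : L2upOf ξ → F}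
    (hf : AEStronglyMeasurable f (Xi ξ)) {C R : ℝ} (hC : ∀ g, ‖f g‖ ≤ C)
    (hR : ∀ g : L2upOf ξ, R < ‖(g : L2)‖ → f g = 0) : MemLp f 2 (Xi ξ) := by
  have hs : MeasurableSet {g : L2upOf ξ | ‖(g : L2)‖ ≤ R} :=
    (isClosed_le (continuous_norm.comp continuous_subtype_val) continuous_const).measurableSet
  refine (memLp_indicator_const 2 hs C (Or.inr (measure_closedBall_lt_top ξ R).ne)).mono hf
    (Eventually.of_forall fun g => ?_)
  by_cases h : g ∈ {g : L2upOf ξ | ‖(g : L2)‖ ≤ R}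
  · rw [indicator_of_mem h]
    exact (hC g).trans (le_abs_self C)
  · rw [indicator_of_notMem h, hR g (not_le.1 h)]
    simp

variable {ξ}

theorem norm_gradient_eq (U : L2 → ℝ) (g : L2) : ‖gradient U g‖ = ‖fderiv ℝ U g‖ := by
  rw [gradient, LinearIsometryEquiv.norm_map]

theorem IsNice.fderiv_eq_zero {U : L2 → ℝ} {R : ℝ} (hR : ∀ g, R < ‖g‖ → U g = 0) {g : L2}
    (hg : R < ‖g‖) : fderiv ℝ U g = 0 := by
  have : U =ᶠ[𝓝 g] fun _ => (0 : ℝ) := by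
    filter_upwards [(isOpen_lt continuous_const continuous_norm).mem_nhds hg] with x hx
    exact hR x hx
  rw [this.fderiv_eq, fderiv_fun_const, Pi.zero_apply]

theorem norm_DD_le (U : L2 → ℝ) (g : L2) : ‖DD U g‖ ≤ ‖fderiv ℝ U g‖ :=
  (norm_pr_le _ _).trans (norm_gradient_eq U g).le

theorem IsNice.continuous_gradient {U : L2 → ℝ} (hU : IsNice U) : Continuous (gradient U) :=
  (InnerProductSpace.toDual ℝ L2).symm.continuous.comp (hU.contDiff.continuous_fderiv one_ne_zero)

theorem IsNice.memLp {U : L2 → ℝ} (hU : IsNice U) : MemLp (fun g : L2upOf ξ => U g) 2 (Xi ξ) := by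
  obtain ⟨C, hC⟩ := hU.bound
  obtain ⟨R, hR⟩ := hU.support
  exact memLp_Xi_of_bounded ξ (hU.contDiff.continuous.comp continuous_subtype_val).aestronglyMeasurable
    (fun g => (hC g).1) fun g hg => hR g hg

theorem IsNice.memLp_DD {U : L2 → ℝ} (hU : IsNice U) :
    MemLp (fun g : L2upOf ξ => DD U g) 2 (Xi ξ) := by
  obtain ⟨C, hC⟩ := hU.bound
  obtain ⟨R, hR⟩ := hU.support
  refine memLp_Xi_of_bounded ξ (aestronglyMeasurable_pr ξ hU.continuous_gradient)
    (fun g => (norm_DD_le U g).trans (hC g).2) (R := R) fun g hg => ?_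
  rw [← norm_le_zero_iff]
  refine (norm_DD_le U g).trans ?_
  rw [IsNice.fderiv_eq_zero hR hg, norm_zero]

theorem DD_add {U V : L2 → ℝ} {g : L2} (hU : DifferentiableAt ℝ U g) (hV : DifferentiableAt ℝ V g) :
    DD (U + V) g = DD U g + DD V g := by
  rw [DD, DD, DD, ← pr_add, gradient, gradient, gradient, fderiv_add hU hV, map_add]

theorem DD_smul {U : L2 → ℝ} {g : L2} (hU : DifferentiableAt ℝ U g) (c : ℝ) :
    DD (c • U) g = c • DD U g := by
  rw [DD, DD, ← pr_smul, gradient, gradient, fderiv_const_smul hU, map_smulₛₗ]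
  simp

variable (ξ)

/-- The class in `L₂(Ξ)` of a function in `𝓕𝓒`. -/
def toLp : FC ξ →ₗ[ℝ] Lp ℝ 2 (Xi ξ) where
  toFun U := (isNice_of_mem_FC U.2).memLp.toLp _
  map_add' U V := MemLp.toLp_add (isNice_of_mem_FC U.2).memLp (isNice_of_mem_FC V.2).memLp
  map_smul' c U := MemLp.toLp_const_smul c (isNice_of_mem_FC U.2).memLp

/-- The class in `L₂(Ξ; L₂)` of the gradient of a function in `𝓕𝓒`. -/
def gradLp : FC ξ →ₗ[ℝ] Lp L2 2 (Xi ξ) where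
  toFun U := (isNice_of_mem_FC U.2).memLp_DD.toLp _
  map_add' U V := by
    rw [← MemLp.toLp_add]
    congr 1
    funext g
    exact DD_add ((isNice_of_mem_FC U.2).differentiable _) ((isNice_of_mem_FC V.2).differentiable _)
  map_smul' c U := by
    rw [RingHom.id_apply, ← MemLp.toLp_const_smul]
    congr 1
    funext g
    exact DD_smul ((isNice_of_mem_FC U.2).differentiable _) c

variable {ξ}

theorem toLp_coeFn (U : FC ξ) : toLp ξ U =ᵐ[Xi ξ] fun g => U.1 g :=
  (isNice_of_mem_FC U.2).memLp.coeFn_toLp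

theorem gradLp_coeFn (U : FC ξ) : gradLp ξ U =ᵐ[Xi ξ] fun g => DD U.1 g :=
  (isNice_of_mem_FC U.2).memLp_DD.coeFn_toLp

theorem preForm_eq (U V : FC ξ) :
    preForm ξ U V = 1 / 2 * inner ℝ (gradLp ξ U) (gradLp ξ V) := by
  rw [preForm, L2.inner_def]
  congr 1
  refine integral_congr_ae ?_
  filter_upwards [gradLp_coeFn U, gradLp_coeFn V] with g h1 h2
  rw [h1, h2]

theorem preForm_self (U : FC ξ) : preForm ξ U U = 1 / 2 * ‖gradLp ξ U‖ ^ 2 := by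
  rw [preForm_eq, real_inner_self_eq_norm_sq]

theorem integrable_inner_DD (U V : FC ξ) :
    Integrable (fun g : L2upOf ξ => (inner ℝ (DD U.1 g) (DD V.1 g) : ℝ)) (Xi ξ) := by
  refine (L2.integrable_inner (𝕜 := ℝ) (gradLp ξ U) (gradLp ξ V)).congr ?_
  filter_upwards [gradLp_coeFn U, gradLp_coeFn V] with g h1 h2
  rw [h1, h2]

variable (ξ)

/-- The closure of the graph of the gradient. -/
def gradGraph : Submodule ℝ (Lp ℝ 2 (Xi ξ) × Lp L2 2 (Xi ξ)) :=
  (LinearMap.range ((toLp ξ).prod (gradLp ξ))).topologicalClosure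

variable {ξ}

theorem isClosed_gradGraph : IsClosed (gradGraph ξ : Set (Lp ℝ 2 (Xi ξ) × Lp L2 2 (Xi ξ))) :=
  Submodule.isClosed_topologicalClosure _

theorem mem_gradGraph (U : FC ξ) : (toLp ξ U, gradLp ξ U) ∈ gradGraph ξ :=
  Submodule.le_topologicalClosure _ ⟨U, rfl⟩

theorem mem_gradGraph_iff {U : Lp ℝ 2 (Xi ξ)} {W : Lp L2 2 (Xi ξ)} :
    (U, W) ∈ gradGraph ξ ↔ ∃ v : ℕ → FC ξ, Tendsto (fun n => toLp ξ (v n)) atTop (𝓝 U) ∧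
      Tendsto (fun n => gradLp ξ (v n)) atTop (𝓝 W) := by
  constructor
  · intro h
    obtain ⟨x, hx, hlim⟩ := mem_closure_iff_seq_limit.1 h
    choose v hv using hx
    refine ⟨v, ?_, ?_⟩
    · have := (continuous_fst.tendsto _).comp hlim
      refine this.congr fun n => ?_
      rw [Function.comp_apply, ← hv]
      rfl
    · have := (continuous_snd.tendsto _).comp hlim
      refine this.congr fun n => ?_
      rw [Function.comp_apply, ← hv]
      rfl
  · rintro ⟨v, h1, h2⟩
    exact mem_closure_iff_seq_limit.2
      ⟨fun n => (toLp ξ (v n), gradLp ξ (v n)), fun n => ⟨v n, rfl⟩, h1.prodMk_nhds h2⟩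

theorem approx_iff {u : ℕ → L2 → ℝ} {U : Lp ℝ 2 (Xi ξ)} :
    Approx ξ u U ↔ ∃ v : ℕ → FC ξ, (∀ n, u n = v n) ∧
      Tendsto (fun n => toLp ξ (v n)) atTop (𝓝 U) ∧ CauchySeq fun n => gradLp ξ (v n) := by
  have hT : ∀ v : ℕ → FC ξ, (∀ n, u n = v n) →
      (Tendsto (fun n => eLpNorm (fun g : L2upOf ξ => u n g - U g) 2 (Xi ξ)) atTop (𝓝 0) ↔
        Tendsto (fun n => toLp ξ (v n)) atTop (𝓝 U)) := by
    intro v hv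
    rw [Lp.tendsto_Lp_iff_tendsto_eLpNorm']
    refine tendsto_congr fun n => eLpNorm_congr_ae ?_
    filter_upwards [toLp_coeFn (v n)] with g hg
    rw [Pi.sub_apply, hg, hv]
  have hC : ∀ v : ℕ → FC ξ, (∀ n, u n = v n) → ∀ k l,
      preForm ξ (u k - u l) (u k - u l) = 1 / 2 * ‖gradLp ξ (v k) - gradLp ξ (v l)‖ ^ 2 := by
    intro v hv k l
    rw [← map_sub, ← preForm_self, hv, hv]
    rfl
  constructor
  · intro h
    have hv : ∀ n, u n = ((⟨u n, h.mem n⟩ : FC ξ) : L2 → ℝ) := fun n => rfl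
    refine ⟨fun n => ⟨u n, h.mem n⟩, hv, (hT _ hv).1 h.tendsto, ?_⟩
    rw [Metric.cauchySeq_iff]
    intro ε hε
    obtain ⟨N, hN⟩ := h.cauchy (ε ^ 2 / 2) (by positivity)
    refine ⟨N, fun k hk l hl => ?_⟩
    have := hN k hk l hl
    rw [hC _ hv] at this
    rw [dist_eq_norm]
    exact lt_of_pow_lt_pow_left₀ 2 hε.le (by linarith)
  · rintro ⟨v, hv, h1, h2⟩
    refine ⟨fun n => hv n ▸ (v n).2, fun ε hε => ?_, (hT v hv).2 h1⟩
    obtain ⟨N, hN⟩ := Metric.cauchySeq_iff.1 h2 (√ε) (Real.sqrt_pos.2 hε)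
    refine ⟨N, fun k hk l hl => ?_⟩
    have h3 := hN k hk l hl
    rw [dist_eq_norm, Real.lt_sqrt (norm_nonneg _)] at h3
    rw [hC v hv]
    nlinarith [sq_nonneg ‖gradLp ξ (v k) - gradLp ξ (v l)‖]

end LpObjects

/-! ### Locality of the gradient -/

theorem lintegral_enorm_sq {α F : Type*} [MeasurableSpace α] [NormedAddCommGroup F]
    (μ : Measure α) (f : α → F) : ∫⁻ a, ‖f a‖ₑ ^ 2 ∂μ = eLpNorm f 2 μ ^ 2 := by
  rw [eLpNorm_eq_lintegral_rpow_enorm_toReal (by norm_num) (by norm_num), ← ENNReal.rpow_natCast,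
    ← ENNReal.rpow_mul]
  simp

/-- Convergence in `L₁` of a product space implies convergence in `L₁` of almost every fibre along
a subsequence. -/
theorem exists_subseq_tendsto_fibre {A B : Type*} [MeasurableSpace A] [MeasurableSpace B]
    {μ : Measure A} {ν : Measure B} [SFinite ν] {f : ℕ → A × B → ℝ≥0∞}
    (hf : ∀ k, Measurable (f k)) (h : Tendsto (fun k => ∫⁻ p, f k p ∂μ.prod ν) atTop (𝓝 0)) :
    ∃ ns : ℕ → ℕ, StrictMono ns ∧
      ∀ᵐ a ∂μ, Tendsto (fun k => ∫⁻ b, f (ns k) (a, b) ∂ν) atTop (𝓝 0) := by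
  -- Integrals below 2^(−n) along the subsequence make the sum of the fibre integrals integrable,
  -- hence finite almost everywhere, so its terms tend to 0.
  have h1 : ∀ n : ℕ, ∀ᶠ k in atTop, ∫⁻ p, f k p ∂μ.prod ν < ENNReal.ofReal ((1 / 2) ^ n) :=
    fun n => (tendsto_order.1 h).2 _ (ENNReal.ofReal_pos.2 (by positivity))
  obtain ⟨ns, hns, hlt⟩ := extraction_forall_of_eventually h1
  refine ⟨ns, hns, ?_⟩
  have hm : ∀ k, Measurable fun a => ∫⁻ b, f (ns k) (a, b) ∂ν := fun k =>
    (hf (ns k)).lintegral_prod_right'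
  have h2 : ∫⁻ a, ∑' k, ∫⁻ b, f (ns k) (a, b) ∂ν ∂μ ≠ ⊤ := by
    rw [lintegral_tsum fun k => (hm k).aemeasurable]
    refine ne_top_of_le_ne_top (b := ∑' k : ℕ, ENNReal.ofReal ((1 / 2) ^ k)) ?_
      (ENNReal.tsum_le_tsum fun k => ?_)
    · rw [← ENNReal.ofReal_tsum_of_nonneg (fun n => by positivity)
        (summable_geometric_of_lt_one (by norm_num) (by norm_num))]
      exact ENNReal.ofReal_ne_top
    · rw [← lintegral_prod _ (hf (ns k)).aemeasurable]
      exact (hlt k).le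
  filter_upwards [ae_lt_top (Measurable.tsum hm) h2] with a ha
  exact ENNReal.tendsto_atTop_zero_of_tsum_ne_top ha.ne

/-- Integrals against a square integrable function pass to the limit under `L₂`-convergence. -/
theorem tendsto_integral_mul_of_L2 {B : Type*} [MeasurableSpace B] {ν : Measure B} {φ f : B → ℝ}
    {F : ℕ → B → ℝ} (hφ : MemLp φ 2 ν) (hf : AEStronglyMeasurable f ν)
    (hF : ∀ k, AEStronglyMeasurable (F k) ν) (hi : ∀ k, Integrable (fun x => φ x * F k x) ν)
    (h : Tendsto (fun k => ∫⁻ x, ‖F k x - f x‖ₑ ^ 2 ∂ν) atTop (𝓝 0)) :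
    Tendsto (fun k => ∫ x, φ x * F k x ∂ν) atTop (𝓝 (∫ x, φ x * f x ∂ν)) := by
  refine tendsto_integral_of_L1 _ (hφ.1.mul hf) (Eventually.of_forall hi) ?_
  have h1 : Tendsto (fun k => eLpNorm φ 2 ν * eLpNorm (F k - f) 2 ν) atTop (𝓝 0) := by
    have h2 : Tendsto (fun k => eLpNorm (F k - f) 2 ν) atTop (𝓝 0) := by
      have h3 := h.ennrpow_const (1 / 2)
      rw [ENNReal.zero_rpow_of_pos (by norm_num)] at h3
      refine h3.congr fun k => ?_
      have := lintegral_enorm_sq ν (F k - f)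
      simp only [Pi.sub_apply] at this
      rw [this, ← ENNReal.rpow_natCast, ← ENNReal.rpow_mul]
      norm_num
    simpa using ENNReal.Tendsto.const_mul h2 (Or.inr hφ.2.ne)
  refine tendsto_of_tendsto_of_tendsto_of_le_of_le tendsto_const_nhds h1 (fun _ => zero_le)
    fun k => ?_
  dsimp only
  have h4 := eLpNorm_smul_le_mul_eLpNorm (p := 2) (q := 2) (r := 1) ((hF k).sub hf) hφ.1
  rw [eLpNorm_one_eq_lintegral_enorm] at h4
  refine le_trans (le_of_eq (lintegral_congr fun x => ?_)) h4
  simp [mul_sub]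

section Fibre

variable {n : ℕ}

/-- The linear map sending the values of a step function to the step function. -/
def chiL (q : Fin n → I) : (Fin (n + 1) → ℝ) →L[ℝ] L2 :=
  ∑ i, (ContinuousLinearMap.proj i : (Fin (n + 1) → ℝ) →L[ℝ] ℝ).smulRight (piece q i)

theorem chiL_apply (q : Fin n → I) (x : Fin (n + 1) → ℝ) : chiL q x = chi q x := by
  simp [chiL, chi_eq_sum]

theorem chiL_single (q : Fin n → I) (i : Fin (n + 1)) : chiL q (Pi.single i 1) = piece q i := by
  simp [chiL, Pi.single_apply]

/-- The piece is fixed by the self-adjoint pr at χ(q, x), so the full gradient and the projected one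
have the same inner product with it. -/
theorem fderiv_comp_chi {U : L2 → ℝ} (hU : Differentiable ℝ U)
    {p : (Fin n → I) × (Fin (n + 1) → ℝ)} (hp : p ∈ goodSet n) (i : Fin (n + 1)) :
    fderiv ℝ (fun x => U (chi p.1 x)) p.2 (Pi.single i 1) =
      inner ℝ (piece p.1 i) (DD U (chi p.1 p.2)) := by
  have h1 : HasFDerivAt (fun x => U (chi p.1 x))
      ((fderiv ℝ U (chi p.1 p.2)).comp (chiL p.1)) p.2 := by
    simp_rw [← chiL_apply]
    exact (hU _).hasFDerivAt.comp p.2 (chiL p.1).hasFDerivAt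
  rw [h1.fderiv, ContinuousLinearMap.comp_apply, chiL_single, real_inner_comm, DD, inner_pr_left,
    pr_chi_piece hp, ← InnerProductSpace.toDual_apply_apply (𝕜 := ℝ), gradient,
    LinearIsometryEquiv.apply_symm_apply]

/-- Integration by parts on the cone. -/
theorem integral_mul_inner_DD {U : L2 → ℝ} (hU : IsNice U) {q : Fin n → I} (hq : q ∈ jumpSet n)
    {φ : (Fin (n + 1) → ℝ) → ℝ} (hφ : ContDiff ℝ ∞ φ) (hc : HasCompactSupport φ)
    (hs : tsupport φ ⊆ strictCone (n + 1)) (i : Fin (n + 1)) :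
    ∫ x, φ x * inner ℝ (piece q i) (DD U (chi q x)) =
      -∫ x, fderiv ℝ φ x (Pi.single i 1) * U (chi q x) := by
  have hchi : ContDiff ℝ 1 fun x => U (chi q x) := by
    simp_rw [← chiL_apply]
    exact hU.contDiff.comp (chiL q).contDiff
  have hφ1 : ContDiff ℝ 1 φ := hφ.of_le (by exact_mod_cast le_top)
  have hd := (hφ1.continuous_fderiv one_ne_zero).clm_apply
    (continuous_const (y := (Pi.single i 1 : Fin (n + 1) → ℝ)))
  have hd' := (hchi.continuous_fderiv one_ne_zero).clm_apply
    (continuous_const (y := (Pi.single i 1 : Fin (n + 1) → ℝ)))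
  have key := integral_mul_fderiv_eq_neg_fderiv_mul_of_integrable (μ := volume) (f := φ)
    (g := fun x => U (chi q x)) (v := Pi.single i 1)
    ((hd.mul hchi.continuous).integrable_of_hasCompactSupport
      (HasCompactSupport.mul_right (hc.fderiv_apply ℝ _)))
    ((hφ.continuous.mul hd').integrable_of_hasCompactSupport hc.mul_right)
    ((hφ.continuous.mul hchi.continuous).integrable_of_hasCompactSupport hc.mul_right)
    (fun x _ => hφ1.differentiable one_ne_zero x) (fun x _ => hchi.differentiable one_ne_zero x)
  rw [← key]
  refine integral_congr_ae (Eventually.of_forall fun x => ?_)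
  -- The formula for the partial derivative is available on the open cone, which contains the
  -- support of φ; elsewhere φ vanishes.
  by_cases hx : x ∈ tsupport φ
  · dsimp only
    rw [← fderiv_comp_chi hU.differentiable (p := (q, x)) ⟨hq, hs hx⟩ i]
  · simp [image_eq_zero_of_notMem_tsupport hx]

theorem norm_piece_le (q : Fin n → I) (i : Fin (n + 1)) : ‖piece q i‖ ≤ 1 := by
  refine (norm_indicatorConstLp_le (hs := measurableSet_Ico (a := leftEnd q i) (b := rightEnd q i))
    (hμs := measure_ne_top (volume : Measure I) _)).trans ?_
  rw [norm_one, one_mul]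
  exact Real.rpow_le_one measureReal_nonneg measureReal_le_one (by norm_num)

end Fibre

/-! ### Gradients of limits, studied on the fibres -/

theorem continuous_pr (g : L2) : Continuous (pr g) :=
  continuous_subtype_val.comp (condExpL2 (μ := (volume : Measure I)) ℝ ℝ (m := sigmaAlg g)
    (Lp.stronglyMeasurable g).measurable.comap_le).continuous

theorem pr_pr (g h : L2) : pr g (pr g h) = pr g h := by
  have hle := (Lp.stronglyMeasurable g).measurable.comap_le
  have : Fact (sigmaAlg g ≤ (inferInstance : MeasurableSpace I)) := ⟨hle⟩
  exact Submodule.starProjection_eq_self_iff.2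
    (SetLike.coe_mem (condExpL2 (μ := (volume : Measure I)) ℝ ℝ (m := sigmaAlg g) hle h))

variable {ξ : StieltjesFunction I}

/-- Gradients take values in the range of the projections. -/
theorem ae_pr_grad {U : Lp ℝ 2 (Xi ξ)} {W : Lp L2 2 (Xi ξ)} (h : (U, W) ∈ gradGraph ξ) :
    ∀ᵐ g : L2upOf ξ ∂Xi ξ, pr g (W g) = W g := by
  obtain ⟨v, -, hv⟩ := mem_gradGraph_iff.1 h
  obtain ⟨ns, -, hns⟩ := exists_subseq_tendsto_ae hv
  filter_upwards [hns, ae_all_iff.2 fun k => gradLp_coeFn (v (ns k))] with g h1 h2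
  refine tendsto_nhds_unique (((continuous_pr g).tendsto _).comp h1) (h1.congr fun k => ?_)
  rw [Function.comp_apply, h2, DD, pr_pr]

theorem tendsto_lintegral_sub_sq {α F : Type*} [MeasurableSpace α] [NormedAddCommGroup F]
    {μ : Measure α} {u : ℕ → Lp F 2 μ} {U : Lp F 2 μ} (h : Tendsto u atTop (𝓝 U)) :
    Tendsto (fun k => ∫⁻ a, ‖(u k - U : Lp F 2 μ) a‖ₑ ^ 2 ∂μ) atTop (𝓝 0) := by
  simp_rw [lintegral_enorm_sq, ← Lp.enorm_def]
  have h1 : Tendsto (fun k => ‖u k - U‖ₑ) atTop (𝓝 0) := by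
    have h2 := (continuous_enorm.tendsto _).comp (h.sub_const U)
    rw [sub_self, enorm_zero] at h2
    exact h2
  have h3 := ((ENNReal.continuous_pow 2).tendsto 0).comp h1
  rw [zero_pow two_ne_zero] at h3
  exact h3

/-- If `U` vanishes on an open set then so does its gradient. -/
theorem grad_eq_zero_on_open {U : Lp ℝ 2 (Xi ξ)} {W : Lp L2 2 (Xi ξ)} (h : (U, W) ∈ gradGraph ξ)
    {O : Set (L2upOf ξ)} (hO : IsOpen O) (hU : ∀ᵐ g ∂Xi ξ, g ∈ O → U g = 0) :
    ∀ᵐ g ∂Xi ξ, g ∈ O → W g = 0 := by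
  obtain ⟨v, hv1, hv2⟩ := mem_gradGraph_iff.1 h
  obtain ⟨O', hO', rfl⟩ := isOpen_induced_iff.1 hO
  have hWm : StronglyMeasurable W := Lp.stronglyMeasurable W
  rw [ae_Xi_iff]
  swap
  · have h1 : MeasurableSet {g | W g = 0} := hWm.measurable (measurableSet_singleton 0)
    have h2 : {g : L2upOf ξ | g ∈ Subtype.val ⁻¹' O' → W g = 0} =
        (Subtype.val ⁻¹' O')ᶜ ∪ {g | W g = 0} := by
      ext g; simp [imp_iff_not_or]
    rw [h2]
    exact hO.measurableSet.compl.union h1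
  intro n
  set ν := (volume : Measure (Fin (n + 1) → ℝ)).restrict (monoCone (n + 1)) with hν
  -- convergence on almost every fibre
  let F : ℕ → L2upOf ξ → ℝ≥0∞ := fun k g =>
    ‖(toLp ξ (v k) - U : Lp ℝ 2 (Xi ξ)) g‖ₑ ^ 2 + ‖(gradLp ξ (v k) - W : Lp L2 2 (Xi ξ)) g‖ₑ ^ 2
  have hm1 : ∀ k, Measurable fun g => ‖(toLp ξ (v k) - U : Lp ℝ 2 (Xi ξ)) g‖ₑ ^ 2 := fun k =>
    (Lp.stronglyMeasurable _).enorm.pow_const 2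
  have hm2 : ∀ k, Measurable fun g => ‖(gradLp ξ (v k) - W : Lp L2 2 (Xi ξ)) g‖ₑ ^ 2 := fun k =>
    (Lp.stronglyMeasurable _).enorm.pow_const 2
  have hFm : ∀ k, Measurable (F k) := fun k => (hm1 k).add (hm2 k)
  have hFlim : Tendsto (fun k => ∫⁻ p, F k (chiUp ξ p) ∂(muJump ξ n).prod ν) atTop (𝓝 0) := by
    have h1 : Tendsto (fun k => ∫⁻ g, F k g ∂Xi ξ) atTop (𝓝 0) := by
      have h2 := (tendsto_lintegral_sub_sq hv1).add (tendsto_lintegral_sub_sq hv2)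
      rw [add_zero] at h2
      exact h2.congr fun k => (lintegral_add_left (hm1 k) _).symm
    refine tendsto_of_tendsto_of_tendsto_of_le_of_le tendsto_const_nhds h1 (fun _ => zero_le)
      fun k => ?_
    dsimp only
    rw [lintegral_Xi ξ (hFm k)]
    exact ENNReal.le_tsum (f := fun n => ∫⁻ p, F k (chiUp ξ p) ∂paramMeasure ξ n) n
  obtain ⟨ns, -, hns⟩ := exists_subseq_tendsto_fibre (f := fun k p => F k (chiUp ξ p))
    (fun k => (hFm k).comp (measurable_chiUp ξ n)) hFlim
  -- square integrability of the gradient on almost every fibre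
  have hWfib : ∀ᵐ q ∂muJump ξ n, ∫⁻ x, ‖W (chiUp ξ (q, x))‖ₑ ^ 2 ∂ν < ⊤ := by
    have hWm2 : Measurable fun g => ‖W g‖ₑ ^ 2 := hWm.enorm.pow_const 2
    have hm : Measurable fun p => ‖W (chiUp ξ p)‖ₑ ^ 2 := hWm2.comp (measurable_chiUp ξ n)
    refine ae_lt_top hm.lintegral_prod_right' ?_
    rw [← lintegral_prod (fun p => ‖W (chiUp ξ p)‖ₑ ^ 2) hm.aemeasurable]
    have h1 : ∫⁻ g, ‖W g‖ₑ ^ 2 ∂Xi ξ < ⊤ := by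
      rw [lintegral_enorm_sq, ← Lp.enorm_def]
      exact ENNReal.pow_lt_top enorm_lt_top
    rw [lintegral_Xi ξ hWm2] at h1
    exact ((ENNReal.le_tsum (f := fun n => ∫⁻ p, ‖W (chiUp ξ p)‖ₑ ^ 2 ∂paramMeasure ξ n)
      n).trans_lt h1).ne
  -- properties that hold almost everywhere
  have hae : ∀ᵐ g : L2upOf ξ ∂Xi ξ, pr g (W g) = W g ∧ (g ∈ Subtype.val ⁻¹' O' → U g = 0) ∧
      ∀ k, (toLp ξ (v (ns k)) - U : Lp ℝ 2 (Xi ξ)) g = (v (ns k)).1 g - U g ∧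
        (gradLp ξ (v (ns k)) - W : Lp L2 2 (Xi ξ)) g = DD (v (ns k)).1 g - W g := by
    filter_upwards [ae_pr_grad h, hU, ae_all_iff.2 fun k => toLp_coeFn (v (ns k)),
      ae_all_iff.2 fun k => gradLp_coeFn (v (ns k)),
      ae_all_iff.2 fun k => Lp.coeFn_sub (toLp ξ (v (ns k))) U,
      ae_all_iff.2 fun k => Lp.coeFn_sub (gradLp ξ (v (ns k))) W] with g h1 h2 h3 h4 h5 h6
    refine ⟨h1, h2, fun k => ⟨?_, ?_⟩⟩
    · rw [h5, Pi.sub_apply, h3]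
    · rw [h6, Pi.sub_apply, h4]
  have hae' : ∀ᵐ q ∂muJump ξ n, ∀ᵐ x ∂ν, (q, x) ∈ goodSet n ∧
      (chiUp ξ (q, x) : L2) = chi q x ∧ pr (chi q x) (W (chiUp ξ (q, x))) = W (chiUp ξ (q, x)) ∧
      (chi q x ∈ O' → U (chiUp ξ (q, x)) = 0) ∧
      ∀ k, F (ns k) (chiUp ξ (q, x)) = ‖(v (ns k)).1 (chi q x) - U (chiUp ξ (q, x))‖ₑ ^ 2 +
        ‖DD (v (ns k)).1 (chi q x) - W (chiUp ξ (q, x))‖ₑ ^ 2 := by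
    refine Measure.ae_ae_of_ae_prod (μ := muJump ξ n) (ν := ν) (p := fun p => p ∈ goodSet n ∧
      (chiUp ξ p : L2) = chi p.1 p.2 ∧ pr (chi p.1 p.2) (W (chiUp ξ p)) = W (chiUp ξ p) ∧
      (chi p.1 p.2 ∈ O' → U (chiUp ξ p) = 0) ∧
      ∀ k, F (ns k) (chiUp ξ p) = ‖(v (ns k)).1 (chi p.1 p.2) - U (chiUp ξ p)‖ₑ ^ 2 +
        ‖DD (v (ns k)).1 (chi p.1 p.2) - W (chiUp ξ p)‖ₑ ^ 2) ?_
    filter_upwards [ae_goodSet ξ n, ae_chiUp ξ n, ae_param_of_ae_Xi ξ hae n]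
      with p h1 h2 ⟨h3, h4, h5⟩
    rw [h2] at h3
    refine ⟨h1, h2, h3, fun h => h4 (by rw [mem_preimage, h2]; exact h), fun k => ?_⟩
    change ‖(toLp ξ (v (ns k)) - U : Lp ℝ 2 (Xi ξ)) _‖ₑ ^ 2 +
      ‖(gradLp ξ (v (ns k)) - W : Lp L2 2 (Xi ξ)) _‖ₑ ^ 2 = _
    rw [(h5 k).1, (h5 k).2, h2]
  -- it suffices to argue on almost every fibre
  suffices hfib : ∀ᵐ q ∂muJump ξ n, ∀ᵐ x ∂ν, chi q x ∈ O' → W (chiUp ξ (q, x)) = 0 by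
    have hms : MeasurableSet {p : (Fin n → I) × (Fin (n + 1) → ℝ) |
        chi p.1 p.2 ∈ O' → W (chiUp ξ p) = 0} := by
      have h2 : {p : (Fin n → I) × (Fin (n + 1) → ℝ) | chi p.1 p.2 ∈ O' → W (chiUp ξ p) = 0} =
          ((fun p => chi p.1 p.2) ⁻¹' O')ᶜ ∪ {p | W (chiUp ξ p) = 0} := by
        ext g; simp [imp_iff_not_or]
      rw [h2]
      exact (hO'.preimage continuous_chi).measurableSet.compl.union
        ((hWm.measurable.comp (measurable_chiUp ξ n)) (measurableSet_singleton 0))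
    have := (Measure.ae_prod_iff_ae_ae (μ := muJump ξ n) (ν := ν) hms).2 hfib
    filter_upwards [this, ae_chiUp ξ n] with p h1 h2 h3
    exact h1 (by rw [← h2]; exact h3)
  filter_upwards [hae', hns, hWfib, ae_muJump_mem_jumpSet ξ n] with q hq hlim hWq hqj
  have hchi : Continuous fun x => chi q x := continuous_chi.comp (Continuous.prodMk_right q)
  have hWqm : AEStronglyMeasurable (fun x => W (chiUp ξ (q, x))) ν :=
    (hWm.comp_measurable ((measurable_chiUp ξ n).comp measurable_prodMk_left)).aestronglyMeasurable
  have hUqm : AEStronglyMeasurable (fun x => U (chiUp ξ (q, x))) ν :=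
    ((Lp.stronglyMeasurable U).comp_measurable
      ((measurable_chiUp ξ n).comp measurable_prodMk_left)).aestronglyMeasurable
  -- Test functions supported in Ω vanish near the boundary of the cone, and at almost every point
  -- of Ω the function U is zero.
  set Ω := strictCone (n + 1) ∩ (fun x => chi q x) ⁻¹' O' with hΩ
  have hΩo : IsOpen Ω := (isOpen_strictCone _).inter (hO'.preimage hchi)
  have hΩs : Ω ⊆ monoCone (n + 1) := fun x hx => strictCone_subset_monoCone _ hx.1
  -- components of the gradient vanish
  have hcomp : ∀ i, ∀ᵐ x, x ∈ Ω → inner ℝ (piece q i) (W (chiUp ξ (q, x))) = 0 := by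
    intro i
    set w : (Fin (n + 1) → ℝ) → ℝ := fun x => inner ℝ (piece q i) (W (chiUp ξ (q, x))) with hw
    have hwm : AEStronglyMeasurable w ν := aestronglyMeasurable_const.inner hWqm
    have hwL2 : MemLp w 2 ν := by
      have h1 : MemLp (fun x => W (chiUp ξ (q, x))) 2 ν := by
        refine ⟨hWqm, ?_⟩
        rw [lintegral_enorm_sq] at hWq
        exact (ENNReal.pow_lt_top_iff.1 hWq).resolve_right (by norm_num)
      exact h1.const_inner _
    -- Fundamental lemma of the calculus of variations: it remains to show that w integrates to 0
    -- against every test function on Ω.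
    refine hΩo.ae_eq_zero_of_integral_contDiff_smul_eq_zero ?_ fun φ hφ hc hs => ?_
    · have h1 : LocallyIntegrable w ν := hwL2.locallyIntegrable (by norm_num)
      exact (locallyIntegrableOn_of_locallyIntegrable_restrict h1).mono_set hΩs
    have hφcone : ∀ f : (Fin (n + 1) → ℝ) → ℝ, ∫ x, φ x * f x = ∫ x, φ x * f x ∂ν := by
      intro f
      refine (setIntegral_eq_integral_of_forall_compl_eq_zero fun x hx => ?_).symm
      rw [image_eq_zero_of_notMem_tsupport fun hx' => hx (hΩs (hs hx')), zero_mul]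
    set ψ : (Fin (n + 1) → ℝ) → ℝ := fun x => fderiv ℝ φ x (Pi.single i 1) with hψ
    have hφ1 : ContDiff ℝ 1 φ := hφ.of_le (by exact_mod_cast le_top)
    have hψc : Continuous ψ := (hφ1.continuous_fderiv one_ne_zero).clm_apply continuous_const
    have hψs : HasCompactSupport ψ := hc.fderiv_apply ℝ _
    have hψ0 : ∀ x, x ∉ Ω → ψ x = 0 := fun x hx => by
      have : fderiv ℝ φ x = 0 := by
        by_contra hne
        exact hx (hs (support_fderiv_subset ℝ (Function.mem_support.2 hne)))
      rw [hψ]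
      simp [this]
    have hψcone : ∀ f : (Fin (n + 1) → ℝ) → ℝ, ∫ x, ψ x * f x = ∫ x, ψ x * f x ∂ν := by
      intro f
      refine (setIntegral_eq_integral_of_forall_compl_eq_zero fun x hx => ?_).symm
      rw [hψ0 x fun hx' => hx (hΩs hx'), zero_mul]
    have hnice : ∀ k, IsNice (v (ns k)).1 := fun k => isNice_of_mem_FC (v (ns k)).2
    have hvc : ∀ k, Continuous fun x => (v (ns k)).1 (chi q x) := fun k =>
      (hnice k).contDiff.continuous.comp hchi
    have hDDae : ∀ k, (fun x => (inner ℝ (piece q i) (DD (v (ns k)).1 (chi q x)) : ℝ)) =ᵐ[ν]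
        fun x => fderiv ℝ (fun x => (v (ns k)).1 (chi q x)) x (Pi.single i 1) := fun k => by
      filter_upwards [hq] with x hx
      exact (fderiv_comp_chi (hnice k).differentiable hx.1 i).symm
    have hdc : ∀ k, Continuous fun x =>
        fderiv ℝ (fun x => (v (ns k)).1 (chi q x)) x (Pi.single i 1) := fun k => by
      have : ContDiff ℝ 1 fun x => (v (ns k)).1 (chi q x) := by
        simp_rw [← chiL_apply]
        exact (hnice k).contDiff.comp (chiL q).contDiff
      exact (this.continuous_fderiv one_ne_zero).clm_apply continuous_const
    -- Both sides of the integration by parts for v (ns k) converge on this fibre; the limit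
    -- identity says that w is a weak partial derivative of U.
    have hlim1 : Tendsto (fun k => ∫ x, φ x * inner ℝ (piece q i) (DD (v (ns k)).1 (chi q x)) ∂ν)
        atTop (𝓝 (∫ x, φ x * w x ∂ν)) := by
      refine tendsto_integral_mul_of_L2 (hφ.continuous.memLp_of_hasCompactSupport hc) hwm
        (fun k => (hdc k).aestronglyMeasurable.congr (hDDae k).symm) (fun k => ?_) ?_
      · refine Integrable.congr (((hφ.continuous.mul (hdc k)).integrable_of_hasCompactSupport
          hc.mul_right).mono_measure Measure.restrict_le_self) ?_
        filter_upwards [hDDae k] with x hx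
        rw [Pi.mul_apply, hx]
      · refine tendsto_of_tendsto_of_tendsto_of_le_of_le tendsto_const_nhds hlim
          (fun _ => zero_le) fun k => ?_
        refine lintegral_mono_ae ?_
        filter_upwards [hq] with x hx
        rw [hx.2.2.2.2 k]
        refine le_trans ?_ le_add_self
        gcongr
        rw [hw, ← inner_sub_right, enorm_le_iff_norm_le]
        refine (norm_inner_le_norm _ _).trans ?_
        exact mul_le_of_le_one_left (norm_nonneg _) (norm_piece_le q i)
    have hlim2 : Tendsto (fun k => ∫ x, ψ x * (v (ns k)).1 (chi q x) ∂ν)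
        atTop (𝓝 (∫ x, ψ x * U (chiUp ξ (q, x)) ∂ν)) := by
      refine tendsto_integral_mul_of_L2 (hψc.memLp_of_hasCompactSupport hψs) hUqm
        (fun k => (hvc k).aestronglyMeasurable) (fun k => ?_) ?_
      · exact ((hψc.mul (hvc k)).integrable_of_hasCompactSupport
          hψs.mul_right).mono_measure Measure.restrict_le_self
      · refine tendsto_of_tendsto_of_tendsto_of_le_of_le tendsto_const_nhds hlim
          (fun _ => zero_le) fun k => ?_
        refine lintegral_mono_ae ?_
        filter_upwards [hq] with x hx
        rw [hx.2.2.2.2 k]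
        exact le_self_add
    have hzero : ∫ x, ψ x * U (chiUp ξ (q, x)) ∂ν = 0 := by
      refine integral_eq_zero_of_ae ?_
      filter_upwards [hq] with x hx
      by_cases hxΩ : x ∈ Ω
      · rw [hx.2.2.2.1 hxΩ.2, mul_zero, Pi.zero_apply]
      · rw [hψ0 x hxΩ, zero_mul, Pi.zero_apply]
    rw [hzero] at hlim2
    have hparts : ∀ k, ∫ x, φ x * inner ℝ (piece q i) (DD (v (ns k)).1 (chi q x)) ∂ν =
        -∫ x, ψ x * (v (ns k)).1 (chi q x) ∂ν := fun k => by
      rw [← hφcone, ← hψcone]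
      exact integral_mul_inner_DD (hnice k) hqj hφ hc (hs.trans inter_subset_left) i
    simp_rw [smul_eq_mul]
    rw [hφcone]
    refine tendsto_nhds_unique hlim1 ?_
    simp_rw [hparts]
    simpa using hlim2.neg
  filter_upwards [hq, ae_all_iff.2 fun i => ae_restrict_of_ae (hcomp i)] with x hx hx0 hxO
  exact eq_zero_of_pr_eq_self hx.1 hx.2.2.1 fun i => hx0 i ⟨hx.1.2, hxO⟩

/-! ### The closure of the form -/

section Closure

variable {ξ : StieltjesFunction I}

/-- Closability, as the case of locality in which the open set is the whole space. -/
theorem grad_eq_zero {W : Lp L2 2 (Xi ξ)} (h : (0, W) ∈ gradGraph ξ) : W = 0 := by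
  have h1 := grad_eq_zero_on_open h isOpen_univ
    ((Lp.coeFn_zero ℝ 2 (Xi ξ)).mono fun g hg _ => hg)
  rw [Lp.eq_zero_iff_ae_eq_zero]
  exact h1.mono fun g hg => hg (mem_univ g)

/-- The gradient of an element of the domain is unique. -/
theorem grad_unique {U : Lp ℝ 2 (Xi ξ)} {W W' : Lp L2 2 (Xi ξ)} (h : (U, W) ∈ gradGraph ξ)
    (h' : (U, W') ∈ gradGraph ξ) : W = W' := by
  have h1 := (gradGraph ξ).sub_mem h h'
  rw [Prod.mk_sub_mk, sub_self] at h1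
  exact sub_eq_zero.1 (grad_eq_zero h1)

theorem Approx.exists_grad {u : ℕ → L2 → ℝ} {U : Lp ℝ 2 (Xi ξ)} (h : Approx ξ u U) :
    ∃ (v : ℕ → FC ξ) (W : Lp L2 2 (Xi ξ)), (∀ n, u n = v n) ∧ (U, W) ∈ gradGraph ξ ∧
      Tendsto (fun n => gradLp ξ (v n)) atTop (𝓝 W) := by
  obtain ⟨v, hv, h1, h2⟩ := approx_iff.1 h
  obtain ⟨W, hW⟩ := cauchySeq_tendsto_of_complete h2
  exact ⟨v, W, hv, mem_gradGraph_iff.2 ⟨v, h1, hW⟩, hW⟩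

theorem mem_dom_iff {U : Lp ℝ 2 (Xi ξ)} :
    U ∈ (closureForm ξ).dom ↔ ∃ W, (U, W) ∈ gradGraph ξ := by
  constructor
  · rintro ⟨u, hu⟩
    obtain ⟨_, W, _, hW, _⟩ := hu.exists_grad
    exact ⟨W, hW⟩
  · rintro ⟨W, hW⟩
    obtain ⟨v, h1, h2⟩ := mem_gradGraph_iff.1 hW
    exact ⟨fun n => v n, approx_iff.2 ⟨v, fun _ => rfl, h1, h2.cauchySeq⟩⟩

/-- The definition of the form chooses approximating sequences; uniqueness of the gradient makes the
limit independent of the choice. -/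
theorem form_eq {U V : Lp ℝ 2 (Xi ξ)} {W W' : Lp L2 2 (Xi ξ)} (h : (U, W) ∈ gradGraph ξ)
    (h' : (V, W') ∈ gradGraph ξ) : (closureForm ξ).form U V = 1 / 2 * inner ℝ W W' := by
  have hex : (∃ u, Approx ξ u U) ∧ ∃ v, Approx ξ v V := ⟨mem_dom_iff.2 ⟨W, h⟩, mem_dom_iff.2 ⟨W', h'⟩⟩
  have h1 : (closureForm ξ).form U V =
      limUnder atTop fun n => preForm ξ (hex.1.choose n) (hex.2.choose n) := by
    simp only [closureForm]
    rw [dif_pos hex]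
  rw [h1]
  refine Tendsto.limUnder_eq ?_
  obtain ⟨u, A, hu, hA, hulim⟩ := hex.1.choose_spec.exists_grad
  obtain ⟨v, B, hv, hB, hvlim⟩ := hex.2.choose_spec.exists_grad
  rw [grad_unique h hA, grad_unique h' hB]
  simp_rw [hu, hv, preForm_eq]
  exact (hulim.inner hvlim).const_mul _

theorem form_self {U : Lp ℝ 2 (Xi ξ)} {W : Lp L2 2 (Xi ξ)} (h : (U, W) ∈ gradGraph ξ) :
    (closureForm ξ).form U U = 1 / 2 * ‖W‖ ^ 2 := by
  rw [form_eq h h, real_inner_self_eq_norm_sq]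

theorem form₁_self {U : Lp ℝ 2 (Xi ξ)} {W : Lp L2 2 (Xi ξ)} (h : (U, W) ∈ gradGraph ξ) :
    (closureForm ξ).form₁ U U = 1 / 2 * ‖W‖ ^ 2 + ‖U‖ ^ 2 := by
  rw [L2Form.form₁, form_self h, real_inner_self_eq_norm_sq]

theorem form₁_sub {U V : Lp ℝ 2 (Xi ξ)} {W W' : Lp L2 2 (Xi ξ)} (h : (U, W) ∈ gradGraph ξ)
    (h' : (V, W') ∈ gradGraph ξ) :
    (closureForm ξ).form₁ (U - V) (U - V) = 1 / 2 * ‖W - W'‖ ^ 2 + ‖U - V‖ ^ 2 :=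
  form₁_self ((gradGraph ξ).sub_mem h h')

theorem isClosablePreForm : IsClosablePreForm ξ where
  memLp U hU := (isNice_of_mem_FC hU).memLp
  integrable U hU V hV := integrable_inner_DD ⟨U, hU⟩ ⟨V, hV⟩
  closable u hu := by
    obtain ⟨v, W, hv, hW, hlim⟩ := hu.exists_grad
    rw [grad_eq_zero hW] at hlim
    simp_rw [hv, preForm_self]
    have h1 := (hlim.norm.pow 2).const_mul (1 / 2 : ℝ)
    rwa [norm_zero, zero_pow two_ne_zero, mul_zero] at h1

theorem toLp_mem_dom (U : FC ξ) : toLp ξ U ∈ (closureForm ξ).dom :=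
  mem_dom_iff.2 ⟨_, mem_gradGraph U⟩

/-- A Cauchy sequence for the form is a Cauchy sequence in the graph, which is closed in a complete
space. -/
theorem closureForm_closed (u : ℕ → Lp ℝ 2 (Xi ξ)) (hu : ∀ n, u n ∈ (closureForm ξ).dom)
    (hc : ∀ ε > (0 : ℝ), ∃ N, ∀ k ≥ N, ∀ l ≥ N,
      (closureForm ξ).form₁ (u k - u l) (u k - u l) < ε) :
    ∃ U ∈ (closureForm ξ).dom,
      Tendsto (fun n => (closureForm ξ).form₁ (u n - U) (u n - U)) atTop (𝓝 0) := by
  choose w hw using fun n => mem_dom_iff.1 (hu n)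
  have hcauchy : CauchySeq fun n => (u n, w n) := by
    rw [Metric.cauchySeq_iff]
    intro ε hε
    obtain ⟨N, hN⟩ := hc (ε ^ 2 / 2) (by positivity)
    refine ⟨N, fun k hk l hl => ?_⟩
    have h1 := hN k hk l hl
    rw [form₁_sub (hw k) (hw l)] at h1
    rw [Prod.dist_eq, max_lt_iff, dist_eq_norm, dist_eq_norm]
    constructor
    · exact lt_of_pow_lt_pow_left₀ 2 hε.le (by nlinarith [sq_nonneg ‖w k - w l‖])
    · exact lt_of_pow_lt_pow_left₀ 2 hε.le (by nlinarith [sq_nonneg ‖u k - u l‖])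
  obtain ⟨⟨U, W⟩, hlim⟩ := cauchySeq_tendsto_of_complete hcauchy
  have hmem : (U, W) ∈ gradGraph ξ :=
    isClosed_gradGraph.mem_of_tendsto hlim (Eventually.of_forall hw)
  refine ⟨U, mem_dom_iff.2 ⟨W, hmem⟩, ?_⟩
  have h1 : Tendsto u atTop (𝓝 U) := (continuous_fst.tendsto _).comp hlim
  have h2 : Tendsto w atTop (𝓝 W) := (continuous_snd.tendsto _).comp hlim
  simp_rw [fun n => form₁_sub (hw n) hmem]
  have h3 := ((h2.sub_const W).norm.pow 2).const_mul (1 / 2)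
  simpa using h3.add ((h1.sub_const U).norm.pow 2)

/-- An element of `L₂(Ξ)` vanishes almost everywhere outside of its support. -/
theorem ae_eq_zero_of_notMem_supp (U : Lp ℝ 2 (Xi ξ)) :
    ∀ᵐ g ∂Xi ξ, g ∈ (L2Form.supp U)ᶜ → U g = 0 := by
  have h1 : (Xi ξ).withDensity (fun g => ‖U g‖ₑ) (L2Form.supp U)ᶜ = 0 :=
    Measure.measure_compl_support
  have hm : Measurable fun g => ‖U g‖ₑ := (Lp.stronglyMeasurable U).enorm
  rw [withDensity_apply_eq_zero hm, measure_eq_zero_iff_ae_notMem] at h1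
  filter_upwards [h1] with g hg hgs
  by_contra hne
  exact hg ⟨by simpa using hne, hgs⟩

/-- Each gradient vanishes on the open complement of the support of its function. For disjoint
supports these complements cover the space, so the integrand is 0 almost everywhere. -/
theorem closureForm_local : (closureForm ξ).HasLocalProperty := by
  intro U hU V hV _ _ hdisj
  obtain ⟨W, hW⟩ := mem_dom_iff.1 hU
  obtain ⟨W', hW'⟩ := mem_dom_iff.1 hV
  rw [form_eq hW hW', L2.inner_def, integral_eq_zero_of_ae, mul_zero]
  filter_upwards [grad_eq_zero_on_open hW Measure.isClosed_support.isOpen_compl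
      (ae_eq_zero_of_notMem_supp U),
    grad_eq_zero_on_open hW' Measure.isClosed_support.isOpen_compl
      (ae_eq_zero_of_notMem_supp V)] with g h1 h2
  by_cases hg : g ∈ L2Form.supp U
  · rw [h2 fun hg' => hdisj.subset ⟨hg, hg'⟩, inner_zero_right, Pi.zero_apply]
  · rw [h1 hg, inner_zero_left, Pi.zero_apply]

theorem closureForm_isDirichletForm_of (hd : Dense (closureForm ξ).dom)
    (hM : ∀ U ∈ (closureForm ξ).dom, ∃ V ∈ (closureForm ξ).dom,
      (V =ᵐ[Xi ξ] fun x => min (max (U x) 0) 1) ∧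
        (closureForm ξ).form V V ≤ (closureForm ξ).form U U) :
    (closureForm ξ).IsDirichletForm where
  zero_mem := mem_dom_iff.2 ⟨0, (gradGraph ξ).zero_mem⟩
  add_mem U hU V hV := by
    obtain ⟨W, hW⟩ := mem_dom_iff.1 hU
    obtain ⟨W', hW'⟩ := mem_dom_iff.1 hV
    exact mem_dom_iff.2 ⟨W + W', (gradGraph ξ).add_mem hW hW'⟩
  smul_mem c U hU := by
    obtain ⟨W, hW⟩ := mem_dom_iff.1 hU
    exact mem_dom_iff.2 ⟨c • W, (gradGraph ξ).smul_mem c hW⟩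
  dense := hd
  symm U hU V hV := by
    obtain ⟨W, hW⟩ := mem_dom_iff.1 hU
    obtain ⟨W', hW'⟩ := mem_dom_iff.1 hV
    rw [form_eq hW hW', form_eq hW' hW, real_inner_comm]
  add_left U hU V hV Z hZ := by
    obtain ⟨W, hW⟩ := mem_dom_iff.1 hU
    obtain ⟨W', hW'⟩ := mem_dom_iff.1 hV
    obtain ⟨W'', hW''⟩ := mem_dom_iff.1 hZ
    rw [form_eq hW hW'', form_eq hW' hW'', form_eq ((gradGraph ξ).add_mem hW hW') hW'',
      inner_add_left, mul_add]
  smul_left c U hU V hV := by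
    obtain ⟨W, hW⟩ := mem_dom_iff.1 hU
    obtain ⟨W', hW'⟩ := mem_dom_iff.1 hV
    rw [form_eq hW hW', form_eq ((gradGraph ξ).smul_mem c hW) hW', real_inner_smul_left]
    ring
  nonneg U hU := by
    obtain ⟨W, hW⟩ := mem_dom_iff.1 hU
    rw [form_self hW]
    positivity
  closed := closureForm_closed
  markov := hM

end Closure
/-! ### Density of `𝓕𝓒` in `L₂(Ξ)` -/

section Density

instance completeSpace_L2sub (ξ : StieltjesFunction I) : CompleteSpace (L2sub ξ) :=
  (isClosed_L2sub (measurable_stieltjes ξ)).completeSpace_coe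

/-- On L₂(ξ) every h in L₂ may be replaced by its projection. Cylinder functions with directions in
L₂(ξ) thus see all characters ⟨·, h⟩. -/
theorem inner_starProjection_L2sub {ξ : StieltjesFunction I} {g : L2} (hg : g ∈ L2sub ξ) (h : L2) :
    (inner ℝ g ((L2sub ξ).starProjection h) : ℝ) = inner ℝ g h := by
  rw [← Submodule.inner_starProjection_left_eq_right, Submodule.starProjection_eq_self_iff.2 hg]

theorem starProjection_L2sub_mem (ξ : StieltjesFunction I) (h : L2) :
    (L2sub ξ).starProjection h ∈ L2sub ξ := Submodule.starProjection_apply_mem _ _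

/-- A smooth cutoff function. -/
def cutoff (R : ℕ) : ContDiffBump (0 : ℝ) := ⟨(R : ℝ) ^ 2 + 1, (R : ℝ) ^ 2 + 2, by positivity, by linarith⟩

theorem cutoff_eq_one {R : ℕ} {g : L2} (hg : ‖g‖ ≤ R) : cutoff R (‖g‖ ^ 2) = 1 := by
  refine (cutoff R).one_of_mem_closedBall ?_
  rw [mem_closedBall_zero_iff, Real.norm_of_nonneg (sq_nonneg _)]
  have := pow_le_pow_left₀ (norm_nonneg g) hg 2
  exact this.trans (le_add_of_nonneg_right zero_le_one)

variable {ξ : StieltjesFunction I}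

theorem cyl_mul_cutoff_mem_FC {k : L2 → ℝ} (hk : IsCyl ξ k) (R : ℕ) :
    (fun g => k g * cutoff R (‖g‖ ^ 2)) ∈ FC ξ :=
  hk.mul_mem_FC (cutoff R).contDiff (cutoff R).hasCompactSupport

theorem cutoff_mem_FC (ξ : StieltjesFunction I) (R : ℕ) :
    (fun g : L2 => cutoff R (‖g‖ ^ 2)) ∈ FC ξ := by
  simpa using cyl_mul_cutoff_mem_FC (IsCyl.one (ξ := ξ)) R

theorem measurableEmbedding_coe (ξ : StieltjesFunction I) :
    MeasurableEmbedding (Subtype.val : L2upOf ξ → L2) :=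
  MeasurableEmbedding.subtype_coe (isClosed_L2upOf ξ).measurableSet

open Complex in
/-- An integrable function whose Fourier transform vanishes is zero. -/
theorem ae_eq_zero_of_fourier {k : L2upOf ξ → ℝ} (hk : Integrable k (Xi ξ))
    (hc : ∀ h : L2, ∫ g, k g * Real.cos (inner ℝ (g : L2) h) ∂Xi ξ = 0)
    (hs : ∀ h : L2, ∫ g, k g * Real.sin (inner ℝ (g : L2) h) ∂Xi ξ = 0) : k =ᵐ[Xi ξ] 0 := by
  set m₁ := (Xi ξ).withDensity fun g => ENNReal.ofReal (k g) with hm₁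
  set m₂ := (Xi ξ).withDensity fun g => ENNReal.ofReal (-k g) with hm₂
  have hf1 : IsFiniteMeasure m₁ := isFiniteMeasure_withDensity_ofReal hk.2
  have hf2 : IsFiniteMeasure m₂ := isFiniteMeasure_withDensity_ofReal hk.neg.2
  have ha1 : AEMeasurable (fun g => ENNReal.ofReal (k g)) (Xi ξ) := hk.1.aemeasurable.ennreal_ofReal
  have ha2 : AEMeasurable (fun g => ENNReal.ofReal (-k g)) (Xi ξ) :=
    hk.1.aemeasurable.neg.ennreal_ofReal
  -- The two finite measures are the positive and negative parts of k · Ξ; the hypotheses say that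
  -- their images in L₂ have the same characteristic function.
  have hmap : m₁.map Subtype.val = m₂.map Subtype.val := by
    refine Measure.ext_of_charFun (funext fun h => ?_)
    have hce : Continuous fun g : L2 => cexp ((inner ℝ g h : ℝ) * Complex.I) := by fun_prop
    rw [charFun_apply, charFun_apply,
      integral_map measurable_subtype_coe.aemeasurable hce.aestronglyMeasurable,
      integral_map measurable_subtype_coe.aemeasurable hce.aestronglyMeasurable,
      hm₁, hm₂, integral_withDensity_eq_integral_toReal_smul₀ ha1
        (Eventually.of_forall fun _ => ENNReal.ofReal_lt_top),
      integral_withDensity_eq_integral_toReal_smul₀ ha2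
        (Eventually.of_forall fun _ => ENNReal.ofReal_lt_top), ← sub_eq_zero]
    have hb : ∀ g : L2upOf ξ, ‖cexp ((inner ℝ (g : L2) h : ℝ) * Complex.I)‖ ≤ 1 := fun g =>
      (norm_exp_ofReal_mul_I _).le
    have hce' : AEStronglyMeasurable
        (fun g : L2upOf ξ => cexp ((inner ℝ (g : L2) h : ℝ) * Complex.I)) (Xi ξ) :=
      (hce.comp continuous_subtype_val).aestronglyMeasurable
    have hint : ∀ l : L2upOf ξ → ℝ, Integrable l (Xi ξ) →
        Integrable (fun g => l g • cexp ((inner ℝ (g : L2) h : ℝ) * Complex.I)) (Xi ξ) :=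
      fun l hl => hl.smul_of_top_left
        (memLp_top_of_bound hce' 1 (Eventually.of_forall hb))
    rw [← integral_sub]
    rotate_left
    · refine hint _ ?_
      exact hk.real_toNNReal
    · refine hint _ ?_
      exact hk.neg.real_toNNReal
    have hcos : Integrable (fun g : L2upOf ξ => k g * Real.cos (inner ℝ (g : L2) h)) (Xi ξ) :=
      hk.mul_of_top_left (memLp_top_of_bound (by
        refine Continuous.aestronglyMeasurable ?_
        fun_prop) 1 (Eventually.of_forall fun g => Real.abs_cos_le_one _))
    have hsin : Integrable (fun g : L2upOf ξ => k g * Real.sin (inner ℝ (g : L2) h)) (Xi ξ) :=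
      hk.mul_of_top_left (memLp_top_of_bound (by
        refine Continuous.aestronglyMeasurable ?_
        fun_prop) 1 (Eventually.of_forall fun g => Real.abs_sin_le_one _))
    calc _ = ∫ g : L2upOf ξ, (((k g * Real.cos (inner ℝ (g : L2) h) : ℝ) : ℂ) +
          ((k g * Real.sin (inner ℝ (g : L2) h) : ℝ) : ℂ) * Complex.I) ∂Xi ξ := by
            refine integral_congr_ae (Eventually.of_forall fun g => ?_)
            dsimp only
            rw [← sub_smul, ENNReal.toReal_ofReal', ENNReal.toReal_ofReal',
              max_zero_sub_max_neg_zero_eq_self, real_smul, exp_mul_I, ofReal_mul, ofReal_mul,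
              ofReal_cos, ofReal_sin]
            ring
      _ = 0 := by
            rw [integral_add hcos.ofReal (hsin.ofReal.mul_const _), integral_mul_const,
              integral_complex_ofReal, integral_complex_ofReal, hc, hs]
            simp
  have heq : m₁ = m₂ := by
    have h1 := congrArg (Measure.comap (Subtype.val : L2upOf ξ → L2)) hmap
    rwa [(measurableEmbedding_coe ξ).comap_map, (measurableEmbedding_coe ξ).comap_map] at h1
  have hfin : ∫⁻ g, ENNReal.ofReal (k g) ∂Xi ξ ≠ ⊤ := hk.lintegral_lt_top.ne
  rw [hm₁, hm₂, withDensity_eq_iff ha1 ha2 hfin] at heq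
  filter_upwards [heq] with g hg
  rcases le_total (k g) 0 with h | h
  · rw [ENNReal.ofReal_of_nonpos h, eq_comm, ENNReal.ofReal_eq_zero] at hg
    exact le_antisymm h (by simpa using hg)
  · rw [ENNReal.ofReal_of_nonpos (p := -k g) (by linarith), ENNReal.ofReal_eq_zero] at hg
    exact le_antisymm hg h

theorem inner_toLp (U : FC ξ) (f : Lp ℝ 2 (Xi ξ)) :
    inner ℝ (toLp ξ U) f = ∫ g : L2upOf ξ, f g * U.1 g ∂Xi ξ := by
  rw [L2.inner_def]
  refine integral_congr_ae ?_
  filter_upwards [toLp_coeFn U] with g hg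
  rw [hg]
  simp

/-- `𝓕𝓒` is dense in `L₂(Ξ)`. -/
theorem dense_range_toLp : Dense (LinearMap.range (toLp ξ) : Set (Lp ℝ 2 (Xi ξ))) := by
  rw [Submodule.dense_iff_topologicalClosure_eq_top, Submodule.topologicalClosure_eq_top_iff,
    Submodule.eq_bot_iff]
  intro f hf
  have hf' : ∀ U : FC ξ, ∫ g : L2upOf ξ, f g * U.1 g ∂Xi ξ = 0 := fun U => by
    rw [← inner_toLp]
    exact (Submodule.mem_orthogonal _ _).1 hf _ ⟨U, rfl⟩
  -- The cutoff makes the product with f integrable, and cosine and sine of ⟨g, h⟩ times the cutoff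
  -- belong to 𝓕𝓒. Orthogonality of f to 𝓕𝓒 therefore annihilates the Fourier transform of the
  -- product.
  have hR : ∀ R : ℕ, (fun g : L2upOf ξ => f g * cutoff R (‖(g : L2)‖ ^ 2)) =ᵐ[Xi ξ] 0 := by
    intro R
    have hcyl : ∀ (c : ℝ → ℝ), ContDiff ℝ ∞ c → ∀ h : L2,
        ∫ g : L2upOf ξ, f g * cutoff R (‖(g : L2)‖ ^ 2) * c (inner ℝ (g : L2) h) ∂Xi ξ = 0 := by
      intro c hc h
      have h1 := hf' ⟨_, cyl_mul_cutoff_mem_FC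
        ((IsCyl.inner (starProjection_L2sub_mem ξ h)).comp hc) R⟩
      refine Eq.trans (integral_congr_ae (Eventually.of_forall fun g => ?_)) h1
      dsimp only
      rw [inner_starProjection_L2sub g.2.2]
      ring
    exact ae_eq_zero_of_fourier ((Lp.memLp f).integrable_mul
      (isNice_of_mem_FC (cutoff_mem_FC ξ R)).memLp) (hcyl _ Real.contDiff_cos) (hcyl _ Real.contDiff_sin)
  rw [Lp.eq_zero_iff_ae_eq_zero]
  filter_upwards [ae_all_iff.2 hR] with g hg
  obtain ⟨R, hR⟩ := exists_nat_ge ‖(g : L2)‖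
  have h1 := hg R
  rwa [cutoff_eq_one hR, mul_one] at h1

theorem dense_dom : Dense (closureForm ξ).dom :=
  dense_range_toLp.mono (by rintro _ ⟨U, rfl⟩; exact toLp_mem_dom U)

end Density
/-! ### The unit contraction -/

section Markov

/-- Integrating a polynomial close to a derivative gives an approximation of a function together
with its derivative. -/
theorem exists_antiderivative (Q : Polynomial ℝ) :
    ∃ P : Polynomial ℝ, P.derivative = Q ∧ P.coeff 0 = 0 := by
  induction Q using Polynomial.induction_on' with
  | add p q hp hq =>
    obtain ⟨P, hP, hP0⟩ := hp
    obtain ⟨P', hP', hP0'⟩ := hq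
    exact ⟨P + P', by rw [Polynomial.derivative_add, hP, hP'], by simp [hP0, hP0']⟩
  | monomial n a =>
    refine ⟨Polynomial.monomial (n + 1) (a / (n + 1)), ?_, by simp [Polynomial.coeff_monomial]⟩
    rw [Polynomial.derivative_monomial]
    have : (n : ℝ) + 1 ≠ 0 := by positivity
    simp [div_mul_cancel₀ _ this]

/-- The unit contraction of the real line. -/
def unitClip (x : ℝ) : ℝ := min (max x 0) 1

theorem lipschitzWith_unitClip : LipschitzWith 1 unitClip :=
  (LipschitzWith.id.max_const 0).min_const 1

theorem unitClip_zero : unitClip 0 = 0 := by simp [unitClip]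

/-- A smooth approximation of the positive part. -/
def softPos (δ x : ℝ) : ℝ := (x + √(x ^ 2 + δ ^ 2)) / 2

theorem abs_softPos_sub_le {δ : ℝ} (hδ : 0 < δ) (x : ℝ) : |softPos δ x - max x 0| ≤ δ := by
  have h1 : |x| ≤ √(x ^ 2 + δ ^ 2) := Real.abs_le_sqrt (by nlinarith)
  have h2 : √(x ^ 2 + δ ^ 2) ≤ |x| + δ := by
    rw [Real.sqrt_le_left (by positivity)]
    nlinarith [sq_abs x, abs_nonneg x, mul_nonneg (abs_nonneg x) hδ.le]
  rw [softPos, abs_le]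
  rcases le_total x 0 with h | h
  · rw [max_eq_right h]
    rw [abs_of_nonpos h] at h1 h2
    constructor <;> linarith
  · rw [max_eq_left h]
    rw [abs_of_nonneg h] at h1 h2
    constructor <;> linarith

theorem hasDerivAt_softPos {δ : ℝ} (hδ : 0 < δ) (x : ℝ) :
    HasDerivAt (softPos δ) ((1 + x / √(x ^ 2 + δ ^ 2)) / 2) x := by
  have h1 : x ^ 2 + δ ^ 2 ≠ 0 := by positivity
  have h2 : HasDerivAt (fun x : ℝ => x ^ 2 + δ ^ 2) (2 * x) x := by
    simpa using (hasDerivAt_pow 2 x).add_const (δ ^ 2)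
  have h3 := ((hasDerivAt_id x).add (h2.sqrt h1)).div_const 2
  refine h3.congr_deriv ?_
  rw [mul_div_mul_left _ _ two_ne_zero]

theorem softPos_deriv_mem (δ x : ℝ) :
    0 ≤ (1 + x / √(x ^ 2 + δ ^ 2)) / 2 ∧ (1 + x / √(x ^ 2 + δ ^ 2)) / 2 ≤ 1 := by
  have h1 : |x| ≤ √(x ^ 2 + δ ^ 2) := Real.abs_le_sqrt (by nlinarith [sq_nonneg δ])
  have h2 : |x / √(x ^ 2 + δ ^ 2)| ≤ 1 := by
    rw [abs_div, abs_of_nonneg (Real.sqrt_nonneg _)]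
    exact div_le_one_of_le₀ h1 (Real.sqrt_nonneg _)
  rw [abs_le] at h2
  constructor <;> linarith

/-- Approximation of the unit contraction by polynomials. -/
theorem exists_polynomial_unitClip (B : ℝ) {ε : ℝ} (hε : 0 < ε) :
    ∃ P : Polynomial ℝ, P.coeff 0 = 0 ∧ ∀ x, |x| ≤ B →
      |P.eval x - unitClip x| ≤ ε ∧ |P.derivative.eval x| ≤ 1 + ε := by
  rcases lt_or_ge B 0 with hB | hB
  · exact ⟨0, by simp, fun x hx => absurd ((abs_nonneg x).trans hx) (not_le.2 hB)⟩
  set δ := ε / 8 with hδd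
  have hδ : 0 < δ := by positivity
  let D : ℝ → ℝ := fun x => (1 + x / √(x ^ 2 + δ ^ 2)) / 2
  -- The contraction is 1 − (1 − x⁺)⁺; both positive parts are replaced by `softPos`, whose
  -- derivative stays in [0, 1].
  let τ : ℝ → ℝ := fun x => 1 - softPos δ (1 - softPos δ x)
  let τ' : ℝ → ℝ := fun x => D (1 - softPos δ x) * D x
  have hDc : Continuous D := by
    refine Continuous.div_const (continuous_const.add (continuous_id.div (by fun_prop) fun x => ?_)) 2
    exact (Real.sqrt_pos.2 (by positivity)).ne'
  have hsc : Continuous (softPos δ) := by unfold softPos; fun_prop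
  have hτ'c : Continuous τ' := (hDc.comp (continuous_const.sub hsc)).mul hDc
  have hτd : ∀ x, HasDerivAt τ (τ' x) x := by
    intro x
    have h1 := (hasDerivAt_softPos hδ (1 - softPos δ x)).comp x
      ((hasDerivAt_softPos hδ x).const_sub 1)
    refine (h1.const_sub 1).congr_deriv ?_
    simp only [τ', D]
    ring
  have hτ'b : ∀ x, |τ' x| ≤ 1 := by
    intro x
    have h1 := softPos_deriv_mem δ x
    have h2 := softPos_deriv_mem δ (1 - softPos δ x)
    rw [abs_of_nonneg (mul_nonneg h2.1 h1.1)]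
    exact mul_le_one₀ h2.2 h1.1 h1.2
  have hτT : ∀ x, |τ x - unitClip x| ≤ 2 * δ := by
    intro x
    have h1 := abs_softPos_sub_le hδ x
    have h2 := abs_softPos_sub_le hδ (1 - softPos δ x)
    have h3 : unitClip x = 1 - max (1 - max x 0) 0 := by
      rw [unitClip]
      rcases le_total (max x 0) 1 with h | h
      · rw [min_eq_left h, max_eq_left (a := 1 - max x 0) (by linarith)]; ring
      · rw [min_eq_right h, max_eq_right (a := 1 - max x 0) (by linarith)]; ring
    have h4 : |max (1 - softPos δ x) 0 - max (1 - max x 0) 0| ≤ |softPos δ x - max x 0| := by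
      refine (abs_max_sub_max_le_abs _ _ _).trans (le_of_eq ?_)
      rw [abs_sub_comm]
      congr 1
      ring
    have h5 : τ x - unitClip x = -(softPos δ (1 - softPos δ x) - max (1 - softPos δ x) 0) -
        (max (1 - softPos δ x) 0 - max (1 - max x 0) 0) := by
      rw [h3]; simp only [τ]; ring
    rw [h5]
    refine (abs_sub _ _).trans ?_
    rw [abs_neg]
    linarith
  -- Error budget: at most ε/4 from integrating η over [0, x], and 2δ = ε/4 each from comparing τ
  -- with the contraction at x and at 0. The bound η ≤ ε serves the derivative.
  set η := min ε (ε / (4 * (B + 1))) with hη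
  have hη0 : 0 < η := lt_min hε (by positivity)
  obtain ⟨Q, hQ⟩ := exists_polynomial_near_of_continuousOn (-B) B τ' hτ'c.continuousOn η hη0
  obtain ⟨P, hP, hP0⟩ := exists_antiderivative Q
  refine ⟨P, hP0, fun x hx => ⟨?_, ?_⟩⟩
  · have hder : ∀ y ∈ Icc (-B) B, HasDerivWithinAt (fun y => P.eval y - τ y)
        (Q.eval y - τ' y) (Icc (-B) B) y := by
      intro y _
      have := (P.hasDerivAt y).sub (hτd y)
      rw [hP] at this
      exact this.hasDerivWithinAt
    have h1 := (convex_Icc (-B) B).norm_image_sub_le_of_norm_hasDerivWithin_le hder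
      (fun y hy => (hQ y hy).le) (x := 0) (y := x) ⟨by linarith, hB⟩ (abs_le.1 hx)
    have h2 : P.eval 0 = 0 := by rw [← Polynomial.coeff_zero_eq_eval_zero, hP0]
    rw [h2, sub_zero, Real.norm_eq_abs, Real.norm_eq_abs] at h1
    have h3 : η * |x| ≤ ε / 4 := by
      calc η * |x| ≤ ε / (4 * (B + 1)) * B :=
            mul_le_mul (min_le_right _ _) hx (abs_nonneg _) (by positivity)
        _ ≤ ε / 4 := by
            rw [div_mul_eq_mul_div, div_le_div_iff₀ (by positivity) (by positivity)]
            nlinarith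
    have h4 := hτT x
    have h5 := hτT 0
    rw [unitClip_zero, sub_zero] at h5
    have h6 : P.eval x - unitClip x =
        (P.eval x - τ x - (0 - τ 0)) + (τ x - unitClip x) - τ 0 := by ring
    rw [h6]
    have h7 := abs_sub (P.eval x - τ x - (0 - τ 0) + (τ x - unitClip x)) (τ 0)
    have h8 := abs_add_le (P.eval x - τ x - (0 - τ 0)) (τ x - unitClip x)
    linarith
  · rw [hP]
    have h1 := (hQ x (abs_le.1 hx)).le.trans (min_le_left _ _)
    have h2 := abs_add_le (Q.eval x - τ' x) (τ' x)
    rw [sub_add_cancel] at h2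
    linarith [hτ'b x]

variable {ξ : StieltjesFunction I}

/-- Elements of 𝓕𝓒 vanish outside of a ball, so no nonzero constant is available and the constant
term has to be 0. -/
theorem polynomial_comp_mem_FC {u : L2 → ℝ} (hu : u ∈ FC ξ) {P : Polynomial ℝ}
    (hP : P.coeff 0 = 0) : (fun g => P.eval (u g)) ∈ FC ξ := by
  obtain ⟨P, rfl⟩ := Polynomial.X_dvd_iff.2 hP
  clear hP
  simp only [Polynomial.eval_mul, Polynomial.eval_X]
  induction P using Polynomial.induction_on' with
  | add p q hp hq =>
    simp only [Polynomial.eval_add, mul_add]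
    exact (FC ξ).add_mem hp hq
  | monomial n a =>
    simp only [Polynomial.eval_monomial]
    induction n with
    | zero =>
      have := (FC ξ).smul_mem a hu
      convert this using 1
      funext g
      simp [mul_comm]
    | succ n ih =>
      convert mul_mem_FC ih hu using 1
      funext g
      simp only [Pi.mul_apply]
      ring

theorem DD_polynomial_comp {u : L2 → ℝ} {g : L2} (hu : DifferentiableAt ℝ u g) (P : Polynomial ℝ) :
    DD (fun g => P.eval (u g)) g = P.derivative.eval (u g) • DD u g := by
  have h1 : HasFDerivAt (fun g => P.eval (u g)) (P.derivative.eval (u g) • fderiv ℝ u g) g :=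
    (P.hasDerivAt (u g)).comp_hasFDerivAt g hu.hasFDerivAt
  rw [DD, DD, gradient, gradient, h1.fderiv, map_smulₛₗ, ← pr_smul]
  simp

theorem norm_le_norm_cutoff {f : Lp ℝ 2 (Xi ξ)} {c : ℝ} {R : ℕ}
    (h : ∀ᵐ g : L2upOf ξ ∂Xi ξ, |f g| ≤ c)
    (h0 : ∀ᵐ g : L2upOf ξ ∂Xi ξ, R < ‖(g : L2)‖ → f g = 0) :
    ‖f‖ ≤ c * ‖toLp ξ ⟨_, cutoff_mem_FC ξ R⟩‖ := by
  refine Lp.norm_le_mul_norm_of_ae_le_mul ?_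
  filter_upwards [h, h0, toLp_coeFn ⟨_, cutoff_mem_FC ξ R⟩] with g h1 h2 h3
  rw [h3]
  by_cases hg : ‖(g : L2)‖ ≤ R
  · simpa [cutoff_eq_one hg] using h1
  · rw [h2 (not_le.1 hg), norm_zero]
    exact mul_nonneg ((abs_nonneg _).trans h1) (norm_nonneg _)

/-- Compositions of functions in `𝓕𝓒` with the unit contraction are approximated by functions in
`𝓕𝓒`. -/
theorem exists_approx_unitClip (u : FC ξ) {ε : ℝ} (hε : 0 < ε) :
    ∃ u' : FC ξ, ‖toLp ξ u' - lipschitzWith_unitClip.compLp unitClip_zero (toLp ξ u)‖ ≤ ε ∧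
      ‖gradLp ξ u'‖ ≤ ‖gradLp ξ u‖ + ε := by
  have hn := isNice_of_mem_FC u.2
  obtain ⟨B, hB⟩ := hn.bound
  obtain ⟨R, hR⟩ := hn.support
  obtain ⟨R', hRR⟩ := exists_nat_ge R
  -- The relative precision ε/c is multiplied by the norm of the cutoff in one estimate and by that
  -- of the gradient in the other; c dominates both.
  set c := ‖toLp ξ ⟨_, cutoff_mem_FC ξ R'⟩‖ + ‖gradLp ξ u‖ + 1 with hc
  have hc0 : 0 < c := by positivity
  obtain ⟨P, hP0, hP⟩ := exists_polynomial_unitClip B (div_pos hε hc0)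
  refine ⟨⟨_, polynomial_comp_mem_FC u.2 hP0⟩, ?_, ?_⟩
  · have hae := Lp.coeFn_sub (toLp ξ ⟨_, polynomial_comp_mem_FC u.2 hP0⟩)
      (lipschitzWith_unitClip.compLp unitClip_zero (toLp ξ u))
    have hval : ∀ᵐ g : L2upOf ξ ∂Xi ξ, (toLp ξ ⟨_, polynomial_comp_mem_FC u.2 hP0⟩ -
        lipschitzWith_unitClip.compLp unitClip_zero (toLp ξ u) : Lp ℝ 2 (Xi ξ)) g =
        P.eval (u.1 g) - unitClip (u.1 g) := by
      filter_upwards [hae, toLp_coeFn ⟨_, polynomial_comp_mem_FC u.2 hP0⟩,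
        lipschitzWith_unitClip.coeFn_compLp unitClip_zero (toLp ξ u), toLp_coeFn u]
        with g h1 h2 h3 h4
      rw [h1, Pi.sub_apply, h2, h3, Function.comp_apply, h4]
    refine (norm_le_norm_cutoff (c := ε / c) (R := R') ?_ ?_).trans ?_
    · filter_upwards [hval] with g hg
      rw [hg]
      exact (hP _ (hB g).1).1
    · filter_upwards [hval] with g hg hgR
      rw [hg, hR _ (hRR.trans_lt hgR), unitClip_zero, ← Polynomial.coeff_zero_eq_eval_zero, hP0,
        sub_zero]
    · rw [div_mul_eq_mul_div, div_le_iff₀ hc0]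
      refine mul_le_mul_of_nonneg_left ?_ hε.le
      linarith [norm_nonneg (gradLp ξ u)]
  · have h1 : ‖gradLp ξ ⟨_, polynomial_comp_mem_FC u.2 hP0⟩‖ ≤ (1 + ε / c) * ‖gradLp ξ u‖ := by
      refine Lp.norm_le_mul_norm_of_ae_le_mul ?_
      filter_upwards [gradLp_coeFn u, gradLp_coeFn ⟨_, polynomial_comp_mem_FC u.2 hP0⟩]
        with g h1 h2
      rw [h1, h2, DD_polynomial_comp (hn.differentiable _), norm_smul]
      exact mul_le_mul_of_nonneg_right (hP _ (hB g).1).2 (norm_nonneg _)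
    refine h1.trans ?_
    have h2 : ε / c * ‖gradLp ξ u‖ ≤ ε := by
      rw [div_mul_eq_mul_div, div_le_iff₀ hc0]
      refine mul_le_mul_of_nonneg_left ?_ hε.le
      linarith [norm_nonneg (toLp ξ ⟨_, cutoff_mem_FC ξ R'⟩)]
    linarith

/-- If second components that are bounded by `C + ε` can be found for all `ε`, then the gradient is
bounded by `C`. -/
theorem exists_grad_of_approx {a : Lp ℝ 2 (Xi ξ)} {C : ℝ}
    (h : ∀ ε > (0 : ℝ), ∃ p ∈ gradGraph ξ, ‖p.1 - a‖ ≤ ε ∧ ‖p.2‖ ≤ C + ε) :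
    ∃ b, (a, b) ∈ gradGraph ξ ∧ ‖b‖ ≤ C := by
  -- For fixed δ the gradients stay bounded by C + δ while the first components converge to a.
  -- Uniqueness of the gradient then makes b independent of δ.
  have h1 : ∀ δ > (0 : ℝ), ∃ b, (a, b) ∈ gradGraph ξ ∧ ‖b‖ ≤ C + δ := fun δ hδ =>
    exists_mem_of_bounded_snd (𝒜 := (gradGraph ξ : Set (Lp ℝ 2 (Xi ξ) × Lp L2 2 (Xi ξ)))) (gradGraph ξ).convex isClosed_gradGraph
      fun ε hε => by
        obtain ⟨p, hp, hp1, hp2⟩ := h (min ε δ) (lt_min hε hδ)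
        exact ⟨p, hp, hp1.trans (min_le_left _ _), by linarith [min_le_right ε δ]⟩
  obtain ⟨b, hb, _⟩ := h1 1 one_pos
  refine ⟨b, hb, le_of_forall_pos_le_add fun δ hδ => ?_⟩
  obtain ⟨b', hb', hle⟩ := h1 δ hδ
  rwa [grad_unique hb hb']

/-- The contraction is 1-Lipschitz, so it preserves convergence in L₂(Ξ), and its polynomial
approximations increase gradient norms by arbitrarily little. Hence the limit has a gradient of norm
at most ‖W‖. -/
theorem closureForm_markov (U : Lp ℝ 2 (Xi ξ)) (hU : U ∈ (closureForm ξ).dom) :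
    ∃ V ∈ (closureForm ξ).dom, (V =ᵐ[Xi ξ] fun x => min (max (U x) 0) 1) ∧
      (closureForm ξ).form V V ≤ (closureForm ξ).form U U := by
  obtain ⟨W, hW⟩ := mem_dom_iff.1 hU
  obtain ⟨v, hv1, hv2⟩ := mem_gradGraph_iff.1 hW
  obtain ⟨b, hb, hbW⟩ := exists_grad_of_approx
    (a := lipschitzWith_unitClip.compLp unitClip_zero U) (C := ‖W‖) fun ε hε => by
      have h1 : ∀ᶠ n in atTop, ‖toLp ξ (v n) - U‖ < ε / 2 := by
        simpa [dist_eq_norm] using Metric.tendsto_nhds.1 hv1 (ε / 2) (by positivity)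
      have h2 : ∀ᶠ n in atTop, ‖gradLp ξ (v n)‖ < ‖W‖ + ε / 2 :=
        (tendsto_order.1 hv2.norm).2 _ (by linarith)
      obtain ⟨n, hn1, hn2⟩ := (h1.and h2).exists
      obtain ⟨u, hu1, hu2⟩ := exists_approx_unitClip (v n) (half_pos hε)
      refine ⟨_, mem_gradGraph u, ?_, hu2.trans (by linarith)⟩
      have h3 := lipschitzWith_unitClip.norm_compLp_sub_le unitClip_zero (toLp ξ (v n)) U
      rw [NNReal.coe_one, one_mul] at h3
      have h4 := norm_sub_le_norm_sub_add_norm_sub (toLp ξ u)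
        (lipschitzWith_unitClip.compLp unitClip_zero (toLp ξ (v n)))
        (lipschitzWith_unitClip.compLp unitClip_zero U)
      dsimp only
      linarith
  refine ⟨_, mem_dom_iff.2 ⟨b, hb⟩, lipschitzWith_unitClip.coeFn_compLp unitClip_zero U, ?_⟩
  rw [form_self hb, form_self hW]
  gcongr

theorem closureForm_isDirichletForm : (closureForm ξ).IsDirichletForm :=
  closureForm_isDirichletForm_of dense_dom closureForm_markov

end Markov
/-! ### A potential that controls the norm of `L_{5/2}` -/

section Potential

/-- A convex function of growth `|x| ^ (5 / 2)`. -/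
def growth (x : ℝ) : ℝ := (1 + x ^ 2) ^ (5 / 4 : ℝ)

/-- The derivative of `growth`. -/
def growthDeriv (x : ℝ) : ℝ := 2 * x * (5 / 4) * (1 + x ^ 2) ^ (1 / 4 : ℝ)

theorem contDiff_growth : ContDiff ℝ ∞ growth := by
  unfold growth
  refine ContDiff.rpow_const_of_ne (by fun_prop) fun x => ?_
  positivity

theorem hasDerivAt_growth (x : ℝ) : HasDerivAt growth (growthDeriv x) x := by
  have h1 : HasDerivAt (fun x : ℝ => 1 + x ^ 2) (2 * x) x := by
    simpa using (hasDerivAt_pow 2 x).const_add 1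
  refine (h1.rpow_const (p := 5 / 4) (Or.inr (by norm_num))).congr_deriv ?_
  rw [growthDeriv]
  norm_num

theorem growth_nonneg (x : ℝ) : 0 ≤ growth x := by unfold growth; positivity

theorem growth_le {x B : ℝ} (h : |x| ≤ B) : growth x ≤ growth B := by
  unfold growth
  have := sq_le_sq' (abs_le.1 h).1 (abs_le.1 h).2
  gcongr

/-- The growth exponent 5/2 is tuned to this: the squared derivative grows like |x|³, the power that
was shown to be integrable over balls. -/
theorem growthDeriv_sq_le (x : ℝ) : growthDeriv x ^ 2 ≤ 13 * (1 + |x| ^ 3) := by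
  have h1 : ((1 + x ^ 2) ^ (1 / 4 : ℝ)) ^ 2 ≤ 1 + |x| := by
    rw [← Real.rpow_natCast, ← Real.rpow_mul (by positivity)]
    have : (1 / 4 : ℝ) * (2 : ℕ) = 1 / 2 := by norm_num
    rw [this, ← Real.sqrt_eq_rpow, Real.sqrt_le_left (by positivity)]
    nlinarith [sq_abs x, abs_nonneg x]
  rw [growthDeriv, mul_pow]
  have h2 : (2 * x * (5 / 4)) ^ 2 = 25 / 4 * |x| ^ 2 := by rw [sq_abs]; ring
  rw [h2]
  calc 25 / 4 * |x| ^ 2 * ((1 + x ^ 2) ^ (1 / 4 : ℝ)) ^ 2 ≤ 25 / 4 * |x| ^ 2 * (1 + |x|) := by gcongr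
    _ ≤ 13 * (1 + |x| ^ 3) := by
        have ha := abs_nonneg x
        nlinarith [mul_nonneg ha (sq_nonneg (|x| - 1)), sq_nonneg (|x| - 1), pow_nonneg ha 3]

theorem enorm_rpow_le_growth (x : ℝ) : ‖x‖ₑ ^ (5 / 2 : ℝ) ≤ ENNReal.ofReal (growth x) := by
  rw [Real.enorm_eq_ofReal_abs, ENNReal.ofReal_rpow_of_nonneg (abs_nonneg _) (by norm_num)]
  refine ENNReal.ofReal_le_ofReal ?_
  have : |x| ^ (5 / 2 : ℝ) = (x ^ 2) ^ (5 / 4 : ℝ) := by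
    rw [← sq_abs, ← Real.rpow_natCast, ← Real.rpow_mul (abs_nonneg _)]
    norm_num
  rw [this, growth]
  gcongr
  linarith

/-- The integral of `growth`. -/
def potential (g : L2) : ℝ≥0∞ := ∫⁻ s, ENNReal.ofReal (growth (g s))

theorem measurable_potential : Measurable potential :=
  measurable_lintegral_comp (ENNReal.continuous_ofReal.comp contDiff_growth.continuous)

variable (ξ : StieltjesFunction I) {n : ℕ}

/-- The projection to `L₂(ξ)` of the indicator of a piece. -/
def projPiece (q : Fin n → I) (i : Fin (n + 1)) : L2 := (L2sub ξ).starProjection (piece q i)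

/-- The average over a piece. -/
def average (q : Fin n → I) (g : L2) (i : Fin (n + 1)) : ℝ := inner ℝ (piece q i) g / len q i

/-- The discretised potential. -/
def pot (q : Fin n → I) (g : L2) : ℝ :=
  ∑ i, len q i * growth (inner ℝ g (projPiece ξ q i) / len q i)

variable {ξ}

/-- The indicators of the pieces need not lie in L₂(ξ), so `pot` is built from their projections; at
points of L₂(ξ) the inner products are the same. -/
theorem isCyl_pot (q : Fin n → I) : IsCyl ξ (pot ξ q) := by
  refine IsCyl.of_fintype (u := fun y => ∑ i, len q i * growth (y i / len q i))
    (h := projPiece ξ q) ?_ fun i => starProjection_L2sub_mem ξ _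
  exact ContDiff.sum fun i _ => contDiff_const.mul (contDiff_growth.comp (by fun_prop))

theorem inner_projPiece {g : L2} (hg : g ∈ L2sub ξ) (q : Fin n → I) (i : Fin (n + 1)) :
    inner ℝ g (projPiece ξ q i) / len q i = average q g i := by
  rw [projPiece, inner_starProjection_L2sub hg, average, real_inner_comm]

theorem pot_nonneg {q : Fin n → I} (hq : q ∈ jumpSet n) (g : L2) : 0 ≤ pot ξ q g :=
  Finset.sum_nonneg fun i _ => mul_nonneg (len_pos hq i).le (growth_nonneg _)

/-- The weight len of each term cancels the denominator of the average, which leaves a step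
function, projected to L₂(ξ). -/
theorem hasFDerivAt_pot {q : Fin n → I} (hq : q ∈ jumpSet n) {g : L2} (hg : g ∈ L2sub ξ) :
    HasFDerivAt (pot ξ q) (innerSL ℝ ((L2sub ξ).starProjection
      (chi q fun i => growthDeriv (average q g i)))) g := by
  have h1 : ∀ i, HasFDerivAt (fun g : L2 => len q i * growth (inner ℝ g (projPiece ξ q i) / len q i))
      (growthDeriv (average q g i) • innerSL ℝ (projPiece ξ q i)) g := by
    intro i
    have h2 : HasFDerivAt (fun g : L2 => (inner ℝ g (projPiece ξ q i) : ℝ) / len q i)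
        ((len q i)⁻¹ • innerSL ℝ (projPiece ξ q i)) g := by
      have h3 := (innerSL ℝ (projPiece ξ q i)).hasFDerivAt (x := g)
      refine (h3.const_smul (len q i)⁻¹).congr_of_eventuallyEq (Eventually.of_forall fun x => ?_)
      simp only [innerSL_apply_apply, Pi.smul_apply, smul_eq_mul, real_inner_comm]
      rw [div_eq_inv_mul]
    have h4 := ((hasDerivAt_growth _).comp_hasFDerivAt g h2).const_mul (len q i)
    refine h4.congr_fderiv ?_
    rw [inner_projPiece hg, smul_smul, smul_smul]
    congr 1
    field_simp [(len_pos hq i).ne']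
  refine (HasFDerivAt.fun_sum fun i _ => h1 i).congr_fderiv ?_
  rw [chi_eq_sum, map_sum, map_sum]
  refine Finset.sum_congr rfl fun i _ => ?_
  rw [map_smul, map_smulₛₗ]
  rfl

/-- Jensen's inequality. -/
theorem cubeNorm_chi_average_le {q : Fin n → I} (hq : q ∈ jumpSet n) (g : L2) :
    cubeNorm (chi q (average q g)) ≤ cubeNorm g := by
  rw [cubeNorm, lintegral_comp_chi hq _ fun y => ‖y‖ₑ ^ 3, cubeNorm, lintegral_eq_sum_piece hq]
  refine Finset.sum_le_sum fun i _ => ?_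
  set A := Ico (leftEnd q i) (rightEnd q i) with hA
  have hvol : volume A = ENNReal.ofReal (len q i) := unitInterval.volume_Ico _ _
  have hl0 : ENNReal.ofReal (len q i) ≠ 0 := (ENNReal.ofReal_pos.2 (len_pos hq i)).ne'
  -- Hölder's inequality with exponents 3 and 3/2 on the piece, in place of convexity.
  have h1 : ‖∫ s in A, g s‖ₑ ≤ eLpNorm g 3 (volume.restrict A) *
      ENNReal.ofReal (len q i) ^ (2 / 3 : ℝ) := by
    refine (enorm_integral_le_lintegral_enorm _).trans ?_
    rw [← eLpNorm_one_eq_lintegral_enorm]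
    refine (eLpNorm_le_eLpNorm_mul_rpow_measure_univ (p := 1) (q := 3) (by norm_num)
      (Lp.aestronglyMeasurable g).restrict).trans ?_
    rw [Measure.restrict_apply_univ, hvol]
    norm_num
  have h2 : eLpNorm g 3 (volume.restrict A) ^ 3 = ∫⁻ s in A, ‖g s‖ₑ ^ 3 := by
    rw [eLpNorm_eq_lintegral_rpow_enorm_toReal (by norm_num) (by norm_num), ← ENNReal.rpow_natCast,
      ← ENNReal.rpow_mul]
    norm_num
  have h3 : ‖average q g i‖ₑ = ‖∫ s in A, g s‖ₑ / ENNReal.ofReal (len q i) := by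
    rw [average, inner_piece, Real.enorm_eq_ofReal_abs, abs_div, abs_of_pos (len_pos hq i),
      ENNReal.ofReal_div_of_pos (len_pos hq i), Real.enorm_eq_ofReal_abs]
  rw [h3, ← h2]
  calc ENNReal.ofReal (len q i) * (‖∫ s in A, g s‖ₑ / ENNReal.ofReal (len q i)) ^ 3
      ≤ ENNReal.ofReal (len q i) * ((eLpNorm g 3 (volume.restrict A) *
          ENNReal.ofReal (len q i) ^ (2 / 3 : ℝ)) / ENNReal.ofReal (len q i)) ^ 3 := by gcongr
    _ = eLpNorm g 3 (volume.restrict A) ^ 3 * (ENNReal.ofReal (len q i) *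
          (ENNReal.ofReal (len q i) ^ (2 / 3 : ℝ)) ^ 3 * (ENNReal.ofReal (len q i))⁻¹ ^ 3) := by
        rw [div_eq_mul_inv]; ring
    _ = eLpNorm g 3 (volume.restrict A) ^ 3 := by
        have h4 : (ENNReal.ofReal (len q i) ^ (2 / 3 : ℝ)) ^ 3 = ENNReal.ofReal (len q i) ^ 2 := by
          rw [← ENNReal.rpow_natCast, ← ENNReal.rpow_mul, ← ENNReal.rpow_natCast]
          norm_num
        rw [h4, ← pow_succ', ← mul_pow, ENNReal.mul_inv_cancel hl0 ENNReal.ofReal_ne_top, one_pow,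
          mul_one]

/-- The projection to L₂(ξ) and averaging both decrease the relevant norms. What matters is that the
bound does not depend on the partition. -/
theorem enorm_fderiv_pot_sq_le {q : Fin n → I} (hq : q ∈ jumpSet n) {g : L2} (hg : g ∈ L2sub ξ) :
    ‖fderiv ℝ (pot ξ q) g‖ₑ ^ 2 ≤ 13 * (1 + cubeNorm g) := by
  set a := average q g with ha
  have h1 : ‖fderiv ℝ (pot ξ q) g‖ ≤ ‖chi q fun i => growthDeriv (a i)‖ := by
    rw [(hasFDerivAt_pot hq hg).fderiv, innerSL_apply_norm]
    exact Submodule.norm_starProjection_apply_le _ _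
  have h2 : ‖chi q fun i => growthDeriv (a i)‖ ^ 2 ≤ ∑ i, len q i * (13 * (1 + |a i| ^ 3)) := by
    rw [norm_sq_chi hq]
    exact Finset.sum_le_sum fun i _ =>
      mul_le_mul_of_nonneg_left (growthDeriv_sq_le _) (len_pos hq i).le
  have h3 : ENNReal.ofReal (∑ i, len q i * (13 * (1 + |a i| ^ 3))) =
      13 * (1 + cubeNorm (chi q a)) := by
    have h4 := lintegral_comp_chi hq a fun y => 13 * (1 + ‖y‖ₑ ^ 3)
    rw [lintegral_const_mul' _ _ (by norm_num), lintegral_add_left measurable_const,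
      lintegral_const, measure_univ, mul_one, ← cubeNorm] at h4
    rw [h4, ENNReal.ofReal_sum_of_nonneg fun i _ => mul_nonneg (len_pos hq i).le (by positivity)]
    refine Finset.sum_congr rfl fun i _ => ?_
    rw [ENNReal.ofReal_mul (len_pos hq i).le, ENNReal.ofReal_mul (by norm_num),
      ENNReal.ofReal_add zero_le_one (by positivity), ENNReal.ofReal_pow (abs_nonneg _),
      Real.enorm_eq_ofReal_abs]
    norm_num
  calc ‖fderiv ℝ (pot ξ q) g‖ₑ ^ 2 = ENNReal.ofReal (‖fderiv ℝ (pot ξ q) g‖ ^ 2) := by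
        rw [ENNReal.ofReal_pow (norm_nonneg _), ofReal_norm]
    _ ≤ ENNReal.ofReal (∑ i, len q i * (13 * (1 + |a i| ^ 3))) :=
        ENNReal.ofReal_le_ofReal ((pow_le_pow_left₀ (norm_nonneg _) h1 2).trans h2)
    _ ≤ 13 * (1 + cubeNorm g) := by
        rw [h3]
        gcongr
        exact cubeNorm_chi_average_le hq g

theorem ofReal_pot {q : Fin n → I} (hq : q ∈ jumpSet n) {g : L2} (hg : g ∈ L2sub ξ) :
    ENNReal.ofReal (pot ξ q g) = ∫⁻ s, ENNReal.ofReal (growth (chi q (average q g) s)) := by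
  rw [lintegral_comp_chi hq _ fun y => ENNReal.ofReal (growth y), pot,
    ENNReal.ofReal_sum_of_nonneg fun i _ => mul_nonneg (len_pos hq i).le (growth_nonneg _)]
  refine Finset.sum_congr rfl fun i _ => ?_
  rw [ENNReal.ofReal_mul (len_pos hq i).le, inner_projPiece hg]

/-- The equidistant points of `(0, 1)`. -/
def uniformPoints (m : ℕ) (j : Fin m) : I :=
  ⟨((j : ℝ) + 1) / (m + 1), by positivity, by
    rw [div_le_one (by positivity)]
    have : ((j : ℕ) : ℝ) + 1 ≤ m := by exact_mod_cast j.2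
    linarith⟩

theorem uniformPoints_mem (m : ℕ) : uniformPoints m ∈ jumpSet m := by
  refine ⟨fun i j hij => ?_, fun i => ⟨?_, ?_⟩⟩
  · rw [← Subtype.coe_lt_coe]
    simp only [uniformPoints]
    have : ((i : ℕ) : ℝ) < (j : ℕ) := by exact_mod_cast hij
    gcongr
  · rw [← Subtype.coe_lt_coe]
    simp only [uniformPoints, Icc.coe_zero]
    positivity
  · rw [← Subtype.coe_lt_coe]
    simp only [uniformPoints, Icc.coe_one]
    rw [div_lt_one (by positivity)]
    have : ((i : ℕ) : ℝ) + 1 ≤ m := by exact_mod_cast i.2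
    linarith

theorem len_uniformPoints (m : ℕ) (i : Fin (m + 1)) : len (uniformPoints m) i = 1 / (m + 1) := by
  have h1 : (leftEnd (uniformPoints m) i : ℝ) = (i : ℕ) / (m + 1) := by
    refine Fin.cases ?_ (fun j => ?_) i
    · simp [leftEnd]
    · simp [leftEnd, uniformPoints]
  have h2 : (rightEnd (uniformPoints m) i : ℝ) = ((i : ℕ) + 1) / (m + 1) := by
    refine Fin.lastCases ?_ (fun j => ?_) i
    · simp only [rightEnd, Fin.snoc_last, Icc.coe_one, Fin.val_last]
      rw [div_self (by positivity)]
    · simp [rightEnd, uniformPoints]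
  rw [len, h1, h2]
  ring

theorem abs_average_le {q : Fin n → I} (hq : q ∈ jumpSet n) {g : L2} {B : ℝ}
    (hg : ∀ᵐ s, |g s| ≤ B) (i : Fin (n + 1)) : |average q g i| ≤ B := by
  rw [average, inner_piece, abs_div, abs_of_pos (len_pos hq i), div_le_iff₀ (len_pos hq i),
    ← volume_real_Ico_piece hq i]
  have hg' : ∀ᵐ s, ‖g s‖ ≤ B := hg
  exact norm_setIntegral_le_of_norm_le_const_ae (measure_lt_top _ _) (ae_restrict_of_ae hg')

/-- Averages of a step function over short pieces agree with the step function. -/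
theorem ae_eventually_average {q : Fin n → I} (hq : q ∈ jumpSet n) (x : Fin (n + 1) → ℝ) :
    ∀ᵐ s : I, ∀ᶠ m in atTop,
      chi (uniformPoints m) (average (uniformPoints m) (chi q x)) s = chi q x s := by
  -- Away from the left ends, s has positive distance to both ends of its piece, so a sufficiently
  -- short piece of the uniform partition around s lies inside.
  have hne : ∀ᵐ s : I, ∀ j, s ≠ leftEnd q j := ae_all_iff.2 fun j => by simp [ae_iff]
  filter_upwards [hne, chi_coeFn hq x, ae_exists_mem_piece q,
    ae_all_iff.2 fun m => chi_coeFn (uniformPoints_mem m) (average (uniformPoints m) (chi q x)),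
    ae_all_iff.2 fun m => ae_exists_mem_piece (uniformPoints m)] with s h1 h2 ⟨j, hj⟩ h4 h5
  have hl : (leftEnd q j : ℝ) < s := Subtype.coe_lt_coe.2 (lt_of_le_of_ne hj.1 (h1 j).symm)
  have hr : (s : ℝ) < rightEnd q j := Subtype.coe_lt_coe.2 hj.2
  have hsmall : ∀ᶠ m : ℕ in atTop, 1 / ((m : ℝ) + 1) < min (s - leftEnd q j : ℝ) (rightEnd q j - s) :=
    (tendsto_order.1 tendsto_one_div_add_atTop_nhds_zero_nat).2 _
      (lt_min (by linarith) (by linarith))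
  filter_upwards [hsmall] with m hm
  obtain ⟨i, hi⟩ := h5 m
  rw [h4 m i hi, h2 j hj, average, inner_piece]
  have hlen := len_uniformPoints m i
  have hpos := len_pos (uniformPoints_mem m) i
  rw [← hlen, len, lt_min_iff] at hm
  have hi1 : (leftEnd (uniformPoints m) i : ℝ) ≤ s := Subtype.coe_le_coe.2 hi.1
  have hi2 : (s : ℝ) < rightEnd (uniformPoints m) i := Subtype.coe_lt_coe.2 hi.2
  have hsub : Ico (leftEnd (uniformPoints m) i) (rightEnd (uniformPoints m) i) ⊆
      Ico (leftEnd q j) (rightEnd q j) := by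
    refine Ico_subset_Ico ?_ ?_ <;> rw [← Subtype.coe_le_coe] <;> linarith [hm.1, hm.2]
  rw [setIntegral_congr_ae (g := fun _ => x j) measurableSet_Ico
    ((chi_coeFn hq x).mono fun t ht h => ht j (hsub h)), setIntegral_const,
    volume_real_Ico_piece (uniformPoints_mem m), smul_eq_mul, mul_div_cancel_left₀ _ hpos.ne']

theorem exists_bound_chi {q : Fin n → I} (hq : q ∈ jumpSet n) (x : Fin (n + 1) → ℝ) :
    ∃ B, ∀ᵐ s : I, |chi q x s| ≤ B := by
  refine ⟨∑ i, |x i|, ?_⟩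
  filter_upwards [chi_coeFn hq x, ae_exists_mem_piece q] with s h1 ⟨i, hi⟩
  rw [h1 i hi]
  exact Finset.single_le_sum (f := fun i => |x i|) (fun i _ => abs_nonneg _) (Finset.mem_univ i)

theorem potential_chi_lt_top {q : Fin n → I} (hq : q ∈ jumpSet n) (x : Fin (n + 1) → ℝ) :
    potential (chi q x) < ⊤ := by
  rw [potential, lintegral_comp_chi hq x fun y => ENNReal.ofReal (growth y)]
  exact ENNReal.sum_lt_top.2 fun i _ => ENNReal.mul_lt_top ENNReal.ofReal_lt_top ENNReal.ofReal_lt_top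

/-- A step function is bounded, and its averages obey the same bound, so dominated convergence
applies. -/
theorem tendsto_pot_chi {q : Fin n → I} (hq : q ∈ jumpSet n) {x : Fin (n + 1) → ℝ}
    (hg : chi q x ∈ L2sub ξ) :
    Tendsto (fun m => ENNReal.ofReal (pot ξ (uniformPoints m) (chi q x))) atTop
      (𝓝 (potential (chi q x))) := by
  obtain ⟨B, hB⟩ := exists_bound_chi hq x
  simp_rw [fun m => ofReal_pot (uniformPoints_mem m) hg]
  refine tendsto_lintegral_of_dominated_convergence' (fun _ => ENNReal.ofReal (growth B))
    (fun m => ?_) (fun m => ?_) (by simp) ?_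
  · exact (contDiff_growth.continuous.measurable.comp_aemeasurable
      (Lp.aestronglyMeasurable _).aemeasurable).ennreal_ofReal
  · filter_upwards [chi_coeFn (uniformPoints_mem m) (average (uniformPoints m) (chi q x)),
      ae_exists_mem_piece (uniformPoints m)] with s h1 ⟨i, hi⟩
    rw [h1 i hi]
    exact ENNReal.ofReal_le_ofReal (growth_le (abs_average_le (uniformPoints_mem m) hB i))
  · filter_upwards [ae_eventually_average hq x] with s hs
    exact tendsto_const_nhds.congr' (hs.mono fun m hm => by simp only [hm])

variable (ξ) in
/-- The discretised potentials converge almost everywhere. -/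
theorem ae_tendsto_pot : ∀ᵐ g : L2upOf ξ ∂Xi ξ, potential g < ⊤ ∧
    Tendsto (fun m => pot ξ (uniformPoints m) g) atTop (𝓝 (potential g).toReal) := by
  have h : ∀ᵐ g : L2upOf ξ ∂Xi ξ, potential g < ⊤ ∧
      Tendsto (fun m => ENNReal.ofReal (pot ξ (uniformPoints m) g)) atTop (𝓝 (potential g)) := by
    have hpm : Measurable fun g : L2upOf ξ => potential g :=
      measurable_potential.comp measurable_subtype_coe
    rw [ae_Xi_iff]
    · intro n
      filter_upwards [ae_goodSet ξ n, ae_chiUp ξ n] with p h1 h2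
      have h3 := (chiUp ξ p).2.2
      rw [h2] at h3 ⊢
      exact ⟨potential_chi_lt_top h1.1 _, tendsto_pot_chi h1.1 h3⟩
    · refine MeasurableSet.inter (measurableSet_lt hpm measurable_const)
        (measurableSet_tendsto_fun (fun m => ?_) hpm)
      have : Continuous (pot ξ (uniformPoints m)) := by
        refine continuous_finsetSum _ fun i _ => continuous_const.mul
          (contDiff_growth.continuous.comp (Continuous.div_const ?_ _))
        fun_prop
      exact (this.comp continuous_subtype_val).measurable.ennreal_ofReal
  filter_upwards [h] with g hg
  refine ⟨hg.1, ((ENNReal.tendsto_toReal hg.1.ne).comp hg.2).congr fun m => ?_⟩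
  rw [Function.comp_apply, ENNReal.toReal_ofReal (pot_nonneg (uniformPoints_mem m) _)]

end Potential
/-! ### The nest of compact sets -/

section Nest

variable {ξ : StieltjesFunction I}

/-- Dominated convergence in `L₂(Ξ)`. -/
theorem tendsto_Lp_of_dominated {f : ℕ → Lp ℝ 2 (Xi ξ)} {F : Lp ℝ 2 (Xi ξ)} {C R : ℝ}
    (h1 : ∀ k, ∀ᵐ g ∂Xi ξ, |f k g| ≤ C)
    (h2 : ∀ k, ∀ᵐ g : L2upOf ξ ∂Xi ξ, R < ‖(g : L2)‖ → f k g = 0)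
    (h3 : ∀ᵐ g ∂Xi ξ, Tendsto (fun k => f k g) atTop (𝓝 (F g))) : Tendsto f atTop (𝓝 F) := by
  have hs : MeasurableSet {g : L2upOf ξ | ‖(g : L2)‖ ≤ R} :=
    (isClosed_le (continuous_norm.comp continuous_subtype_val) continuous_const).measurableSet
  have hm : ∀ u : Lp ℝ 2 (Xi ξ), AEMeasurable (fun g => u g) (Xi ξ) := fun u =>
    (Lp.aestronglyMeasurable u).aemeasurable
  have hlim : Tendsto (fun k => ∫⁻ g, ‖f k g - F g‖ₑ ^ 2 ∂Xi ξ) atTop (𝓝 0) := by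
    have h4 := tendsto_lintegral_of_dominated_convergence' (μ := Xi ξ)
      (F := fun k g => ‖f k g - F g‖ₑ ^ 2) (f := fun _ => 0)
      ({g : L2upOf ξ | ‖(g : L2)‖ ≤ R}.indicator fun _ => ENNReal.ofReal ((2 * C) ^ 2))
      (fun k => ((hm _).sub (hm _)).enorm.pow_const 2) (fun k => ?_) ?_ ?_
    · simpa using h4
    · filter_upwards [ae_all_iff.2 h1, ae_all_iff.2 h2, h3] with g hg1 hg2 hg3
      by_cases hg : g ∈ {g : L2upOf ξ | ‖(g : L2)‖ ≤ R}
      · rw [indicator_of_mem hg, Real.enorm_eq_ofReal_abs, ← ENNReal.ofReal_pow (abs_nonneg _)]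
        refine ENNReal.ofReal_le_ofReal (pow_le_pow_left₀ (abs_nonneg _) ?_ 2)
        have hF : |F g| ≤ C := le_of_tendsto' hg3.abs hg1
        have := abs_sub (f k g) (F g)
        linarith [hg1 k]
      · rw [indicator_of_notMem hg]
        have hg' : R < ‖(g : L2)‖ := not_le.1 hg
        have hF : F g = 0 := tendsto_nhds_unique hg3
          (tendsto_const_nhds.congr fun k => (hg2 k hg').symm)
        simp [hF, hg2 k hg']
    · rw [lintegral_indicator_const hs]
      exact (ENNReal.mul_lt_top ENNReal.ofReal_lt_top (measure_closedBall_lt_top ξ R)).ne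
    · filter_upwards [h3] with g hg
      have h5 := (hg.sub_const (F g)).enorm
      rw [sub_self, enorm_zero] at h5
      have h6 := ((ENNReal.continuous_pow 2).tendsto 0).comp h5
      rwa [zero_pow two_ne_zero] at h6
  rw [Lp.tendsto_Lp_iff_tendsto_eLpNorm']
  have h7 := hlim.ennrpow_const (1 / 2)
  rw [ENNReal.zero_rpow_of_pos (by norm_num)] at h7
  refine h7.congr fun k => ?_
  have := lintegral_enorm_sq (Xi ξ) (f k - F : L2upOf ξ → ℝ)
  simp only [Pi.sub_apply] at this
  rw [this, ← ENNReal.rpow_natCast, ← ENNReal.rpow_mul]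
  norm_num

/-- A smooth cutoff of the potential. -/
def potCut : ContDiffBump (0 : ℝ) := ⟨1, 2, one_pos, one_lt_two⟩

theorem potCut_mem (x : ℝ) : 0 ≤ potCut x ∧ potCut x ≤ 1 := ⟨potCut.nonneg, potCut.le_one⟩

theorem exists_bound_deriv_potCut : ∃ K, 0 ≤ K ∧ ∀ x, |deriv potCut x| ≤ K := by
  have h1 : ContDiff ℝ 1 potCut := potCut.contDiff
  obtain ⟨K, hK⟩ :=
    (h1.continuous_deriv le_rfl).bounded_above_of_compact_support potCut.hasCompactSupport.deriv
  exact ⟨K, (norm_nonneg _).trans (hK 0), hK⟩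

theorem cut_mem_FC (u : FC ξ) (M : ℝ) (m : ℕ) :
    (fun g => u.1 g * potCut (pot ξ (uniformPoints m) g / M)) ∈ FC ξ :=
  mul_cyl_mem_FC u.2 ((isCyl_pot (uniformPoints m)).comp
    (f := fun x => potCut (x / M)) (potCut.contDiff.comp (by fun_prop)))

/-- A function in `𝓕𝓒` times a cutoff of the discretised potential. -/
def cutFC (u : FC ξ) (M : ℝ) (m : ℕ) : FC ξ := ⟨_, cut_mem_FC u M m⟩

/-- By the product and chain rules the gradient is at most C + C D ‖∇pot‖; the factor 1/M is dropped
since M ≥ 1. The inequality (a + b)² ≤ 2a² + 2b² and the bound 13 (1 + ‖g‖₃³) give K, uniformly in M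
and m. -/
theorem enorm_DD_cutFC_sq_le (u : FC ξ) : ∃ K : ℝ, ∃ R : ℝ, 0 ≤ K ∧ ∀ M : ℝ, 1 ≤ M → ∀ m,
    ∀ g : L2upOf ξ, ‖DD (cutFC u M m).1 g‖ₑ ^ 2 ≤ ENNReal.ofReal K * ballWeight R g := by
  have hn := isNice_of_mem_FC u.2
  obtain ⟨C, hC⟩ := hn.bound
  obtain ⟨R, hR⟩ := hn.support
  obtain ⟨D, hD0, hD⟩ := exists_bound_deriv_potCut
  have hC0 : 0 ≤ C := (abs_nonneg _).trans (hC 0).1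
  refine ⟨2 * C ^ 2 + 2 * (C * D) ^ 2 * 13, R, by positivity, fun M hM m g => ?_⟩
  have hsupp : ∀ g : L2, R < ‖g‖ → (cutFC u M m).1 g = 0 := fun g hg => by
    simp [cutFC, hR g hg]
  by_cases hg : R < ‖(g : L2)‖
  · have h1 : ‖DD (cutFC u M m).1 g‖ ≤ 0 := by
      refine (norm_DD_le _ _).trans ?_
      rw [IsNice.fderiv_eq_zero hsupp hg, norm_zero]
    rw [norm_le_zero_iff.1 h1, enorm_zero, zero_pow two_ne_zero]
    exact zero_le
  have hM0 : 0 < M := by linarith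
  have hpot := (hasFDerivAt_pot (uniformPoints_mem m) g.2.2).differentiableAt.hasFDerivAt
  have hcut : HasFDerivAt (fun g : L2 => potCut (pot ξ (uniformPoints m) g / M))
      (deriv potCut (pot ξ (uniformPoints m) g / M) •
        (M⁻¹ • fderiv ℝ (pot ξ (uniformPoints m)) g)) (g : L2) := by
    have h1 : HasFDerivAt (fun g : L2 => pot ξ (uniformPoints m) g / M)
        (M⁻¹ • fderiv ℝ (pot ξ (uniformPoints m)) g) (g : L2) := by
      simp_rw [div_eq_inv_mul]
      exact hpot.const_mul M⁻¹
    have h2 : Differentiable ℝ potCut :=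
      (potCut.contDiff (n := 1)).differentiable one_ne_zero
    exact (h2 _).hasDerivAt.comp_hasFDerivAt (g : L2) h1
  have hder := (hn.differentiable (g : L2)).hasFDerivAt.mul hcut
  have h3 : ‖fderiv ℝ (cutFC u M m).1 g‖ ≤
      C + C * D * ‖fderiv ℝ (pot ξ (uniformPoints m)) (g : L2)‖ := by
    have h4 : fderiv ℝ (cutFC u M m).1 g = _ := hder.fderiv
    rw [h4, add_comm]
    refine (norm_add_le _ _).trans (add_le_add ?_ ?_)
    · rw [norm_smul]
      refine (mul_le_of_le_one_left (norm_nonneg _) ?_).trans (hC g).2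
      rw [Real.norm_of_nonneg (potCut_mem _).1]
      exact (potCut_mem _).2
    · rw [norm_smul, norm_smul, norm_smul, mul_assoc]
      refine mul_le_mul (hC g).1 ?_ (by positivity) hC0
      refine mul_le_mul (hD _) ?_ (by positivity) hD0
      refine mul_le_of_le_one_left (norm_nonneg _) ?_
      rw [Real.norm_of_nonneg (by positivity)]
      exact inv_le_one_of_one_le₀ hM
  have h5 : ballWeight R g = 1 + cubeNorm g := by
    rw [ballWeight, indicator_of_mem (by simpa using hg)]
    rfl
  have h6 := enorm_fderiv_pot_sq_le (uniformPoints_mem m) g.2.2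
  set P := ‖fderiv ℝ (pot ξ (uniformPoints m)) (g : L2)‖ with hP
  calc ‖DD (cutFC u M m).1 g‖ₑ ^ 2 ≤ ENNReal.ofReal (2 * C ^ 2 + 2 * (C * D) ^ 2 * P ^ 2) := by
        rw [← ofReal_norm, ← ENNReal.ofReal_pow (norm_nonneg _)]
        refine ENNReal.ofReal_le_ofReal ?_
        have h7 := pow_le_pow_left₀ (norm_nonneg _) ((norm_DD_le _ _).trans h3) 2
        nlinarith [sq_nonneg (C - C * D * P)]
    _ = ENNReal.ofReal (2 * C ^ 2) + ENNReal.ofReal (2 * (C * D) ^ 2) *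
          ‖fderiv ℝ (pot ξ (uniformPoints m)) (g : L2)‖ₑ ^ 2 := by
        rw [ENNReal.ofReal_add (by positivity) (by positivity), ENNReal.ofReal_mul (p := 2 * (C * D) ^ 2) (by positivity),
          hP, ENNReal.ofReal_pow (norm_nonneg _), ofReal_norm]
    _ ≤ ENNReal.ofReal (2 * C ^ 2) * (1 + cubeNorm g) +
          ENNReal.ofReal (2 * (C * D) ^ 2) * (13 * (1 + cubeNorm g)) := by
        gcongr
        exact le_mul_of_one_le_right zero_le le_self_add
    _ = ENNReal.ofReal (2 * C ^ 2 + 2 * (C * D) ^ 2 * 13) * ballWeight R g := by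
        rw [h5, ENNReal.ofReal_add (by positivity) (by positivity),
          ENNReal.ofReal_mul (q := 13) (by positivity)]
        norm_num
        ring

theorem exists_bound_gradLp_cutFC (u : FC ξ) :
    ∃ C : ℝ, ∀ M : ℝ, 1 ≤ M → ∀ m, ‖gradLp ξ (cutFC u M m)‖ ≤ C := by
  obtain ⟨K, R, hK, h⟩ := enorm_DD_cutFC_sq_le u
  set A := ENNReal.ofReal K * ∫⁻ g : L2upOf ξ, ballWeight R g ∂Xi ξ with hA
  have hAtop : A ≠ ⊤ :=
    (ENNReal.mul_lt_top ENNReal.ofReal_lt_top (lintegral_ballWeight_lt_top ξ R)).ne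
  refine ⟨√A.toReal, fun M hM m => Real.le_sqrt_of_sq_le ?_⟩
  have h1 : ‖gradLp ξ (cutFC u M m)‖ₑ ^ 2 ≤ A := by
    rw [Lp.enorm_def, ← lintegral_enorm_sq, hA, ← lintegral_const_mul' _ _ ENNReal.ofReal_ne_top]
    refine lintegral_mono_ae ?_
    filter_upwards [gradLp_coeFn (cutFC u M m)] with g hg
    rw [hg]
    exact h M hM m g
  rw [← ENNReal.ofReal_le_iff_le_toReal hAtop, ENNReal.ofReal_pow (norm_nonneg _), ofReal_norm]
  exact h1

/-! ### From the discretised cutoffs to the cutoff of the potential -/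

theorem measurable_cut (u : FC ξ) (M : ℝ) :
    Measurable fun g : L2upOf ξ => u.1 g * potCut ((potential g).toReal / M) := by
  refine Measurable.mul ?_ (potCut.continuous.measurable.comp (Measurable.div_const ?_ _))
  · exact ((isNice_of_mem_FC u.2).contDiff.continuous.comp continuous_subtype_val).measurable
  · exact (measurable_potential.comp measurable_subtype_coe).ennreal_toReal

theorem abs_mul_potCut_le (a x : ℝ) : |a * potCut x| ≤ |a| := by
  rw [abs_mul]
  refine mul_le_of_le_one_right (abs_nonneg _) ?_
  rw [abs_of_nonneg (potCut_mem _).1]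
  exact (potCut_mem _).2

theorem memLp_cut (u : FC ξ) (M : ℝ) :
    MemLp (fun g : L2upOf ξ => u.1 g * potCut ((potential g).toReal / M)) 2 (Xi ξ) := by
  obtain ⟨C, hC⟩ := (isNice_of_mem_FC u.2).bound
  obtain ⟨R, hR⟩ := (isNice_of_mem_FC u.2).support
  exact memLp_Xi_of_bounded ξ (measurable_cut u M).aestronglyMeasurable
    (fun g => (abs_mul_potCut_le _ _).trans (hC g).1) (R := R)
    fun g hg => by rw [hR _ hg, zero_mul]

/-- A function in `𝓕𝓒` times a cutoff of the potential. -/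
def cutLp (u : FC ξ) (M : ℝ) : Lp ℝ 2 (Xi ξ) := (memLp_cut u M).toLp _

theorem cutLp_coeFn (u : FC ξ) (M : ℝ) :
    cutLp u M =ᵐ[Xi ξ] fun g => u.1 g * potCut ((potential g).toReal / M) :=
  (memLp_cut u M).coeFn_toLp

theorem tendsto_cutFC (u : FC ξ) (M : ℝ) :
    Tendsto (fun m => toLp ξ (cutFC u M m)) atTop (𝓝 (cutLp u M)) := by
  obtain ⟨C, hC⟩ := (isNice_of_mem_FC u.2).bound
  obtain ⟨R, hR⟩ := (isNice_of_mem_FC u.2).support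
  refine tendsto_Lp_of_dominated (C := C) (R := R) (fun m => ?_) (fun m => ?_) ?_
  · filter_upwards [toLp_coeFn (cutFC u M m)] with g hg
    rw [hg]
    exact (abs_mul_potCut_le _ _).trans (hC g).1
  · filter_upwards [toLp_coeFn (cutFC u M m)] with g hg hgR
    rw [hg]
    simp [cutFC, hR _ hgR]
  · filter_upwards [ae_all_iff.2 fun m => toLp_coeFn (cutFC u M m), cutLp_coeFn u M,
      ae_tendsto_pot ξ] with g h1 h2 h3
    simp_rw [h1, h2]
    exact ((potCut.continuous.tendsto _).comp (h3.2.div_const M)).const_mul _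

theorem tendsto_cutLp (u : FC ξ) :
    Tendsto (fun k : ℕ => cutLp u ((k : ℝ) + 1)) atTop (𝓝 (toLp ξ u)) := by
  obtain ⟨C, hC⟩ := (isNice_of_mem_FC u.2).bound
  obtain ⟨R, hR⟩ := (isNice_of_mem_FC u.2).support
  refine tendsto_Lp_of_dominated (C := C) (R := R) (fun m => ?_) (fun m => ?_) ?_
  · filter_upwards [cutLp_coeFn u ((m : ℝ) + 1)] with g hg
    rw [hg]
    exact (abs_mul_potCut_le _ _).trans (hC g).1
  · filter_upwards [cutLp_coeFn u ((m : ℝ) + 1)] with g hg hgR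
    rw [hg, hR _ hgR, zero_mul]
  · filter_upwards [ae_all_iff.2 fun m : ℕ => cutLp_coeFn u ((m : ℝ) + 1), toLp_coeFn u] with g h1 h2
    simp_rw [h1, h2]
    have h3 : Tendsto (fun k : ℕ => (potential g).toReal / ((k : ℝ) + 1)) atTop (𝓝 0) := by
      simpa [div_eq_mul_inv] using
        tendsto_one_div_add_atTop_nhds_zero_nat.const_mul (potential g).toReal
    have h4 := ((potCut.continuous.tendsto 0).comp h3).const_mul (u.1 g)
    rwa [potCut.one_of_mem_closedBall (by simp [potCut]), mul_one] at h4

theorem eLpNorm_rpow_le_potential (g : L2) :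
    eLpNorm g (5 / 2) (volume : Measure I) ^ (5 / 2 : ℝ) ≤ potential g := by
  have h52 : (5 / 2 : ℝ≥0∞).toReal = 5 / 2 := by simp
  rw [eLpNorm_eq_lintegral_rpow_enorm_toReal (by norm_num)
    (ENNReal.div_ne_top (by norm_num) (by norm_num)), h52, ← ENNReal.rpow_mul]
  norm_num
  exact lintegral_mono fun s => enorm_rpow_le_growth (g s)

/-- Where the cutoff does not vanish, the potential is below 2M. This bounds the norm of L_{5/2},
which dominates that of L_{2+1/j} for every j ≥ 2. -/
theorem exists_cutLp_eq_zero (u : FC ξ) {M : ℝ} (hM : 0 < M) :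
    ∃ n, ∀ᵐ g ∂Xi ξ, g ∉ normBall ξ (n + 1) → cutLp u M g = 0 := by
  -- If the norm exceeded k, then k ≤ k^(5/2) ≤ 2M would follow, which contradicts k ≥ 2M + 1.
  obtain ⟨k, hk⟩ := exists_nat_ge (2 * M + 1)
  refine ⟨k + 1, ?_⟩
  filter_upwards [cutLp_coeFn u M, ae_tendsto_pot ξ] with g h1 h2 h3
  rw [h1]
  by_contra hne
  refine h3 ?_
  have h4 : (potential g).toReal / M ∈ Metric.ball (0 : ℝ) 2 := by
    have := right_ne_zero_of_mul hne
    rw [← Function.mem_support, potCut.support_eq] at this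
    exact this
  rw [mem_ball_zero_iff, Real.norm_of_nonneg (by positivity), div_lt_iff₀ hM] at h4
  have h5 : potential g ≤ ENNReal.ofReal (2 * M) := by
    rw [← ENNReal.ofReal_toReal h2.1.ne]
    exact ENNReal.ofReal_le_ofReal h4.le
  have hk1 : (1 : ℝ) ≤ k := by linarith
  have h6 : eLpNorm (g : L2) (5 / 2) (volume : Measure I) ≤ k := by
    by_contra hlt
    rw [not_le] at hlt
    have h7 : (k : ℝ≥0∞) ≤ eLpNorm (g : L2) (5 / 2) (volume : Measure I) ^ (5 / 2 : ℝ) := by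
      calc (k : ℝ≥0∞) = (k : ℝ≥0∞) ^ (1 : ℝ) := (ENNReal.rpow_one _).symm
        _ ≤ (k : ℝ≥0∞) ^ (5 / 2 : ℝ) :=
            ENNReal.rpow_le_rpow_of_exponent_le (by exact_mod_cast hk1) (by norm_num)
        _ ≤ _ := by gcongr
    have h8 := (h7.trans (eLpNorm_rpow_le_potential g)).trans h5
    rw [← ENNReal.ofReal_natCast, ENNReal.ofReal_le_ofReal_iff (by positivity)] at h8
    linarith
  change eLpNorm (g : L2) (2 + 1 / ((k + 1 + 1 : ℕ) : ℝ≥0∞)) (volume : Measure I) ≤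
    ((k + 1 + 1 : ℕ) : ℝ≥0∞)
  refine (eLpNorm_le_eLpNorm_of_exponent_le ?_ (Lp.aestronglyMeasurable _)).trans (h6.trans ?_)
  · have h9 : (5 / 2 : ℝ≥0∞) = 2 + 1 / 2 := by
      rw [← ENNReal.toReal_eq_toReal_iff' (by finiteness) (by finiteness),
        ENNReal.toReal_add (by finiteness) (by finiteness)]
      norm_num
    rw [h9]
    gcongr
    exact_mod_cast (by omega : 2 ≤ k + 1 + 1)
  · exact_mod_cast (by omega : k ≤ k + 1 + 1)

variable (ξ) in
/-- Elements of the domain that vanish outside of one of the compact sets, with gradients. -/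
def nestGraph : Submodule ℝ (Lp ℝ 2 (Xi ξ) × Lp L2 2 (Xi ξ)) where
  carrier := {p | p ∈ gradGraph ξ ∧ ∃ n, ∀ᵐ g ∂Xi ξ, g ∉ normBall ξ (n + 1) → p.1 g = 0}
  add_mem' := by
    rintro p p' ⟨hp, n, hn⟩ ⟨hp', n', hn'⟩
    refine ⟨(gradGraph ξ).add_mem hp hp', max n n', ?_⟩
    filter_upwards [hn, hn', Lp.coeFn_add p.1 p'.1] with g h1 h2 h3 h4
    rw [Prod.fst_add, h3, Pi.add_apply, h1 fun h => h4 (normBall_mono ξ (le_max_left _ _) h),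
      h2 fun h => h4 (normBall_mono ξ (le_max_right _ _) h), add_zero]
  zero_mem' := ⟨(gradGraph ξ).zero_mem, 0, by
    filter_upwards [Lp.coeFn_zero ℝ 2 (Xi ξ)] with g hg _ using hg⟩
  smul_mem' := by
    rintro c p ⟨hp, n, hn⟩
    refine ⟨(gradGraph ξ).smul_mem c hp, n, ?_⟩
    filter_upwards [hn, Lp.coeFn_smul c p.1] with g h1 h2 h3
    rw [Prod.smul_fst, h2, Pi.smul_apply, h1 h3, smul_zero]

theorem nestGraph_le : nestGraph ξ ≤ gradGraph ξ := fun _ hp => hp.1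

/-- Two limits with one bound on the gradients: m → ∞ puts u times the cutoff of the potential in
the domain, and the level tending to ∞ puts u in the closure of the functions that live on the nest.
Uniqueness identifies the gradient obtained there as that of u. -/
theorem gradGraph_le_closure_nestGraph : gradGraph ξ ≤ (nestGraph ξ).topologicalClosure := by
  refine Submodule.topologicalClosure_minimal _ ?_ (Submodule.isClosed_topologicalClosure _)
  rintro _ ⟨u, rfl⟩
  obtain ⟨C, hC⟩ := exists_bound_gradLp_cutFC u
  have h1 : ∀ k : ℕ, ∃ b, (cutLp u ((k : ℝ) + 1), b) ∈ gradGraph ξ ∧ ‖b‖ ≤ C := fun k =>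
    exists_mem_of_bounded_snd (𝒜 := (gradGraph ξ : Set (Lp ℝ 2 (Xi ξ) × Lp L2 2 (Xi ξ))))
      (gradGraph ξ).convex isClosed_gradGraph fun ε hε => by
        obtain ⟨m, hm⟩ := (Metric.tendsto_nhds.1 (tendsto_cutFC u ((k : ℝ) + 1)) ε hε).exists
        rw [dist_eq_norm] at hm
        exact ⟨_, mem_gradGraph (cutFC u ((k : ℝ) + 1) m), hm.le, hC _ (by simp) m⟩
  obtain ⟨b, hb, -⟩ := exists_mem_of_bounded_snd (a := toLp ξ u) (C := C)
    (𝒜 := ((nestGraph ξ).topologicalClosure : Set (Lp ℝ 2 (Xi ξ) × Lp L2 2 (Xi ξ))))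
    (nestGraph ξ).topologicalClosure.convex (Submodule.isClosed_topologicalClosure _) fun ε hε => by
      obtain ⟨k, hk⟩ := (Metric.tendsto_nhds.1 (tendsto_cutLp u) ε hε).exists
      rw [dist_eq_norm] at hk
      obtain ⟨b, hb, hbC⟩ := h1 k
      exact ⟨_, Submodule.le_topologicalClosure _
        ⟨hb, exists_cutLp_eq_zero u (by positivity)⟩, hk.le, hbC⟩
  have hb' : (toLp ξ u, b) ∈ gradGraph ξ :=
    Submodule.topologicalClosure_minimal _ nestGraph_le isClosed_gradGraph hb
  rwa [grad_unique hb' (mem_gradGraph u)] at hb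

theorem exists_form₁_sub_lt {U : Lp ℝ 2 (Xi ξ)} {W : Lp L2 2 (Xi ξ)} (hW : (U, W) ∈ gradGraph ξ)
    {𝒜 : Set (Lp ℝ 2 (Xi ξ) × Lp L2 2 (Xi ξ))} (h𝒜 : 𝒜 ⊆ gradGraph ξ) (hcl : (U, W) ∈ closure 𝒜)
    {ε : ℝ} (hε : 0 < ε) : ∃ p ∈ 𝒜, (closureForm ξ).form₁ (U - p.1) (U - p.1) < ε := by
  obtain ⟨p, hp, hd⟩ := Metric.mem_closure_iff.1 hcl (√(ε / 2)) (Real.sqrt_pos.2 (by positivity))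
  refine ⟨p, hp, ?_⟩
  rw [Prod.dist_eq, max_lt_iff, dist_eq_norm, dist_eq_norm, Real.lt_sqrt (norm_nonneg _),
    Real.lt_sqrt (norm_nonneg _)] at hd
  rw [form₁_sub hW (W' := p.2) (h𝒜 hp)]
  linarith [hd.1, hd.2]

theorem isNest_normBall : (closureForm ξ).IsNest fun n => normBall ξ (n + 1) where
  mono := normBall_mono ξ
  closed n := isClosed_normBall ξ (n + 1)
  dense := by
    refine ⟨iUnion_subset fun n U hU => hU.1, fun U hU ε hε => ?_⟩
    obtain ⟨W, hW⟩ := mem_dom_iff.1 hU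
    obtain ⟨p, ⟨hp, n, hn⟩, hlt⟩ := exists_form₁_sub_lt hW
      (𝒜 := (nestGraph ξ : Set (Lp ℝ 2 (Xi ξ) × Lp L2 2 (Xi ξ)))) nestGraph_le
      (gradGraph_le_closure_nestGraph hW) hε
    exact ⟨p.1, mem_iUnion.2 ⟨n, mem_dom_iff.2 ⟨p.2, hp⟩, hn⟩, hlt⟩

end Nest
/-! ### Quasi-regularity -/

section QuasiRegular

variable {ξ : StieltjesFunction I}

theorem isQuasiContinuous_of_continuous {f : L2upOf ξ → ℝ} (hf : Continuous f) :
    (closureForm ξ).IsQuasiContinuous f :=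
  ⟨_, isNest_normBall, fun _ => hf.continuousOn⟩

theorem continuous_of_mem_FC {u : L2 → ℝ} (hu : u ∈ FC ξ) : Continuous fun g : L2upOf ξ => u g :=
  (isNice_of_mem_FC hu).contDiff.continuous.comp continuous_subtype_val

theorem denseInDom_range_toLp : (closureForm ξ).DenseInDom (range (toLp ξ)) := by
  refine ⟨by rintro _ ⟨u, rfl⟩; exact toLp_mem_dom u, fun U hU ε hε => ?_⟩
  obtain ⟨W, hW⟩ := mem_dom_iff.1 hU
  obtain ⟨_, ⟨u, rfl⟩, hlt⟩ := exists_form₁_sub_lt hW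
    (𝒜 := range fun u : FC ξ => (toLp ξ u, gradLp ξ u))
    (by rintro _ ⟨u, rfl⟩; exact mem_gradGraph u) hW hε
  exact ⟨_, ⟨u, rfl⟩, hlt⟩

theorem isExceptional_empty : (closureForm ξ).IsExceptional ∅ :=
  ⟨_, isNest_normBall, empty_subset _⟩

/-- Inner products with a dense sequence of L₂(ξ) separate the points of L₂(ξ). A cutoff that equals
1 at both points brings them into 𝓕𝓒. -/
theorem exists_separating : ∃ u : ℕ → FC ξ, ∀ g g' : L2upOf ξ, g ≠ g' → ∃ n, (u n).1 g ≠ (u n).1 g' := by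
  set e := TopologicalSpace.denseSeq (L2sub ξ) with he
  let v : ℕ × ℕ → FC ξ := fun p =>
    ⟨_, cyl_mul_cutoff_mem_FC (IsCyl.inner (e p.1).2) p.2⟩
  refine ⟨fun n => v n.unpair, fun g g' hne => ?_⟩
  by_contra! h
  obtain ⟨R, hR⟩ := exists_nat_ge (max ‖(g : L2)‖ ‖(g' : L2)‖)
  have h1 : ∀ j, inner ℝ (g : L2) (e j : L2) = inner ℝ (g' : L2) (e j : L2) := by
    intro j
    have h2 := h (Nat.pair j R)
    simp only [v, Nat.unpair_pair] at h2
    rwa [cutoff_eq_one ((le_max_left _ _).trans hR), cutoff_eq_one ((le_max_right _ _).trans hR),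
      mul_one, mul_one] at h2
  have h2 : ∀ k : L2sub ξ, inner ℝ ((g : L2) - g') (k : L2) = 0 := by
    have hcont : Continuous fun k : L2sub ξ => (inner ℝ ((g : L2) - g') (k : L2) : ℝ) := by fun_prop
    have hcl : IsClosed {k : L2sub ξ | (inner ℝ ((g : L2) - g') (k : L2) : ℝ) = 0} :=
      isClosed_eq hcont continuous_const
    have hsub : range e ⊆ {k : L2sub ξ | (inner ℝ ((g : L2) - g') (k : L2) : ℝ) = 0} := by
      rintro _ ⟨j, rfl⟩
      rw [Set.mem_ofPred_eq, inner_sub_left, h1, sub_self]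
    intro k
    exact hcl.closure_subset_iff.2 hsub (TopologicalSpace.denseRange_denseSeq (L2sub ξ) k)
  have h3 := h2 ⟨(g : L2) - g', (L2sub ξ).sub_mem g.2.2 g'.2.2⟩
  rw [inner_self_eq_zero, sub_eq_zero] at h3
  exact hne (Subtype.ext h3)

theorem closureForm_isQuasiRegular : (closureForm ξ).IsQuasiRegular where
  compact_nest := ⟨_, isNest_normBall, isCompact_normBall ξ⟩
  dense_quasiContinuous := ⟨_, denseInDom_range_toLp, by
    rintro _ ⟨u, rfl⟩
    exact ⟨_, isQuasiContinuous_of_continuous (continuous_of_mem_FC u.2), (toLp_coeFn u).symm⟩⟩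
  separating := by
    obtain ⟨u, hu⟩ := exists_separating (ξ := ξ)
    exact ⟨fun n => toLp ξ (u n), fun n g => (u n).1 g, ∅, fun n => ⟨toLp_mem_dom _,
      isQuasiContinuous_of_continuous (continuous_of_mem_FC (u n).2), (toLp_coeFn _).symm⟩,
      isExceptional_empty, fun g _ g' _ hne => hu g g' hne⟩

end QuasiRegular
end StickyFlow

end

/-- A real-valued nondecreasing ξ on the compact interval lies between its values at 0 and 1, so
boundedness is built into the type. The sets K_n with n ≥ 1 appear with index n + 1. -/
theorem mainTheorem4 (ξ : StieltjesFunction unitInterval) (hξ : ContinuousAt ξ 1) :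
    StickyFlow.IsClosablePreForm ξ ∧
    (StickyFlow.closureForm ξ).IsDirichletForm ∧
    (StickyFlow.closureForm ξ).IsNest (fun n => StickyFlow.normBall ξ (n + 1)) ∧
    (∀ n : ℕ, IsCompact (StickyFlow.normBall ξ (n + 1))) ∧
    (StickyFlow.closureForm ξ).IsQuasiRegular ∧
    (StickyFlow.closureForm ξ).HasLocalProperty :=
  ⟨StickyFlow.isClosablePreForm, StickyFlow.closureForm_isDirichletForm,
    StickyFlow.isNest_normBall, StickyFlow.isCompact_normBall ξ,
    StickyFlow.closureForm_isQuasiRegular, StickyFlow.closureForm_local⟩
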